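/- Let $m\ge 2$, let $X$ be a smooth manifold of dimension $n$, and let $g_1,\dots,g_m$ be smooth vector fields on $X$, defining the driftless system $\dot x=\sum_{i=1}^m u_i g_i(x)$. Consider the distributions $$H_{0,2}=\{g_1,\dots,g_{m-1}\},\qquad H_{1,2}=\{g_1,\dots,g_{m-1},[g_m,g_1],\dots,[g_m,g_{m-1}]\},$$ $$H'_{1,2}=H_{1,2}+\{g_m\},\qquad H_{2,3}=H'_{1,2}+\{[g_m,[g_m,g_1]],\dots,[g_m,[g_m,g_{m-1}]]\},$$ where $\{\cdot\}$ denotes the pointwise linear span. For $\mathbf j\in\mathbb N^m$ put $|\mathbf j|=\sum_i j_i$. The pure prolongation of order $\mathbf j$ is the control system on $X\times\mathbb R^{|\mathbf j|}$ with states $x$ and $u_i^{(p)}$ ($0\le p<j_i$), inputs $u_i^{(j_i)}$, and equations $\dot x=\sum_i u_i^{(0)}g_i(x)$, $\dot u_i^{(p)}=u_i^{(p+1)}$. The system is P$^2$-flat of order $\mathbf j$ at a point of $X\times\mathbb R^{|\mathbf j|}$ if near this point its prolongation of order $\mathbf j$ is equivalent, by a smooth diffeomorphism of the states and a smooth regular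 feedback $u=a+bv$ ($b$ invertible), to a Brunovský system $y_i^{(\kappa_i)}=v_i$, $i=1,\dots,m$, with all $\kappa_i\ge1$; the tuple $(y_1,\dots,y_m)$, as functions of the prolonged state, is then called a flat output of order $\mathbf j$ at the point. The order $\mathbf j$ is called minimal if for no $\mathbf j'$ with $|\mathbf j'|<|\mathbf j|$ is the system P$^2$-flat of order $\mathbf j'$ at any point of $X\times\mathbb R^{|\mathbf j'|}$. Functions $y_1,\dots,y_m$ of the prolonged state are differentially independent at a point if, for every $r$, the differentials of their time derivatives $y_i^{(k)}$, $1\le i\le m$, $0\le k\le r$, along the system (as functions of $x$ and of the inputs and their derivatives) are linearly independent over this point. 1. Let $n=2m-1$. If $H_{0,2}$ is involutive and $H'_{1,2}$ has rank $2m-1$ everywhere, then the system is P$^2$-flat of order $\mathbf j=(0,\dots,0,1)$ at every point with $u_m^{(0)}\neq0$, and this order is minimal. At such a point, $(y_1,\dots,y_m)$ is a flat output of order $\mathbf j$ if and only if, near the point, the $y_i$ are smooth functions of $x$ only, with differentials that annihilate $H_{0,2}$ and are linearly independent at the point. 2. Let $n=2m$. If $H_{0,2}$ and $H_{1,2}$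 are involutive, $H_{1,2}$ has rank $2m-2$ everywhere and $H_{2,3}=TX$, then the system is P$^2$-flat of order $\mathbf j=(0,\dots,0,2)$ at every point with $u_m^{(0)}\neq0$, and this order is minimal. At such a point, $(y_1,\dots,y_m)$ is a flat output of order $\mathbf j$ if and only if, after a permutation of the $y_i$, they are smooth near the point and differentially independent at it and, near the point, $y_1,y_2$ are functions of $x$ only with differentials that annihilate $H_{1,2}$, while $y_3,\dots,y_m$ are functions of $x$ and $u_m^{(0)}$ only with differentials that annihilate $H_{0,2}$ (regarded as vector fields on the prolonged space). -/

import Mathlib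

open scoped Manifold ContDiff Topology

noncomputable section

namespace PureProlongation

variable {E : Type*} [NormedAddCommGroup E] [NormedSpace ℝ E]
  {H : Type*} [TopologicalSpace H] (I : ModelWithCorners ℝ E H)
  {M : Type*} [TopologicalSpace M] [ChartedSpace H M]

/-! ### Vector fields, distributions, differentials -/

/-- The vector field `V` is smooth on the set `U`. -/
def SmoothFieldOn [IsManifold I 1 M] (V : (x : M) → TangentSpace I x) (U : Set M) : Prop :=
  ContMDiffOn I I.tangent ∞ (fun x => (⟨x, V x⟩ : TangentBundle I M)) U

/-- A distribution `D` is involutive if it is closed under the Lie bracket of local smooth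
vector fields with values in `D`. -/
def Involutive [IsManifold I 1 M] (D : (x : M) → Submodule ℝ (TangentSpace I x)) : Prop :=
  ∀ U : Set M, IsOpen U → ∀ V W : (x : M) → TangentSpace I x,
    SmoothFieldOn I V U → SmoothFieldOn I W U →
    (∀ x ∈ U, V x ∈ D x) → (∀ x ∈ U, W x ∈ D x) →
    ∀ x ∈ U, VectorField.mlieBracket I V W x ∈ D x

/-- The differential at `q` of a real function. -/
def differential (h : M → ℝ) (q : M) : TangentSpace I q →L[ℝ] ℝ :=
  mfderiv I 𝓘(ℝ, ℝ) h q

/-- The Lie derivative of a real function along a vector field. -/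
def lieDeriv (V : (x : M) → TangentSpace I x) (h : M → ℝ) (q : M) : ℝ :=
  differential I h q (V q)

/-- `h` is smooth in a neighbourhood of `p`. -/
def SmoothNear (h : M → ℝ) (p : M) : Prop :=
  ∃ U : Set M, IsOpen U ∧ p ∈ U ∧ ContMDiffOn I 𝓘(ℝ, ℝ) ∞ h U

/-! ### The distributions built on input vector fields `g` with distinguished input `l` -/

section Distributions

variable {m : ℕ} (g : Fin m → (x : M) → TangentSpace I x) (l : Fin m)

/-- `{g_i : i ≠ l}`. -/
def H02 (x : M) : Submodule ℝ (TangentSpace I x) :=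
  Submodule.span ℝ {w | ∃ i, i ≠ l ∧ w = g i x}

/-- `{g_i, [g_l, g_i] : i ≠ l}`. -/
def H12 (x : M) : Submodule ℝ (TangentSpace I x) :=
  H02 I g l x ⊔
    Submodule.span ℝ {w | ∃ i, i ≠ l ∧ w = VectorField.mlieBracket I (g l) (g i) x}

/-- `{g_l, g_i, [g_l, g_i] : i ≠ l}`. -/
def H12' (x : M) : Submodule ℝ (TangentSpace I x) :=
  H12 I g l x ⊔ Submodule.span ℝ {g l x}

/-- `{g_l, g_i, [g_l, g_i], [g_l, [g_l, g_i]] : i ≠ l}`. -/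
def H23 (x : M) : Submodule ℝ (TangentSpace I x) :=
  H12' I g l x ⊔
    Submodule.span ℝ {w | ∃ i, i ≠ l ∧
      w = VectorField.mlieBracket I (g l) (VectorField.mlieBracket I (g l) (g i)) x}

end Distributions

/-! ### Control systems and Brunovský form -/

/-- The control-affine system `ẋ = f(x) + ∑ i, u_i g_i(x)` on `M` with `m` inputs. -/
structure ControlAffineSystem (M : Type*) [TopologicalSpace M] [ChartedSpace H M] (m : ℕ) where
  /-- the drift `f` -/
  drift : (x : M) → TangentSpace I x
  /-- the input vector fields `g_i` -/
  input : Fin m → (x : M) → TangentSpace I x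

/-- The driftless system `ẋ = ∑ i, u_i g_i(x)`. -/
def driftless {m : ℕ} (g : Fin m → (x : M) → TangentSpace I x) : ControlAffineSystem I M m where
  drift := fun _ => 0
  input := g

/-- Real families indexed by pairs `(i, p)` with `p < k i`, that is, `ℝ^|k|`. -/
abbrev Chains {m : ℕ} (k : Fin m → ℕ) : Type := ((i : Fin m) × Fin (k i)) → ℝ

/-- The right-hand side of the Brunovský system with indices `κ`:
`ż_{i,p} = z_{i,p+1}` for `p + 1 < κ i`, and `ż_{i,κ i - 1} = v_i`. -/
def brunovsky {m : ℕ} (κ : Fin m → ℕ) (z : Chains κ) (v : Fin m → ℝ) : Chains κ :=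
  fun c => if h : (c.2 : ℕ) + 1 < κ c.1 then z ⟨c.1, ⟨(c.2 : ℕ) + 1, h⟩⟩ else v c.1

variable {I}

/-- A local equivalence, near `p`, of the system `S` with a Brunovský system, through a smooth
diffeomorphism `z = φ(x)` and a smooth regular feedback `u = a(x) + b(x) v`. -/
structure BrunovskyLinearization {m : ℕ} (S : ControlAffineSystem I M m) (p : M) where
  /-- the Brunovský indices -/
  κ : Fin m → ℕ
  κ_pos : ∀ i, 0 < κ i
  /-- the diffeomorphism -/
  φ : OpenPartialHomeomorph M (Chains κ)
  mem_source : p ∈ φ.source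
  smooth : ContMDiffOn I 𝓘(ℝ, Chains κ) ∞ φ φ.source
  smooth_symm : ContMDiffOn 𝓘(ℝ, Chains κ) I ∞ φ.symm φ.target
  /-- the feedback `u = a(x) + b(x) v` -/
  a : M → Fin m → ℝ
  b : M → Matrix (Fin m) (Fin m) ℝ
  smooth_a : ∀ i, ContMDiffOn I 𝓘(ℝ, ℝ) ∞ (fun q => a q i) φ.source
  smooth_b : ∀ i k, ContMDiffOn I 𝓘(ℝ, ℝ) ∞ (fun q => b q i k) φ.source
  regular : ∀ q ∈ φ.source, IsUnit (b q)
  conj : ∀ q ∈ φ.source, ∀ v : Fin m → ℝ,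
    mfderiv I 𝓘(ℝ, Chains κ) φ q
      (S.drift q + ∑ i, (a q i + (b q).mulVec v i) • S.input i q) = brunovsky κ (φ q) v

/-- The functions `z_{i,0}`, heads of the integrator chains. -/
def BrunovskyLinearization.output {m : ℕ} {S : ControlAffineSystem I M m} {p : M}
    (L : BrunovskyLinearization S p) (i : Fin m) (q : M) : ℝ :=
  L.φ q ⟨i, ⟨0, L.κ_pos i⟩⟩

/-! ### Pure prolongations -/

/-- The coordinate `u_i^(p)` of the prolonged state, for `p < j i`; it is `0` for `p ≥ j i`, where
`u_i^(p)` is not a state of the prolonged system. -/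
def inputDeriv {m : ℕ} {j : Fin m → ℕ} (ν : Chains j) (i : Fin m) (p : ℕ) : ℝ :=
  if h : p < j i then ν ⟨i, ⟨p, h⟩⟩ else 0

variable (I) in
/-- The tangent vector of `M × ℝ^|j|` with components `w` and `ν`. -/
def tangentPair {m : ℕ} {j : Fin m → ℕ} (q : M × Chains j) (w : TangentSpace I q.1)
    (ν : Chains j) : TangentSpace (I.prod 𝓘(ℝ, Chains j)) q :=
  ((w, ν) : E × Chains j)

/-- The pure prolongation of order `j` of `S`. Its states are `x` and `u_i^(p)` for `p < j i`, its
`i`-th input is `u_i^(j i)`. -/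
def ControlAffineSystem.prolong {m : ℕ} (S : ControlAffineSystem I M m) (j : Fin m → ℕ) :
    ControlAffineSystem (I.prod 𝓘(ℝ, Chains j)) (M × Chains j) m where
  drift := fun q => tangentPair I q
    (S.drift q.1 + ∑ i, inputDeriv q.2 i 0 • S.input i q.1)
    (fun c => inputDeriv q.2 c.1 ((c.2 : ℕ) + 1))
  input := fun i q => tangentPair I q
    (if j i = 0 then S.input i q.1 else 0)
    (fun c => if c.1 = i ∧ (c.2 : ℕ) + 1 = j c.1 then 1 else 0)

/-- `S` is flat by pure prolongation of order `j` at `p`: the prolonged system is, near `p`,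
equivalent by diffeomorphism and feedback to a Brunovský system. -/
def P2FlatAt {m : ℕ} (S : ControlAffineSystem I M m) (j : Fin m → ℕ) (p : M × Chains j) : Prop :=
  Nonempty (BrunovskyLinearization (S.prolong j) p)

/-- No pure prolongation of smaller total order makes `S` linearizable, at any point. -/
def NoShorterProlongation {m : ℕ} (S : ControlAffineSystem I M m) (j : Fin m → ℕ) : Prop :=
  ∀ j' : Fin m → ℕ, ∑ i, j' i < ∑ i, j i → ∀ p : M × Chains j', ¬ P2FlatAt S j' p

/-- `y = (y_1, …, y_m)` is, near `p`, the flat output given by a Brunovský form of the prolonged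
system of order `j`. -/
def IsFlatOutputAt {m : ℕ} (S : ControlAffineSystem I M m) (j : Fin m → ℕ) (p : M × Chains j)
    (y : Fin m → M × Chains j → ℝ) : Prop :=
  ∃ L : BrunovskyLinearization (S.prolong j) p, ∀ i, ∀ q ∈ L.φ.source, y i q = L.output i q

/-- The projection of the prolongation of order `j + r` onto that of order `j`, which forgets the
input derivatives `u_i^(p)` with `p ≥ j i`. -/
def forget {m : ℕ} {j : Fin m → ℕ} (r : ℕ) (q : M × Chains (fun i => j i + r)) : M × Chains j :=
  (q.1, fun c => inputDeriv q.2 c.1 c.2)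

/-- The `k`-th time derivative, along the system, of a function `h` of `x` and `u_i^(p)`, `p < j i`.
It depends on `x` and `u_i^(p)` for `p < j i + k` only, and is given as a function on the
prolongation of order `j + r`, for any `r ≥ k`. -/
def timeDeriv {m : ℕ} (S : ControlAffineSystem I M m) {j : Fin m → ℕ} (h : M × Chains j → ℝ)
    (r k : ℕ) : M × Chains (fun i => j i + r) → ℝ :=
  (lieDeriv (I.prod 𝓘(ℝ, Chains (fun i => j i + r)))
    (S.prolong (fun i => j i + r)).drift)^[k] (h ∘ forget r)

/-- `y_1, …, y_m` are differentially independent at `p`: the differentials of `y_i^(k)`,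
`1 ≤ i ≤ m`, `0 ≤ k ≤ r`, are linearly independent over `p`, for every `r`. -/
def DifferentiallyIndependentAt {m : ℕ} (S : ControlAffineSystem I M m) {j : Fin m → ℕ}
    (y : Fin m → M × Chains j → ℝ) (p : M × Chains j) : Prop :=
  ∀ r : ℕ, ∀ q : M × Chains (fun i => j i + r), forget r q = p →
    LinearIndependent ℝ (fun c : Fin m × Fin (r + 1) =>
      differential (I.prod 𝓘(ℝ, Chains (fun i => j i + r))) (timeDeriv S (y c.1) r c.2) q)

/-- Near `p`, the function `h` on `M × ℝ^|j|` does not depend on the inputs and their derivatives,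
and its differential annihilates the distribution `D` on `M`. -/
def InputFreeAnnihilates {m : ℕ} {j : Fin m → ℕ} (D : (x : M) → Submodule ℝ (TangentSpace I x))
    (h : M × Chains j → ℝ) (p : M × Chains j) : Prop :=
  ∀ᶠ q in 𝓝 p, ∀ w ∈ D q.1, ∀ ν : Chains j,
    differential (I.prod 𝓘(ℝ, Chains j)) h q (tangentPair I q w ν) = 0

/-- Near `p`, the function `h` on `M × ℝ^|j|` does not depend on the input derivatives `u_i^(p)`
with `p ≥ 1`, and its differential annihilates the distribution `D` on `M`. -/
def DerivFreeAnnihilates {m : ℕ} {j : Fin m → ℕ} (D : (x : M) → Submodule ℝ (TangentSpace I x))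
    (h : M × Chains j → ℝ) (p : M × Chains j) : Prop :=
  ∀ᶠ q in 𝓝 p, ∀ w ∈ D q.1, ∀ ν : Chains j, (∀ i, inputDeriv ν i 0 = 0) →
    differential (I.prod 𝓘(ℝ, Chains j)) h q (tangentPair I q w ν) = 0

/-- The solutions near `p` of the equations for the flat outputs with `2m - 1` states: smooth
functions of `x` with differentials that annihilate `H02` and are linearly independent at `p`. -/
def OutputEquationsOdd {m : ℕ} (g : Fin m → (x : M) → TangentSpace I x) (l : Fin m)
    {j : Fin m → ℕ} (y : Fin m → M × Chains j → ℝ) (p : M × Chains j) : Prop :=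
  (∀ i, SmoothNear (I.prod 𝓘(ℝ, Chains j)) (y i) p) ∧
  (∀ i, InputFreeAnnihilates (H02 I g l) (y i) p) ∧
  LinearIndependent ℝ (fun i => differential (I.prod 𝓘(ℝ, Chains j)) (y i) p)

/-- The solutions near `p` of the equations for the flat outputs with `2m` states: smooth
differentially independent functions, the first two of them functions of `x` with differentials
that annihilate `H12`, the others functions of `x` and prolonged inputs `u_i^(0)` with
differentials that annihilate `H02`. -/
def OutputEquationsEven {m : ℕ} (g : Fin m → (x : M) → TangentSpace I x) (l : Fin m)
    {j : Fin m → ℕ} (y : Fin m → M × Chains j → ℝ) (p : M × Chains j) : Prop :=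
  (∀ i, SmoothNear (I.prod 𝓘(ℝ, Chains j)) (y i) p) ∧
  (∀ i : Fin m, (i : ℕ) < 2 → InputFreeAnnihilates (H12 I g l) (y i) p) ∧
  (∀ i : Fin m, 2 ≤ (i : ℕ) → DerivFreeAnnihilates (H02 I g l) (y i) p) ∧
  DifferentiallyIndependentAt (driftless I g) y p

end PureProlongation

end

noncomputable section

namespace PureProlongation

/-! ### Inverse function theorem on a neighbourhood -/

/-! Write `F` for the drift of a prolongation, `B_k` for its input fields and `u` for the prolonged
input `u_l`. A Brunovský form with outputs `y_i` and indices `κ_i` amounts to three facts: every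
`B_k` annihilates the derivatives of `y_i` of order below `κ_i - 1`; all derivatives of order below
`κ_i` are local coordinates, so that `∑ κ_i` is the dimension of the prolonged state; and the
decoupling matrix of the `B_k` applied to the last members of the chains is invertible.

Upper bound on the indices (`exists_κ_le`). The successive brackets of `B_k` with `F` are the
coordinate fields of `u_k^(p)` for decreasing `p`, and then `g_k` (`tower`). If `κ_i ≥ j_k + 2` for
every `k`, all these fields annihilate `y_i`; hence so do the brackets of the `g_k`, which span the
tangent space because `H12'` or `H23` does, and `dy_i = 0`, which is absurd. So `κ_i ≤ max j + 1`,
and counting dimensions gives `n + |j| ≤ m (|j| + 1)` (`finrank_add_le_of_P2FlatAt`). This excludes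
`|j| = 0` when `n = 2m - 1`, and `|j| ≤ 1` when `n = 2m`, which is minimality.

Flat outputs satisfy the equations. For `n = 2m - 1` the indices are at most 2 with sum `2m`, so all
equal 2, and the outputs are annihilated by the `B_k`, which are the lifts of `g_i` for `i ≠ l`
together with `∂/∂u`. For `n = 2m` the indices are at most 3 with sum `2m + 2`. An output with index
3 is annihilated also by the `[B_k, F]`, and hence, where `u ≠ 0`, it is a first integral of `H12`,
of corank 2. So at most two indices are 3, and the sum forces exactly two of them to be 3 and the
others to be 2. Differential independence holds for every Brunovský output
(`differentiallyIndependentAt_output`).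

Solutions are flat outputs (`isFlatOutputAt_of_linearIndependent`). When the `B_k` and `[B_k, F]`
are independent, invertibility of the decoupling matrix follows from independence of the lower
derivatives alone: a kernel vector would make a combination of the `[B_k, F]` annihilated by as many
forms as cut out the span of the `B_k`. The rank hypotheses and `u ≠ 0` give independence of the
`B_k` and their brackets.

Existence rests on the Frobenius theorem (`exists_firstIntegrals_manifold`), proved here from the
integrability of `dy = a(t, y) dt`: this equation is solved along rays by the inverse function
theorem in a space of continuous paths. For `n = 2m - 1` the `m` first integrals of `H02` are the
outputs. For `n = 2m` the two first integrals of `H12` and their time derivatives are independent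
because `H23 = TX` (`linearIndependent_firstIntegrals`); a Steinitz exchange with `u` and the first
integrals of `H02` supplies the remaining `m - 2` outputs. -/

/-- A smooth map with invertible derivative at `a` restricts to a diffeomorphism between open sets,
with smooth inverse on the whole target. -/
theorem exists_openPartialHomeomorph_of_contDiffOn {E F : Type*} [NormedAddCommGroup E]
    [NormedSpace ℝ E] [CompleteSpace E] [NormedAddCommGroup F] [NormedSpace ℝ F]
    {f : E → F} {U : Set E} (hU : IsOpen U)
    (hf : ContDiffOn ℝ ∞ f U) {a : E} (ha : a ∈ U) (f' : E ≃L[ℝ] F)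
    (hf' : HasFDerivAt f (f' : E →L[ℝ] F) a) :
    ∃ e : OpenPartialHomeomorph E F, a ∈ e.source ∧ e.source ⊆ U ∧ (e : E → F) = f ∧
      ContDiffOn ℝ ∞ e.symm e.target := by
  have hfa : ContDiffAt ℝ ∞ f a := hf.contDiffAt (hU.mem_nhds ha)
  have hne : (∞ : WithTop ℕ∞) ≠ 0 := by simp
  set e₀ := hfa.toOpenPartialHomeomorph f hf' hne with he₀
  have he₀f : (e₀ : E → F) = f := hfa.toOpenPartialHomeomorph_coe hf' hne
  have hsrc : a ∈ e₀.source := hfa.mem_toOpenPartialHomeomorph_source hf' hne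
  -- Invertibility of the derivative is an open condition; restricting to it makes the inverse
  -- smooth on the whole target, not only at the image of `a`.
  set W : Set E := U ∩ fderiv ℝ f ⁻¹' Set.range ((↑) : (E ≃L[ℝ] F) → E →L[ℝ] F) with hW
  have hWo : IsOpen W :=
    (hf.continuousOn_fderiv_of_isOpen hU (by simp)).isOpen_inter_preimage hU
      ContinuousLinearEquiv.isOpen
  have haW : a ∈ W := ⟨ha, f', by rw [hf'.fderiv]⟩
  refine ⟨e₀.restrOpen W hWo, ⟨hsrc, haW⟩, fun x hx => hx.2.1, he₀f, fun y hy => ?_⟩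
  have hy1 : y ∈ e₀.target := by
    have := OpenPartialHomeomorph.map_source _ ((e₀.restrOpen W hWo).map_target hy)
    exact hy.1
  have hyW : e₀.symm y ∈ W := ((e₀.restrOpen W hWo).map_target hy).2
  obtain ⟨hyU, g', hg'⟩ := hyW
  have hd : ContDiffAt ℝ ∞ f (e₀.symm y) := hf.contDiffAt (hU.mem_nhds hyU)
  have : ContDiffAt ℝ ∞ e₀.symm y := by
    refine e₀.contDiffAt_symm (f₀' := g') hy1 ?_ ?_
    · rw [he₀f, hg']; exact (hd.differentiableAt hne).hasFDerivAt
    · rw [he₀f]; exact hd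
  exact this.contDiffWithinAt

/-! ### Composition operators on spaces of continuous maps -/

section Nemytskii

universe u

variable {K : Type*} [TopologicalSpace K] [CompactSpace K]

/-- Pointwise evaluation of a continuous family of linear maps. -/
def pointwiseApply (K : Type*) [TopologicalSpace K] [CompactSpace K]
    (E F : Type*) [NormedAddCommGroup E] [NormedSpace ℝ E]
    [NormedAddCommGroup F] [NormedSpace ℝ F] :
    C(K, E →L[ℝ] F) →L[ℝ] C(K, E) →L[ℝ] C(K, F) :=
  LinearMap.mkContinuous₂
    (LinearMap.mk₂ ℝ (fun (A : C(K, E →L[ℝ] F)) (γ : C(K, E)) =>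
      (⟨fun s => A s (γ s), by fun_prop⟩ : C(K, F)))
      (by intros; ext; simp) (by intros; ext; simp) (by intros; ext; simp) (by intros; ext; simp))
    1 (by
      intro A γ
      rw [ContinuousMap.norm_le _ (by positivity)]
      intro s
      simp only [LinearMap.mk₂_apply, ContinuousMap.coe_mk, one_mul]
      refine ((A s).le_opNorm _).trans ?_
      gcongr
      · exact A.norm_coe_le_norm s
      · exact γ.norm_coe_le_norm s)

@[simp]
theorem pointwiseApply_apply {E F : Type*} [NormedAddCommGroup E] [NormedSpace ℝ E]
    [NormedAddCommGroup F] [NormedSpace ℝ F] (A : C(K, E →L[ℝ] F)) (γ : C(K, E)) (s : K) :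
    pointwiseApply K E F A γ s = A s (γ s) := rfl

/-- The mean value inequality on the segment from `γ s` to `γ s + η s` bounds the remainder
pointwise. The bound is uniform in `s` because a point of this segment is the value at `s` of a path
`γ + t • η`, and `γ ↦ f' ∘ γ` is continuous for the supremum norm. -/
theorem hasFDerivAt_postcomp {E F : Type*} [NormedAddCommGroup E] [NormedSpace ℝ E]
    [NormedAddCommGroup F] [NormedSpace ℝ F] (f : C(E, F)) (f' : C(E, E →L[ℝ] F))
    (hf : ∀ x, HasFDerivAt f (f' x) x) (γ : C(K, E)) :
    HasFDerivAt (fun γ : C(K, E) => f.comp γ) (pointwiseApply K E F (f'.comp γ)) γ := by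
  rw [hasFDerivAt_iff_isLittleO_nhds_zero, Asymptotics.isLittleO_iff]
  intro c hc
  have hcont : ContinuousAt (fun γ : C(K, E) => f'.comp γ) γ :=
    (ContinuousMap.continuous_postcomp f').continuousAt
  obtain ⟨δ, hδ, hball⟩ :=
    (Metric.continuousAt_iff (α := C(K, E)) (β := C(K, E →L[ℝ] F))).1 hcont c hc
  filter_upwards [Metric.ball_mem_nhds (0 : C(K, E)) hδ] with η hη
  rw [mem_ball_zero_iff] at hη
  rw [ContinuousMap.norm_le _ (by positivity)]
  intro s
  have key : ‖f (γ s + η s) - f (γ s) - f' (γ s) (γ s + η s - γ s)‖ ≤ c * ‖γ s + η s - γ s‖ := by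
    refine (convex_segment (γ s) (γ s + η s)).norm_image_sub_le_of_norm_hasFDerivWithin_le'
      (f := f) (f' := f') (fun x _ => (hf x).hasFDerivWithinAt) ?_
      (left_mem_segment ..) (right_mem_segment ..)
    rintro x hx
    rw [segment_eq_image'] at hx
    obtain ⟨t, ⟨ht0, ht1⟩, rfl⟩ := hx
    have h1 : dist (γ + t • η) γ < δ := by
      rw [dist_eq_norm, add_sub_cancel_left, norm_smul, Real.norm_eq_abs, abs_of_nonneg ht0]
      nlinarith [norm_nonneg η]
    have h2 := ((ContinuousMap.dist_apply_le_dist s).trans_lt (hball h1)).le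
    rw [dist_eq_norm] at h2
    simpa using h2
  have : ‖η s‖ ≤ ‖η‖ := η.norm_coe_le_norm s
  simp only [add_sub_cancel_left] at key
  calc _ = ‖f (γ s + η s) - f (γ s) - f' (γ s) (η s)‖ := by simp
    _ ≤ c * ‖η s‖ := key
    _ ≤ c * ‖η‖ := by gcongr

/-- The derivative of composition with `f` is again a composition operator, with `f'`, followed by
the bounded bilinear map `pointwiseApply`; hence induction on the order. The codomain varies in the
induction, from `F` to `E →L[ℝ] F`, which is why `E` and `F` share a universe. -/
theorem contDiff_nat_postcomp {E : Type u} [NormedAddCommGroup E] [NormedSpace ℝ E] (n : ℕ) :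
    ∀ {F : Type u} [NormedAddCommGroup F] [NormedSpace ℝ F] (f : C(E, F)),
      ContDiff ℝ ∞ f → ContDiff ℝ n (fun γ : C(K, E) => f.comp γ) := by
  induction n with
  | zero =>
    intro F _ _ f hf
    exact contDiff_zero.2 (ContinuousMap.continuous_postcomp f)
  | succ n ih =>
    intro F _ _ f hf
    have hf' : ContDiff ℝ ∞ (fderiv ℝ f) := hf.fderiv_right (by simp)
    set f' : C(E, E →L[ℝ] F) := ⟨fderiv ℝ f, hf'.continuous⟩
    have hd := fun γ : C(K, E) => hasFDerivAt_postcomp (K := K) f f'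
      (fun x => ((hf.differentiable (by simp)) x).hasFDerivAt) γ
    refine (contDiff_succ_iff_hasFDerivAt (𝕜 := ℝ) (n := n)).2 ⟨_, ?_, hd⟩
    exact (pointwiseApply K E F).contDiff.comp (ih f' hf')

theorem contDiff_postcomp {E F : Type u} [NormedAddCommGroup E] [NormedSpace ℝ E]
    [NormedAddCommGroup F] [NormedSpace ℝ F] (f : C(E, F)) (hf : ContDiff ℝ ∞ f) :
    ContDiff ℝ ∞ (fun γ : C(K, E) => f.comp γ) :=
  contDiff_infty.2 fun n => contDiff_nat_postcomp n f hf

end Nemytskii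

/-! ### The total differential equation `dy = a(t, y) dt` -/

section Frobenius

universe u

set_option linter.unusedSectionVars false

variable {T Y : Type u} [NormedAddCommGroup T] [NormedSpace ℝ T] [FiniteDimensional ℝ T]
  [NormedAddCommGroup Y] [NormedSpace ℝ Y] [FiniteDimensional ℝ Y]

/-- The primitive vanishing at `0` of a continuous path. -/
def pathPrimitive (Y : Type*) [NormedAddCommGroup Y] [NormedSpace ℝ Y] :
    C(unitInterval, Y) →L[ℝ] C(unitInterval, Y) :=
  LinearMap.mkContinuous
    { toFun := fun γ => ⟨fun s => ∫ σ in (0 : ℝ)..s, Set.IccExtend zero_le_one γ σ,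
        (intervalIntegral.continuous_primitive
          (fun a b => (γ.continuous.Icc_extend' (h := zero_le_one)).intervalIntegrable a b) 0).comp
            continuous_subtype_val⟩
      map_add' := by
        intro γ γ'
        ext s
        simp only [ContinuousMap.coe_mk, ContinuousMap.add_apply]
        rw [← intervalIntegral.integral_add
          ((γ.continuous.Icc_extend' (h := zero_le_one)).intervalIntegrable _ _)
          ((γ'.continuous.Icc_extend' (h := zero_le_one)).intervalIntegrable _ _)]
        rfl
      map_smul' := by
        intro c γ
        ext s
        simp only [ContinuousMap.coe_mk, ContinuousMap.smul_apply, RingHom.id_apply]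
        rw [← intervalIntegral.integral_smul]
        rfl }
    1 (by
      intro γ
      rw [ContinuousMap.norm_le _ (by positivity)]
      intro s
      have := intervalIntegral.norm_integral_le_of_norm_le_const (a := (0 : ℝ)) (b := s)
        (f := Set.IccExtend zero_le_one γ) (C := ‖γ‖) (fun x _ => γ.norm_coe_le_norm _)
      refine this.trans ?_
      rw [sub_zero, abs_of_nonneg s.2.1, one_mul]
      exact mul_le_of_le_one_right (norm_nonneg _) s.2.2)

theorem pathPrimitive_apply (γ : C(unitInterval, Y)) (s : unitInterval) :
    pathPrimitive Y γ s = ∫ σ in (0 : ℝ)..s, Set.IccExtend zero_le_one γ σ := rfl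

/-- The constant path, as a linear map. -/
def constPath (Y : Type*) [NormedAddCommGroup Y] [NormedSpace ℝ Y] [FiniteDimensional ℝ Y] :
    Y →L[ℝ] C(unitInterval, Y) :=
  LinearMap.toContinuousLinearMap
    { toFun := fun y => ContinuousMap.const _ y
      map_add' := by intros; rfl
      map_smul' := by intros; rfl }

@[simp]
theorem constPath_apply (y : Y) (s : unitInterval) : constPath Y y s = y := rfl

/-- The ray from `0` to `t`, as a linear map. -/
def rayPath (T : Type*) [NormedAddCommGroup T] [NormedSpace ℝ T] [FiniteDimensional ℝ T] :
    T →L[ℝ] C(unitInterval, T) :=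
  LinearMap.toContinuousLinearMap
    { toFun := fun t => ⟨fun s => (s : ℝ) • t, by fun_prop⟩
      map_add' := by intros; ext; simp
      map_smul' := by intro c t; ext s; exact smul_comm (s : ℝ) c t }

@[simp]
theorem rayPath_apply (t : T) (s : unitInterval) : rayPath T t s = (s : ℝ) • t := rfl

/-- The path `s ↦ (s t, γ s)`, as a linear map of `(γ, t, y)`. -/
def graphPath (T Y : Type*) [NormedAddCommGroup T] [NormedSpace ℝ T] [FiniteDimensional ℝ T]
    [NormedAddCommGroup Y] [NormedSpace ℝ Y] :
    C(unitInterval, Y) × (T × Y) →L[ℝ] C(unitInterval, T × Y) :=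
  ((ContinuousLinearMap.inl ℝ T Y).compLeftContinuous ℝ unitInterval).comp
      ((rayPath T).comp ((ContinuousLinearMap.fst ℝ T Y).comp (ContinuousLinearMap.snd ℝ _ _))) +
    ((ContinuousLinearMap.inr ℝ T Y).compLeftContinuous ℝ unitInterval).comp
      (ContinuousLinearMap.fst ℝ _ _)

@[simp]
theorem graphPath_apply (q : C(unitInterval, Y) × (T × Y)) (s : unitInterval) :
    graphPath T Y q s = ((s : ℝ) • q.2.1, q.1 s) := by
  simp [graphPath]

/-- The integral operator whose zeros are the solutions along rays of `dy = a(t, y) dt`. -/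
def rayOperator (a : C(T × Y, T →L[ℝ] Y)) (q : C(unitInterval, Y) × (T × Y)) :
    C(unitInterval, Y) :=
  q.1 - constPath Y q.2.2 - pathPrimitive Y
    (pointwiseApply unitInterval T Y (a.comp (graphPath T Y q)) (constPath T q.2.1))

theorem contDiff_rayOperator (a : C(T × Y, T →L[ℝ] Y)) (ha : ContDiff ℝ ∞ a) :
    ContDiff ℝ ∞ (rayOperator a) := by
  have h1 : ContDiff ℝ ∞ (fun q : C(unitInterval, Y) × (T × Y) => a.comp (graphPath T Y q)) :=
    (contDiff_postcomp a ha).comp (graphPath T Y).contDiff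
  unfold rayOperator
  refine (contDiff_fst.sub ((constPath Y).contDiff.comp (contDiff_snd.comp contDiff_snd))).sub ?_
  refine (pathPrimitive Y).contDiff.comp ?_
  exact ((pointwiseApply unitInterval T Y).contDiff.comp h1).clm_apply
    ((constPath T).contDiff.comp (contDiff_fst.comp contDiff_snd))

/-- The derivative of `a` as a continuous map. -/
def fderivMap (a : C(T × Y, T →L[ℝ] Y)) (ha : ContDiff ℝ ∞ a) :
    C(T × Y, (T × Y) →L[ℝ] T →L[ℝ] Y) :=
  ⟨fderiv ℝ a, ha.continuous_fderiv (by simp)⟩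

theorem fderiv_rayOperator_apply (a : C(T × Y, T →L[ℝ] Y)) (ha : ContDiff ℝ ∞ a)
    (q v : C(unitInterval, Y) × (T × Y)) :
    fderiv ℝ (rayOperator a) q v = v.1 - constPath Y v.2.2 - pathPrimitive Y
      (pointwiseApply unitInterval T Y (a.comp (graphPath T Y q)) (constPath T v.2.1) +
       pointwiseApply unitInterval T Y
        (pointwiseApply unitInterval (T × Y) (T →L[ℝ] Y) ((fderivMap a ha).comp (graphPath T Y q))
          (graphPath T Y v)) (constPath T q.2.1)) := by
  have h0 : HasFDerivAt (fun γ : C(unitInterval, T × Y) => a.comp γ) _ (graphPath T Y q) :=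
    hasFDerivAt_postcomp a (fderivMap a ha)
    (fun x => (ha.differentiable (by simp) x).hasFDerivAt) (graphPath T Y q)
  have h1 : HasFDerivAt (fun q : C(unitInterval, Y) × (T × Y) => a.comp (graphPath T Y q)) _ q :=
    HasFDerivAt.comp (F := C(unitInterval, T × Y)) (G := C(unitInterval, T →L[ℝ] Y))
      (g := fun γ => a.comp γ) q h0 (graphPath T Y).hasFDerivAt
  have h2 : HasFDerivAt (fun q : C(unitInterval, Y) × (T × Y) =>
      pointwiseApply unitInterval T Y (a.comp (graphPath T Y q))) _ q :=
    HasFDerivAt.comp (F := C(unitInterval, T →L[ℝ] Y))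
      (G := C(unitInterval, T) →L[ℝ] C(unitInterval, Y))
      (g := fun A => pointwiseApply unitInterval T Y A) q
      (pointwiseApply unitInterval T Y).hasFDerivAt h1
  have h2' : HasFDerivAt (fun q : C(unitInterval, Y) × (T × Y) =>
      pointwiseApply unitInterval T Y (a.comp (graphPath T Y q)) (constPath T q.2.1)) _ q :=
    HasFDerivAt.clm_apply (G := C(unitInterval, T)) (H := C(unitInterval, Y)) h2
      ((constPath T).hasFDerivAt.comp q (hasFDerivAt_fst.comp q hasFDerivAt_snd))
  have h3 := (HasFDerivAt.sub (hasFDerivAt_fst (E := C(unitInterval, Y)) (F := T × Y) (p := q))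
    ((constPath Y).hasFDerivAt.comp q
    (hasFDerivAt_snd.comp q hasFDerivAt_snd))).sub (HasFDerivAt.comp (F := C(unitInterval, Y))
      (G := C(unitInterval, Y)) (g := fun γ => pathPrimitive Y γ) q
      (pathPrimitive Y).hasFDerivAt h2')
  have h4 : HasFDerivAt (rayOperator a) _ q := h3
  rw [h4.fderiv]
  rfl

end Frobenius

section Frobenius

universe u

variable {T Y : Type u} [NormedAddCommGroup T] [NormedSpace ℝ T] [FiniteDimensional ℝ T]
  [NormedAddCommGroup Y] [NormedSpace ℝ Y] [FiniteDimensional ℝ Y]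

theorem hasDerivAt_primitive_IccExtend (γ : C(unitInterval, Y)) (s : ℝ) :
    HasDerivAt (fun s => ∫ σ in (0 : ℝ)..s, Set.IccExtend zero_le_one γ σ)
      (Set.IccExtend zero_le_one γ s) s := by
  have hc : Continuous (Set.IccExtend zero_le_one γ) := γ.continuous.Icc_extend'
  exact intervalIntegral.integral_hasDerivAt_right (hc.intervalIntegrable _ _)
    (hc.stronglyMeasurableAtFilter _ _) hc.continuousAt

/-- A variation `δ` in the direction `τ` of the solution along a ray is given by the equation
itself, when the integrability condition holds along the solution. -/
theorem variation_eq_of_integrable (a : C(T × Y, T →L[ℝ] Y)) (ha : ContDiff ℝ ∞ a)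
    (γ δ : C(unitInterval, Y)) (t τ : T) (y : Y)
    (hγ : rayOperator a (γ, (t, y)) = 0)
    (hδ : fderiv ℝ (rayOperator a) (γ, (t, y)) (δ, (τ, 0)) = 0)
    (hsymm : ∀ s : unitInterval, ∀ v w : T,
      fderiv ℝ a ((s : ℝ) • t, γ s) (v, a ((s : ℝ) • t, γ s) v) w =
        fderiv ℝ a ((s : ℝ) • t, γ s) (w, a ((s : ℝ) • t, γ s) w) v) :
    δ 1 = a (t, γ 1) τ := by
  rw [fderiv_rayOperator_apply a ha] at hδ
  rw [rayOperator] at hγ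
  set A : C(unitInterval, Y) := pointwiseApply unitInterval T Y
    (a.comp (graphPath T Y (γ, (t, y)))) (constPath T t) with hA
  set D : C(unitInterval, Y) := pointwiseApply unitInterval T Y
    (a.comp (graphPath T Y (γ, (t, y)))) (constPath T τ) +
       pointwiseApply unitInterval T Y
        (pointwiseApply unitInterval (T × Y) (T →L[ℝ] Y)
          ((fderivMap a ha).comp (graphPath T Y (γ, (t, y))))
          (graphPath T Y (δ, (τ, 0)))) (constPath T t) with hD
  have hAs : ∀ s, A s = a ((s : ℝ) • t, γ s) t := fun s => by simp [hA]
  have hDs : ∀ s, D s = a ((s : ℝ) • t, γ s) τ +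
      fderiv ℝ a ((s : ℝ) • t, γ s) ((s : ℝ) • τ, δ s) t := fun s => by simp [hD, fderivMap]
  set γ' : ℝ → Y := fun s => y + ∫ σ in (0 : ℝ)..s, Set.IccExtend zero_le_one A σ with hγ'
  set δ' : ℝ → Y := fun s => ∫ σ in (0 : ℝ)..s, Set.IccExtend zero_le_one D σ with hδ'
  have hγeq : ∀ s : unitInterval, γ' s = γ s := by
    intro s
    have := congrArg (fun c : C(unitInterval, Y) => c s) hγ
    simp only [ContinuousMap.sub_apply, constPath_apply, pathPrimitive_apply,
      ContinuousMap.zero_apply] at this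
    simp only [hγ']
    rw [sub_sub, sub_eq_zero] at this
    exact this.symm
  have hδeq : ∀ s : unitInterval, δ' s = δ s := by
    intro s
    have := congrArg (fun c : C(unitInterval, Y) => c s) hδ
    simp only [ContinuousMap.sub_apply, constPath_apply, pathPrimitive_apply,
      ContinuousMap.zero_apply] at this
    simp only [hδ']
    rw [sub_sub, sub_eq_zero, zero_add] at this
    exact this.symm
  have hγd : ∀ s, HasDerivAt γ' (Set.IccExtend zero_le_one A s) s := fun s =>
    (hasDerivAt_primitive_IccExtend A s).const_add y
  have hδd : ∀ s, HasDerivAt δ' (Set.IccExtend zero_le_one D s) s := fun s =>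
    hasDerivAt_primitive_IccExtend D s
  -- The expected variation at time `s` is `s • a (s t, γ s) τ`, and `ε` is the defect. The
  -- integrability condition exchanges `t` and `τ` in the derivative of the expected term, leaving
  -- the linear equation `ε' = ∂_y a (ε) t` with `ε 0 = 0`, so `ε` vanishes by a Grönwall estimate.
  set ε : ℝ → Y := fun s => δ' s - s • a (s • t, γ' s) τ with hε
  set ε' : ℝ → Y := fun s => Set.IccExtend zero_le_one D s -
    (s • fderiv ℝ a (s • t, γ' s) (t, Set.IccExtend zero_le_one A s) τ + a (s • t, γ' s) τ)
    with hε'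
  have hεd : ∀ s, HasDerivAt ε (ε' s) s := by
    intro s
    have h1 : HasDerivAt (fun s : ℝ => (s • t, γ' s)) (t, Set.IccExtend zero_le_one A s) s := by
      have : HasDerivAt (fun s : ℝ => s • t) t s := by
        simpa using (hasDerivAt_id s).smul_const t
      exact this.prodMk (hγd s)
    have h2 : HasDerivAt (fun s : ℝ => a (s • t, γ' s))
        (fderiv ℝ a (s • t, γ' s) (t, Set.IccExtend zero_le_one A s)) s :=
      ((ha.differentiable (by simp) (s • t, γ' s)).hasFDerivAt).comp_hasDerivAt s h1
    have h3 : HasDerivAt (fun s : ℝ => a (s • t, γ' s) τ)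
        (fderiv ℝ a (s • t, γ' s) (t, Set.IccExtend zero_le_one A s) τ) s := by
      simpa using h2.clm_apply (hasDerivAt_const s τ)
    have h4 := (hasDerivAt_id s).smul h3
    simp only [id, one_smul] at h4
    exact (hδd s).sub h4
  have hεeq : ∀ s ∈ Set.Icc (0 : ℝ) 1, ε' s = fderiv ℝ a (s • t, γ' s) (0, ε s) t := by
    intro s hs
    have e1 := hγeq ⟨s, hs⟩
    have e2 := hδeq ⟨s, hs⟩
    have i1 := hsymm ⟨s, hs⟩ t τ
    simp only at e1 e2 i1
    simp only [hε', hε]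
    rw [Set.IccExtend_of_mem _ _ hs, Set.IccExtend_of_mem _ _ hs, hAs, hDs]
    simp only
    rw [e1, e2, i1]
    have : ((0 : T), δ ⟨s, hs⟩ - s • a (s • t, γ ⟨s, hs⟩) τ) =
        (s • τ, δ ⟨s, hs⟩) - s • (τ, a (s • t, γ ⟨s, hs⟩) τ) := by
      ext <;> simp
    rw [this, map_sub, map_smul]
    simp only [sub_apply, smul_apply]
    abel
  obtain ⟨C, hC⟩ : ∃ C, ∀ s ∈ (Set.univ : Set unitInterval),
      ‖fderiv ℝ a ((s : ℝ) • t, γ s)‖ ≤ C :=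
    isCompact_univ.exists_bound_of_continuousOn
      ((ha.continuous_fderiv (by simp)).comp (by fun_prop)).continuousOn
  have hzero : ∀ s ∈ Set.Icc (0 : ℝ) 1, ε s = 0 := by
    refine eq_zero_of_abs_deriv_le_mul_abs_self_of_eq_zero_right
      (f' := ε') (K := C * ‖t‖)
      (fun s _ => (hεd s).continuousAt.continuousWithinAt)
      (fun s _ => (hεd s).hasDerivWithinAt) (by simp [hε, hδ']) ?_
    intro s hs
    have hs' : s ∈ Set.Icc (0 : ℝ) 1 := ⟨hs.1, hs.2.le⟩
    rw [hεeq s hs']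
    have hn : ‖fderiv ℝ a (s • t, γ' s)‖ ≤ C := by
      have := hC ⟨s, hs'⟩ (Set.mem_univ _)
      rw [← hγeq ⟨s, hs'⟩] at this
      exact this
    calc ‖fderiv ℝ a (s • t, γ' s) (0, ε s) t‖
        ≤ ‖fderiv ℝ a (s • t, γ' s)‖ * ‖((0 : T), ε s)‖ * ‖t‖ :=
          (fderiv ℝ a (s • t, γ' s)).le_opNorm₂ _ _
      _ = ‖fderiv ℝ a (s • t, γ' s)‖ * ‖t‖ * ‖ε s‖ := by
          simp [Prod.norm_def]; ring
      _ ≤ _ := by gcongr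
  have h1 := hzero 1 ⟨zero_le_one, le_rfl⟩
  have e1 := hγeq 1
  have e2 := hδeq 1
  simp only [hε, one_smul, sub_eq_zero] at h1
  simp only [Set.Icc.coe_one] at e1 e2
  rw [← e2, h1, e1]

/-- At the origin the ray is constant, so `∂a` enters the linearized integral multiplied by the zero
direction: the derivative with respect to the path is the identity. With the parameters appended as
second component the derivative is therefore a shear, with explicit inverse. -/
theorem isInvertible_fderiv_rayOperator_prod (a : C(T × Y, T →L[ℝ] Y)) (ha : ContDiff ℝ ∞ a) :
    ∃ e : (C(unitInterval, Y) × (T × Y)) ≃L[ℝ] (C(unitInterval, Y) × (T × Y)),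
      HasFDerivAt (fun q => (rayOperator a q, q.2))
        (e : (C(unitInterval, Y) × (T × Y)) →L[ℝ] (C(unitInterval, Y) × (T × Y))) 0 := by
  set B : (T × Y) →L[ℝ] C(unitInterval, Y) :=
    -((fderiv ℝ (rayOperator a) 0).comp (ContinuousLinearMap.inr ℝ _ _)) with hB
  have hdec : ∀ v : C(unitInterval, Y) × (T × Y),
      fderiv ℝ (rayOperator a) 0 v = v.1 - B v.2 := by
    intro v
    have hv : v = (v.1, 0) + (0, v.2) := by simp
    have h1 : fderiv ℝ (rayOperator a) 0 (v.1, 0) = v.1 := by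
      rw [fderiv_rayOperator_apply a ha]
      simp
    conv_lhs => rw [hv, map_add, h1]
    simp [hB]
  refine ⟨ContinuousLinearEquiv.equivOfInverse
    (((ContinuousLinearMap.fst ℝ _ _) - B.comp (ContinuousLinearMap.snd ℝ _ _)).prod
      (ContinuousLinearMap.snd ℝ _ _))
    (((ContinuousLinearMap.fst ℝ _ _) + B.comp (ContinuousLinearMap.snd ℝ _ _)).prod
      (ContinuousLinearMap.snd ℝ _ _)) (fun v => by simp) (fun v => by simp), ?_⟩
  have h := (((contDiff_rayOperator a ha).differentiable (by simp) 0).hasFDerivAt).prodMk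
    (hasFDerivAt_snd (𝕜 := ℝ) (p := (0 : C(unitInterval, Y) × (T × Y))))
  refine h.congr_fderiv ?_
  exact ContinuousLinearMap.ext fun v => Prod.ext (hdec v) rfl

end Frobenius

section Frobenius

universe u

variable {T Y : Type u} [NormedAddCommGroup T] [NormedSpace ℝ T] [FiniteDimensional ℝ T]
  [NormedAddCommGroup Y] [NormedSpace ℝ Y] [FiniteDimensional ℝ Y]

/-- The solutions along rays, with parameters: a smooth family `Γ (t, y)` of paths whose end points
satisfy `∂_t Γ (t, y) 1 = a (t, Γ (t, y) 1)` and `Γ (0, y) 1 = y` to first order. -/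
theorem exists_raySolution (a : C(T × Y, T →L[ℝ] Y)) (ha : ContDiff ℝ ∞ a)
    (hsymm : ∀ᶠ x in 𝓝 (0 : T × Y), ∀ v w : T,
      fderiv ℝ a x (v, a x v) w = fderiv ℝ a x (w, a x w) v) :
    ∃ (G : T × Y → Y) (W : Set (T × Y)), IsOpen W ∧ 0 ∈ W ∧ ContDiffOn ℝ ∞ G W ∧ G 0 = 0 ∧
      (∀ p ∈ W, ∀ τ, fderiv ℝ G p (τ, 0) = a (p.1, G p) τ) ∧
      (∀ η, fderiv ℝ G 0 (0, η) = η) := by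
  obtain ⟨L, hL⟩ := isInvertible_fderiv_rayOperator_prod a ha
  have hsm : ContDiff ℝ ∞ (fun q : C(unitInterval, Y) × (T × Y) => (rayOperator a q, q.2)) :=
    (contDiff_rayOperator a ha).prodMk contDiff_snd
  obtain ⟨e, h0, -, hef, hes⟩ := exists_openPartialHomeomorph_of_contDiffOn isOpen_univ
    hsm.contDiffOn (Set.mem_univ 0) L hL
  have he0 : e 0 = 0 := by rw [hef]; simp [rayOperator]
  have h0t : (0 : C(unitInterval, Y) × (T × Y)) ∈ e.target := he0 ▸ e.map_source h0
  have hsymm0 : e.symm 0 = 0 := by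
    have := e.left_inv h0
    rwa [he0] at this
  set Γ : T × Y → C(unitInterval, Y) := fun p => (e.symm (0, p)).1 with hΓ
  set W₁ : Set (T × Y) := (fun p => ((0 : C(unitInterval, Y)), p)) ⁻¹' e.target with hW₁
  have hW₁o : IsOpen W₁ := e.open_target.preimage (by fun_prop)
  have h0W₁ : (0 : T × Y) ∈ W₁ := h0t
  have hΓs : ContDiffOn ℝ ∞ Γ W₁ :=
    contDiff_fst.comp_contDiffOn (hes.comp (contDiff_prodMk_right _).contDiffOn (fun p hp => hp))
  have hsec : ∀ p ∈ W₁, e.symm (0, p) = (Γ p, p) ∧ rayOperator a (Γ p, p) = 0 := by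
    intro p hp
    have h1 := e.right_inv hp
    rw [hef] at h1
    have h2 : (e.symm (0, p)).2 = p := congrArg Prod.snd h1
    have h3 : e.symm (0, p) = (Γ p, p) := Prod.ext rfl h2
    refine ⟨h3, ?_⟩
    rw [← h3]
    exact congrArg Prod.fst h1
  have hΓ0 : Γ 0 = 0 := by
    have : ((0 : C(unitInterval, Y)), (0 : T × Y)) = 0 := rfl
    simp only [hΓ]
    rw [this, hsymm0]
    rfl
  have hΓd : ∀ p ∈ W₁, HasFDerivAt Γ (fderiv ℝ Γ p) p := fun p hp =>
    ((hΓs.contDiffAt (hW₁o.mem_nhds hp)).differentiableAt (by simp)).hasFDerivAt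
  have hlin : ∀ p ∈ W₁, ∀ v, fderiv ℝ (rayOperator a) (Γ p, p) (fderiv ℝ Γ p v, v) = 0 := by
    intro p hp v
    have h1 : HasFDerivAt (fun p => rayOperator a (Γ p, p))
        ((fderiv ℝ (rayOperator a) (Γ p, p)).comp
          ((fderiv ℝ Γ p).prod (ContinuousLinearMap.id ℝ _))) p :=
      HasFDerivAt.comp (f := fun p => (Γ p, p)) p
        ((contDiff_rayOperator a ha).differentiable (by simp) (Γ p, p)).hasFDerivAt
        ((hΓd p hp).prodMk (hasFDerivAt_id p))
    have h2 : (fun p => rayOperator a (Γ p, p)) =ᶠ[𝓝 p] fun _ => 0 := by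
      filter_upwards [hW₁o.mem_nhds hp] with p' hp' using (hsec p' hp').2
    have h3 := (h1.congr_of_eventuallyEq h2.symm).unique (hasFDerivAt_const _ _)
    exact congrArg (fun L => L v) h3
  obtain ⟨r, hr, hball⟩ := Metric.eventually_nhds_iff_ball.1 hsymm
  -- The integrability condition is known only on a ball about the origin and is needed along the
  -- whole solution. The parameters are restricted so that both the ray and the path `Γ p` stay
  -- inside this ball.
  set W₂ : Set (T × Y) := W₁ ∩ Γ ⁻¹' Metric.ball 0 r with hW₂
  have hW₂o : IsOpen W₂ := hΓs.continuousOn.isOpen_inter_preimage hW₁o Metric.isOpen_ball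
  set W : Set (T × Y) := W₂ ∩ Metric.ball 0 r with hW
  have hWW₁ : ∀ p ∈ W, p ∈ W₁ := fun p hp => hp.1.1
  set ev : C(unitInterval, Y) →L[ℝ] Y := ContinuousMap.evalCLM ℝ 1 with hev
  have hGd : ∀ p ∈ W₁, HasFDerivAt (fun p => Γ p 1) (ev.comp (fderiv ℝ Γ p)) p := fun p hp =>
    ev.hasFDerivAt.comp p (hΓd p hp)
  refine ⟨fun p => Γ p 1, W, hW₂o.inter Metric.isOpen_ball,
    ⟨⟨h0W₁, by simpa [hΓ0] using hr⟩, by simpa using hr⟩,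
    ev.contDiff.comp_contDiffOn (hΓs.mono hWW₁), by simp [hΓ0], ?_, ?_⟩
  · rintro ⟨t, y⟩ hp τ
    have hp₁ := hWW₁ _ hp
    rw [(hGd _ hp₁).fderiv]
    refine variation_eq_of_integrable a ha (Γ (t, y)) (fderiv ℝ Γ (t, y) (τ, 0)) t τ y
      (hsec _ hp₁).2 (hlin _ hp₁ _) ?_
    intro s v w
    refine hball _ ?_ v w
    have h1 : ‖Γ (t, y)‖ < r := by simpa using hp.1.2
    have h2 : ‖(t, y)‖ < r := by simpa using hp.2
    rw [mem_ball_zero_iff, Prod.norm_def, max_lt_iff]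
    refine ⟨?_, ((Γ (t, y)).norm_coe_le_norm s).trans_lt h1⟩
    simp only
    rw [norm_smul, Real.norm_eq_abs, abs_of_nonneg s.2.1]
    have h3 : ‖t‖ ≤ ‖(t, y)‖ := le_max_left _ _
    nlinarith [norm_nonneg t, s.2.1, s.2.2]
  · intro η
    rw [(hGd _ h0W₁).fderiv]
    have h := hlin 0 h0W₁ (0, η)
    rw [hΓ0, fderiv_rayOperator_apply a ha] at h
    have h' := congrArg (fun c : C(unitInterval, Y) => c 1) h
    simp only [ContinuousMap.sub_apply, constPath_apply, ContinuousMap.zero_apply, map_zero,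
      Prod.fst_zero, add_zero, sub_zero, sub_eq_zero] at h'
    exact h'

/-- Complete integrability of `dy = a(t, y) dt`. -/
theorem exists_firstIntegral_of_totalEquation (a : C(T × Y, T →L[ℝ] Y)) (ha : ContDiff ℝ ∞ a)
    (hsymm : ∀ᶠ x in 𝓝 (0 : T × Y), ∀ v w : T,
      fderiv ℝ a x (v, a x v) w = fderiv ℝ a x (w, a x w) v) :
    ∃ (f : T × Y → Y) (U : Set (T × Y)), IsOpen U ∧ 0 ∈ U ∧ ContDiffOn ℝ ∞ f U ∧
      ∀ x ∈ U, (∀ t, fderiv ℝ f x (t, a x t) = 0) ∧ Function.Surjective (fderiv ℝ f x) := by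
  obtain ⟨G, W, hWo, h0W, hG, hG0, hGt, hGy⟩ := exists_raySolution a ha hsymm
  -- `Ψ` carries the slices `y = const` to the graphs of solutions, so the second component of its
  -- local inverse is constant along solutions and is the desired first integral.
  set Ψ : T × Y → T × Y := fun p => (p.1, G p) with hΨ
  have hΨs : ContDiffOn ℝ ∞ Ψ W := contDiff_fst.contDiffOn.prodMk hG
  have hGd : ∀ p ∈ W, HasFDerivAt G (fderiv ℝ G p) p := fun p hp =>
    ((hG.contDiffAt (hWo.mem_nhds hp)).differentiableAt (by simp)).hasFDerivAt
  have hΨd : ∀ p ∈ W, HasFDerivAt Ψ ((ContinuousLinearMap.fst ℝ T Y).prod (fderiv ℝ G p)) p :=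
    fun p hp => hasFDerivAt_fst.prodMk (hGd p hp)
  have hG0v : ∀ v : T × Y, fderiv ℝ G 0 v = a 0 v.1 + v.2 := by
    intro v
    have hv : v = (v.1, 0) + (0, v.2) := by simp
    conv_lhs => rw [hv, map_add, hGy, hGt 0 h0W, Prod.fst_zero, hG0]
    rfl
  set L : (T × Y) ≃L[ℝ] (T × Y) := ContinuousLinearEquiv.equivOfInverse
    ((ContinuousLinearMap.fst ℝ T Y).prod
      ((a 0).comp (ContinuousLinearMap.fst ℝ T Y) + ContinuousLinearMap.snd ℝ T Y))
    ((ContinuousLinearMap.fst ℝ T Y).prod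
      (ContinuousLinearMap.snd ℝ T Y - (a 0).comp (ContinuousLinearMap.fst ℝ T Y)))
    (fun v => by simp) (fun v => by simp) with hL
  have hΨ0 : HasFDerivAt Ψ (L : (T × Y) →L[ℝ] (T × Y)) 0 := by
    refine (hΨd 0 h0W).congr_fderiv ?_
    exact ContinuousLinearMap.ext fun v => Prod.ext rfl (hG0v v)
  obtain ⟨e, h0, heW, hef, hes⟩ := exists_openPartialHomeomorph_of_contDiffOn hWo hΨs h0W L hΨ0
  have he0 : e 0 = 0 := by rw [hef]; simp [hΨ, hG0]
  refine ⟨fun x => (e.symm x).2, e.target, e.open_target, he0 ▸ e.map_source h0,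
    contDiff_snd.comp_contDiffOn hes, ?_⟩
  intro x hx
  set f : T × Y → Y := fun x => (e.symm x).2 with hf
  set p := e.symm x with hp
  have hps : p ∈ e.source := e.map_target hx
  have hpx : Ψ p = x := by rw [← hef]; exact e.right_inv hx
  have hfd : HasFDerivAt f (fderiv ℝ f x) (Ψ p) := by
    rw [hpx]
    exact (((contDiff_snd.comp_contDiffOn hes).contDiffAt
      (e.open_target.mem_nhds hx)).differentiableAt (by simp)).hasFDerivAt
  have hcomp := hfd.comp p (hΨd p (heW hps))
  have heq : f ∘ Ψ =ᶠ[𝓝 p] Prod.snd := by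
    filter_upwards [e.open_source.mem_nhds hps] with p' hp'
    simp only [Function.comp, hf]
    rw [← hef, e.left_inv hp']
  have huniq := (hcomp.congr_of_eventuallyEq heq.symm).unique hasFDerivAt_snd
  have hkey : ∀ v : T × Y, fderiv ℝ f x (v.1, fderiv ℝ G p v) = v.2 := fun v =>
    congrArg (fun L => L v) huniq
  have hx1 : (p.1, G p) = x := hpx
  refine ⟨fun t => ?_, fun η => ⟨_, hkey (0, η)⟩⟩
  have h1 := hkey (t, 0)
  rw [hGt p (heW hps), hx1] at h1
  exact h1

end Frobenius

section Frobenius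

/-- Brackets of combinations of the fields `V i` are combinations of the `V i`, when the brackets of
the `V i` are. -/
theorem lieBracket_sum_smul_mem_span {E ι : Type*} [NormedAddCommGroup E] [NormedSpace ℝ E]
    [Fintype ι] (V : ι → E → E) (c d : ι → E → ℝ) (x : E)
    (hV : ∀ i, DifferentiableAt ℝ (V i) x) (hc : ∀ i, DifferentiableAt ℝ (c i) x)
    (hd : ∀ i, DifferentiableAt ℝ (d i) x)
    (hbr : ∀ i j, VectorField.lieBracket ℝ (V i) (V j) x ∈
      Submodule.span ℝ (Set.range fun i => V i x)) :
    VectorField.lieBracket ℝ (fun z => ∑ i, c i z • V i z) (fun z => ∑ i, d i z • V i z) x ∈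
      Submodule.span ℝ (Set.range fun i => V i x) := by
  have hder : ∀ c : ι → E → ℝ, (∀ i, DifferentiableAt ℝ (c i) x) → ∀ w,
      fderiv ℝ (fun z => ∑ i, c i z • V i z) x w =
        ∑ i, c i x • fderiv ℝ (V i) x w + ∑ i, fderiv ℝ (c i) x w • V i x := by
    intro c hc w
    have : HasFDerivAt (fun z => ∑ i, c i z • V i z)
        (∑ i, (c i x • fderiv ℝ (V i) x + (fderiv ℝ (c i) x).smulRight (V i x))) x :=
      HasFDerivAt.fun_sum fun i _ => (hc i).hasFDerivAt.smul (hV i).hasFDerivAt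
    rw [this.fderiv]
    simp [Finset.sum_add_distrib]
  have hmem : ∀ i, V i x ∈ Submodule.span ℝ (Set.range fun i => V i x) := fun i =>
    Submodule.subset_span ⟨i, rfl⟩
  have hS : VectorField.lieBracket ℝ (fun z => ∑ i, c i z • V i z)
      (fun z => ∑ i, d i z • V i z) x =
      ∑ i, ∑ j, (c i x * d j x) • VectorField.lieBracket ℝ (V i) (V j) x +
      (∑ i, fderiv ℝ (d i) x (∑ i, c i x • V i x) • V i x -
        ∑ i, fderiv ℝ (c i) x (∑ i, d i x • V i x) • V i x) := by
    rw [VectorField.lieBracket_eq]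
    simp only
    rw [hder d hd, hder c hc]
    simp only [map_sum, map_smul, VectorField.lieBracket_eq, smul_sub, Finset.sum_sub_distrib,
      Finset.smul_sum, smul_smul]
    rw [Finset.sum_comm (f := fun i j => (c i x * d j x) • fderiv ℝ (V j) x (V i x))]
    simp only [mul_comm (c _ x) (d _ x)]
    abel
  rw [hS]
  refine Submodule.add_mem _ (Submodule.sum_mem _ fun i _ => Submodule.sum_mem _ fun j _ =>
    Submodule.smul_mem _ _ (hbr i j)) (Submodule.sub_mem _ ?_ ?_) <;>
  exact Submodule.sum_mem _ fun i _ => Submodule.smul_mem _ _ (hmem i)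

variable {ι Y : Type} [Fintype ι] [DecidableEq ι] [NormedAddCommGroup Y] [NormedSpace ℝ Y]
  [FiniteDimensional ℝ Y]

/-- Frobenius theorem for fields on a product, which project to the coordinate fields of the first
factor at the origin. -/
theorem exists_firstIntegral_of_adapted (V : ι → (ι → ℝ) × Y → (ι → ℝ) × Y)
    {U : Set ((ι → ℝ) × Y)} (hU : IsOpen U) (h0 : 0 ∈ U) (hV : ∀ i, ContDiffOn ℝ ∞ (V i) U)
    (hV0 : ∀ i, (V i 0).1 = Pi.single i 1)
    (hbr : ∀ x ∈ U, ∀ i j, VectorField.lieBracket ℝ (V i) (V j) x ∈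
      Submodule.span ℝ (Set.range fun i => V i x)) :
    ∃ (f : (ι → ℝ) × Y → Y) (U' : Set ((ι → ℝ) × Y)), IsOpen U' ∧ 0 ∈ U' ∧ ContDiffOn ℝ ∞ f U' ∧
      ∀ x ∈ U', (∀ i, fderiv ℝ f x (V i x) = 0) ∧ Function.Surjective (fderiv ℝ f x) := by
  set M : (ι → ℝ) × Y → (ι → ℝ) →L[ℝ] (ι → ℝ) × Y := fun x =>
    ∑ i, (ContinuousLinearMap.proj (R := ℝ) (φ := fun _ : ι => ℝ) i).smulRight (V i x) with hM
  have hMa : ∀ x t, M x t = ∑ i, t i • V i x := fun x t => by simp [hM]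
  have hMs : ContDiffOn ℝ ∞ M U := by
    refine ContDiffOn.sum fun i _ => ?_
    exact (ContinuousLinearMap.smulRightL ℝ (ι → ℝ) ((ι → ℝ) × Y)
      (ContinuousLinearMap.proj i)).contDiff.comp_contDiffOn (hV i)
  set P : (ι → ℝ) × Y → (ι → ℝ) →L[ℝ] (ι → ℝ) := fun x =>
    (ContinuousLinearMap.fst ℝ (ι → ℝ) Y).comp (M x) with hP
  have hPs : ContDiffOn ℝ ∞ P U := contDiffOn_const.clm_comp hMs
  have hP0 : P 0 = ContinuousLinearMap.id ℝ (ι → ℝ) := by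
    refine ContinuousLinearMap.ext fun t => ?_
    simp only [hP, ContinuousLinearMap.comp_apply, hMa]
    simp only [ContinuousLinearMap.coe_fst', Prod.fst_sum, Prod.smul_fst, hV0]
    ext k
    simp [Finset.sum_apply, Pi.single_apply]
  set U₁ : Set ((ι → ℝ) × Y) :=
    U ∩ P ⁻¹' Set.range ((↑) : ((ι → ℝ) ≃L[ℝ] (ι → ℝ)) → (ι → ℝ) →L[ℝ] (ι → ℝ)) with hU₁
  have hU₁o : IsOpen U₁ :=
    hPs.continuousOn.isOpen_inter_preimage hU ContinuousLinearEquiv.isOpen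
  have h0U₁ : (0 : (ι → ℝ) × Y) ∈ U₁ := ⟨h0, ContinuousLinearEquiv.refl ℝ (ι → ℝ), by rw [hP0]; rfl⟩
  -- Change of basis in the distribution: `R x t` is the combination of the `V i` whose first
  -- component is `t`. The distribution thereby becomes the graph of `a₀`, and its integral
  -- manifolds solve `dy = a₀ dt`.
  set R : (ι → ℝ) × Y → (ι → ℝ) →L[ℝ] (ι → ℝ) × Y := fun x => (M x).comp (P x).inverse with hR
  have hPinv : ContDiffOn ℝ ∞ (fun x => (P x).inverse) U₁ := by
    intro x hx
    obtain ⟨e, he⟩ := hx.2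
    have h1 : ContDiffAt ℝ ∞ ContinuousLinearMap.inverse (P x) := by
      rw [← he]; exact contDiffAt_map_inverse e
    exact (h1.comp x (hPs.contDiffAt (hU.mem_nhds hx.1))).contDiffWithinAt
  have hRs : ContDiffOn ℝ ∞ R U₁ := (hMs.mono Set.inter_subset_left).clm_comp hPinv
  have hPP : ∀ x ∈ U₁, ∀ t, P x ((P x).inverse t) = t ∧ (P x).inverse (P x t) = t := by
    rintro x ⟨-, e, he⟩ t
    rw [← he]
    simp
  have hR1 : ∀ x ∈ U₁, ∀ t, (R x t).1 = t := fun x hx t => (hPP x hx t).1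
  set a₀ : (ι → ℝ) × Y → (ι → ℝ) →L[ℝ] Y := fun x =>
    (ContinuousLinearMap.snd ℝ (ι → ℝ) Y).comp (R x) with ha₀
  have ha₀s : ContDiffOn ℝ ∞ a₀ U₁ := contDiffOn_const.clm_comp hRs
  have hRa : ∀ x ∈ U₁, ∀ t, R x t = (t, a₀ x t) := fun x hx t => Prod.ext (hR1 x hx t) rfl
  -- Since `R z v` has the constant first component `v`, the bracket of `R · v` and `R · w` has
  -- first component zero. By involutivity it is a combination of the `V i`, whose coefficients
  -- vanish because `P x` is invertible. The second component of the bracket is exactly the defect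
  -- of integrability.
  have hsymm₀ : ∀ x ∈ U₁, ∀ v w, fderiv ℝ a₀ x (v, a₀ x v) w = fderiv ℝ a₀ x (w, a₀ x w) v := by
    intro x hx v w
    have hci : ∀ v i, DifferentiableAt ℝ (fun z => (P z).inverse v i) x := by
      intro v i
      have h1 : DifferentiableAt ℝ (fun z => (P z).inverse) x :=
        (hPinv.contDiffAt (hU₁o.mem_nhds hx)).differentiableAt (by simp)
      have h2 : DifferentiableAt ℝ (fun z => (P z).inverse v) x :=
        h1.clm_apply (differentiableAt_const v)
      exact (differentiableAt_pi.1 h2) i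
    have hmem := lieBracket_sum_smul_mem_span V (fun i z => (P z).inverse v i)
      (fun i z => (P z).inverse w i) x
      (fun i => ((hV i).contDiffAt (hU.mem_nhds hx.1)).differentiableAt (by simp))
      (hci v) (hci w) (hbr x hx.1)
    have hsum : ∀ v, (fun z => ∑ i, (P z).inverse v i • V i z) = fun z => R z v := by
      intro v; funext z; rw [← hMa]; rfl
    rw [hsum, hsum] at hmem
    have ha₀d : DifferentiableAt ℝ a₀ x :=
      (ha₀s.contDiffAt (hU₁o.mem_nhds hx)).differentiableAt (by simp)
    have hRd : ∀ v u, fderiv ℝ (fun z => R z v) x u = (0, fderiv ℝ a₀ x u v) := by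
      intro v u
      have h1 : (fun z => R z v) =ᶠ[𝓝 x] fun z => (v, a₀ z v) := by
        filter_upwards [hU₁o.mem_nhds hx] with z hz using hRa z hz v
      rw [h1.fderiv_eq]
      have h2 := (ha₀d.hasFDerivAt.clm_apply (hasFDerivAt_const v x))
      have h3 := (hasFDerivAt_const v x).prodMk h2
      rw [h3.fderiv]
      simp
    have hb : VectorField.lieBracket ℝ (fun z => R z v) (fun z => R z w) x =
        (0, fderiv ℝ a₀ x (v, a₀ x v) w - fderiv ℝ a₀ x (w, a₀ x w) v) := by
      rw [VectorField.lieBracket_eq]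
      simp only
      rw [hRd, hRd, hRa x hx, hRa x hx]
      simp
    rw [hb] at hmem
    obtain ⟨s, hs⟩ := (Submodule.mem_span_range_iff_exists_fun ℝ).1 hmem
    have hs' : M x s = (0, fderiv ℝ a₀ x (v, a₀ x v) w - fderiv ℝ a₀ x (w, a₀ x w) v) := by
      rw [hMa]; exact hs
    have hs0 : s = 0 := by
      have h1 : P x s = 0 := congrArg Prod.fst hs'
      rw [← (hPP x hx s).2, h1, map_zero]
    rw [hs0, map_zero] at hs'
    exact sub_eq_zero.1 (congrArg Prod.snd hs').symm
  obtain ⟨r, hr, hball⟩ := Metric.isOpen_iff.1 hU₁o 0 h0U₁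
  -- The ray operator needs a coefficient defined and smooth on the whole space; the cutoff provides
  -- one that agrees with `a₀` near the origin.
  set χ : ContDiffBump (0 : (ι → ℝ) × Y) := ⟨r / 4, r / 2, by positivity, by linarith⟩ with hχ
  have has : ContDiff ℝ ∞ (fun x => χ x • a₀ x) := by
    rw [contDiff_iff_contDiffAt]
    intro x
    by_cases hx : x ∈ Metric.ball (0 : (ι → ℝ) × Y) r
    · exact χ.contDiff.contDiffAt.smul (ha₀s.contDiffAt (hU₁o.mem_nhds (hball hx)))
    · have hx' : x ∉ tsupport χ := by
        rw [χ.tsupport_eq]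
        intro h
        refine hx (Metric.closedBall_subset_ball ?_ h)
        show r / 2 < r
        linarith
      have : (fun x => χ x • a₀ x) =ᶠ[𝓝 x] fun _ => 0 := by
        filter_upwards [(isClosed_tsupport χ).isOpen_compl.mem_nhds hx'] with z hz
        rw [image_eq_zero_of_notMem_tsupport hz, zero_smul]
      exact contDiffAt_const.congr_of_eventuallyEq this
  set a : C((ι → ℝ) × Y, (ι → ℝ) →L[ℝ] Y) := ⟨fun x => χ x • a₀ x, has.continuous⟩ with ha
  have haeq : ∀ x ∈ Metric.ball (0 : (ι → ℝ) × Y) (r / 4), a x = a₀ x := by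
    intro x hx
    have : χ x = 1 := χ.one_of_mem_closedBall (Metric.ball_subset_closedBall hx)
    simp [ha, this]
  have hballo : Metric.ball (0 : (ι → ℝ) × Y) (r / 4) ⊆ U₁ :=
    (Metric.ball_subset_ball (by linarith)).trans hball
  have hsymm : ∀ᶠ x in 𝓝 (0 : (ι → ℝ) × Y), ∀ v w : (ι → ℝ),
      fderiv ℝ a x (v, a x v) w = fderiv ℝ a x (w, a x w) v := by
    filter_upwards [Metric.ball_mem_nhds (0 : (ι → ℝ) × Y) (show 0 < r / 4 by positivity)]
      with x hx v w
    have h1 : (a : (ι → ℝ) × Y → (ι → ℝ) →L[ℝ] Y) =ᶠ[𝓝 x] a₀ := by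
      filter_upwards [Metric.isOpen_ball.mem_nhds hx] with z hz using haeq z hz
    rw [h1.fderiv_eq, haeq x hx]
    exact hsymm₀ x (hballo hx) v w
  obtain ⟨f, U', hU'o, h0U', hf, hfp⟩ := exists_firstIntegral_of_totalEquation a has hsymm
  refine ⟨f, U' ∩ Metric.ball 0 (r / 4), hU'o.inter Metric.isOpen_ball,
    ⟨h0U', Metric.mem_ball_self (by positivity)⟩, hf.mono Set.inter_subset_left, ?_⟩
  rintro x ⟨hx, hxb⟩
  refine ⟨fun i => ?_, (hfp x hx).2⟩
  -- The field `V i` is recovered as `R` applied to its own first component.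
  have h1 := (hfp x hx).1 (P x (Pi.single i 1))
  rw [haeq x hxb, ← hRa x (hballo hxb)] at h1
  have h2 : R x (P x (Pi.single i 1)) = V i x := by
    simp only [hR, ContinuousLinearMap.comp_apply]
    rw [(hPP x (hballo hxb) _).2, hMa]
    simp [Pi.single_apply]
  rwa [h2] at h1

end Frobenius

section Frobenius

/-- A linearly independent family is the image of the first coordinate vectors under a linear
isomorphism `ℝ^ι × ℝ^d ≃ E`. -/
theorem exists_continuousLinearEquiv_of_linearIndependent {E ι : Type*} [NormedAddCommGroup E]
    [NormedSpace ℝ E] [FiniteDimensional ℝ E] [Fintype ι] [DecidableEq ι] {v : ι → E}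
    (hv : LinearIndependent ℝ v) :
    ∃ A : ((ι → ℝ) × (Fin (Module.finrank ℝ E - Fintype.card ι) → ℝ)) ≃L[ℝ] E,
      ∀ i, A (Pi.single i 1, 0) = v i := by
  obtain ⟨Q, hQ⟩ := Submodule.exists_isCompl (Submodule.span ℝ (Set.range v))
  have hdim : Module.finrank ℝ Q = Module.finrank ℝ E - Fintype.card ι := by
    have h1 := Submodule.finrank_add_eq_of_isCompl hQ
    have h2 := finrank_span_eq_card hv
    omega
  set B := Module.Basis.span hv
  set C := (Module.finBasisOfFinrankEq ℝ Q hdim)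
  set A := (LinearEquiv.prodCongr B.equivFun.symm C.equivFun.symm).trans
    (Submodule.prodEquivOfIsCompl _ _ hQ)
  refine ⟨A.toContinuousLinearEquiv, fun i => ?_⟩
  have hB : B.equivFun.symm (Pi.single i 1) = B i := by simp
  show A (Pi.single i 1, 0) = v i
  simp only [A, LinearEquiv.trans_apply, LinearEquiv.prodCongr_apply, hB, map_zero,
    Submodule.coe_prodEquivOfIsCompl', ZeroMemClass.coe_zero, add_zero]
  exact congrArg Subtype.val (Module.Basis.span_apply hv i)

/-- **Frobenius theorem**: an involutive family of `card ι` independent smooth fields on an open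
set of `E` has locally `dim E - card ι` independent first integrals. -/
theorem exists_firstIntegrals {E ι : Type} [NormedAddCommGroup E] [NormedSpace ℝ E]
    [FiniteDimensional ℝ E] [Fintype ι] (V : ι → E → E) {U : Set E} (hU : IsOpen U) {x₀ : E}
    (hx₀ : x₀ ∈ U) (hV : ∀ i, ContDiffOn ℝ ∞ (V i) U)
    (hli : LinearIndependent ℝ fun i => V i x₀)
    (hbr : ∀ x ∈ U, ∀ i j, VectorField.lieBracket ℝ (V i) (V j) x ∈
      Submodule.span ℝ (Set.range fun i => V i x)) :
    ∃ (f : Fin (Module.finrank ℝ E - Fintype.card ι) → E → ℝ) (U' : Set E), IsOpen U' ∧ x₀ ∈ U' ∧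
      (∀ k, ContDiffOn ℝ ∞ (f k) U') ∧ (∀ x ∈ U', ∀ i k, fderiv ℝ (f k) x (V i x) = 0) ∧
      LinearIndependent ℝ fun k => fderiv ℝ (f k) x₀ := by
  classical
  obtain ⟨A, hA⟩ := exists_continuousLinearEquiv_of_linearIndependent hli
  set ψ := fun z => x₀ + A z with hψ
  have hψd : ∀ z, HasFDerivAt ψ (A : _ →L[ℝ] E) z := fun z => A.hasFDerivAt.const_add x₀
  have hψs : ContDiff ℝ ∞ ψ := contDiff_const.add A.contDiff
  have hψ0 : ψ 0 = x₀ := by simp [hψ]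
  set W : ι → _ → _ := fun i z => A.symm (V i (ψ z)) with hW
  have hVd : ∀ i, ∀ x ∈ U, HasFDerivAt (V i) (fderiv ℝ (V i) x) x := fun i x hx =>
    (((hV i).contDiffAt (hU.mem_nhds hx)).differentiableAt (by simp)).hasFDerivAt
  have hWd : ∀ i, ∀ z ∈ ψ ⁻¹' U, ∀ v,
      fderiv ℝ (W i) z v = A.symm (fderiv ℝ (V i) (ψ z) (A v)) := by
    intro i z hz v
    have h1 : HasFDerivAt (W i) _ z :=
      A.symm.hasFDerivAt.comp z ((hVd i (ψ z) hz).comp z (hψd z))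
    rw [h1.fderiv]
    rfl
  obtain ⟨F, U', hU'o, h0U', hF, hFp⟩ := exists_firstIntegral_of_adapted W
    (hU.preimage hψs.continuous) (by simpa [hψ0] using hx₀)
    (fun i => A.symm.contDiff.comp_contDiffOn ((hV i).comp hψs.contDiffOn fun z hz => hz))
    (fun i => by simp only [hW]; rw [hψ0, ← hA i, A.symm_apply_apply])
    (fun z hz i j => by
      rw [VectorField.lieBracket_eq]
      simp only
      rw [hWd j z hz, hWd i z hz, ← map_sub]
      simp only [hW, A.apply_symm_apply]
      have h1 := Submodule.mem_map_of_mem (f := A.symm.toLinearEquiv.toLinearMap) (hbr (ψ z) hz i j)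
      rw [Submodule.map_span, ← Set.range_comp, VectorField.lieBracket_eq] at h1
      exact h1)
  set φ : E → _ := fun x => A.symm (x - x₀) with hφ
  have hφd : ∀ x, HasFDerivAt φ (A.symm : E →L[ℝ] _) x := fun x =>
    A.symm.hasFDerivAt.comp x ((hasFDerivAt_id x).sub_const x₀)
  have hφs : ContDiff ℝ ∞ φ := A.symm.contDiff.comp (contDiff_id.sub contDiff_const)
  have hφ0 : φ x₀ = 0 := by simp [hφ]
  have hψφ : ∀ x, ψ (φ x) = x := fun x => by simp [hψ, hφ]
  have hFd : ∀ x ∈ φ ⁻¹' U', ∀ k, HasFDerivAt (fun x => F (φ x) k)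
      ((ContinuousLinearMap.proj k).comp ((fderiv ℝ F (φ x)).comp (A.symm : E →L[ℝ] _))) x := by
    intro x hx k
    have h1 : HasFDerivAt F (fderiv ℝ F (φ x)) (φ x) :=
      ((hF.contDiffAt (hU'o.mem_nhds hx)).differentiableAt (by simp)).hasFDerivAt
    have h2 := (hasFDerivAt_pi'.1 (h1.comp x (hφd x))) k
    exact h2
  refine ⟨fun k x => F (φ x) k, φ ⁻¹' U', hU'o.preimage hφs.continuous, by simpa [hφ0] using h0U',
    fun k => ?_, fun x hx i k => ?_, ?_⟩
  · have h1 : ContDiffOn ℝ ∞ (fun x => F (φ x)) (φ ⁻¹' U') := hF.comp hφs.contDiffOn fun x hx => hx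
    exact (contDiffOn_pi.1 h1) k
  · rw [(hFd x hx k).fderiv]
    have h1 := (hFp (φ x) hx).1 i
    simp only [hW, hψφ] at h1
    have h2 := congrFun h1 k
    exact h2
  · have hx₀' : x₀ ∈ φ ⁻¹' U' := by simpa [hφ0] using h0U'
    have heq : (fun k => fderiv ℝ (fun x => F (φ x) k) x₀) = fun k =>
        (ContinuousLinearMap.proj k).comp ((fderiv ℝ F (φ x₀)).comp (A.symm : E →L[ℝ] _)) :=
      funext fun k => (hFd x₀ hx₀' k).fderiv
    rw [heq, Fintype.linearIndependent_iff]
    intro c hc k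
    obtain ⟨v, hv⟩ := (hFp (φ x₀) hx₀').2 (Pi.single k 1)
    have h1 := congrArg (fun L => L (A v)) hc
    simp only [sum_apply, smul_apply, ContinuousLinearMap.comp_apply,
      ContinuousLinearEquiv.coe_coe, A.symm_apply_apply, hv, ContinuousLinearMap.proj_apply,
      zero_apply, smul_eq_mul] at h1
    simpa [Pi.single_apply] using h1

end Frobenius

/-! ### Calculus in a chart of the first factor of a product -/

section Chart

set_option linter.unusedSectionVars false

variable {E : Type*} [NormedAddCommGroup E] [NormedSpace ℝ E] [FiniteDimensional ℝ E]
  {H : Type*} [TopologicalSpace H] {I : ModelWithCorners ℝ E H} [I.Boundaryless]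
  {M : Type*} [TopologicalSpace M] [ChartedSpace H M] [IsManifold I ∞ M]
  {F : Type*} [NormedAddCommGroup F] [NormedSpace ℝ F]

variable (I) in
/-- A vector field read in the chart at `x₀`. -/
def chartField (x₀ : M) (V : (x : M) → TangentSpace I x) (ξ : E) : E :=
  VectorField.mpullback 𝓘(ℝ, E) I (extChartAt I x₀).symm V ξ

variable (I F) in
/-- The parametrization of a product with a vector space by a chart of the first factor. -/
def prodChart (x₀ : M) (z : E × F) : M × F := ((extChartAt I x₀).symm z.1, z.2)

theorem contMDiffAt_extChartAt_symm_of_mem (x₀ : M) {ξ : E} (hξ : ξ ∈ (extChartAt I x₀).target) :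
    ContMDiffAt 𝓘(ℝ, E) I ∞ (extChartAt I x₀).symm ξ :=
  (contMDiffOn_extChartAt_symm x₀).contMDiffAt ((isOpen_extChartAt_target x₀).mem_nhds hξ)

theorem isInvertible_mfderiv_extChartAt_symm (x₀ : M) {ξ : E}
    (hξ : ξ ∈ (extChartAt I x₀).target) :
    (mfderiv 𝓘(ℝ, E) I (extChartAt I x₀).symm ξ).IsInvertible := by
  have : IsManifold I 1 M := IsManifold.of_le (n := ∞) (by simp)
  have h := isInvertible_mfderivWithin_extChartAt_symm (I := I) hξ
  rwa [I.range_eq_univ, mfderivWithin_univ] at h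

theorem mfderiv_chart_symm_chartField (x₀ : M) (V : (x : M) → TangentSpace I x) {ξ : E}
    (hξ : ξ ∈ (extChartAt I x₀).target) :
    mfderiv 𝓘(ℝ, E) I (extChartAt I x₀).symm ξ (chartField I x₀ V ξ : E) =
      V ((extChartAt I x₀).symm ξ) := by
  obtain ⟨e, he⟩ := isInvertible_mfderiv_extChartAt_symm x₀ hξ
  simp only [chartField, VectorField.mpullback]
  rw [← he, ContinuousLinearMap.inverse_equiv]
  exact e.apply_symm_apply _

theorem contDiffOn_chartField [IsManifold I 1 M] (x₀ : M) {V : (x : M) → TangentSpace I x}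
    (hV : SmoothFieldOn I V Set.univ) :
    ContDiffOn ℝ ∞ (chartField I x₀ V) (extChartAt I x₀).target := by
  intro ξ hξ
  have h := ContMDiffAt.mpullback_vectorField_preimage (I := 𝓘(ℝ, E)) (I' := I) (m := ∞) (n := ∞)
    (f := (extChartAt I x₀).symm) (V := V) (x₀ := ξ)
    (hV.contMDiffAt Filter.univ_mem) (contMDiffAt_extChartAt_symm_of_mem x₀ hξ)
    (isInvertible_mfderiv_extChartAt_symm x₀ hξ) (by simp)
  exact ((contMDiffAt_vectorSpace_iff_contDiffAt).1 h).contDiffWithinAt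

theorem lieBracket_chartField [IsManifold I 1 M] (x₀ : M) {V W : (x : M) → TangentSpace I x}
    (hV : SmoothFieldOn I V Set.univ) (hW : SmoothFieldOn I W Set.univ) {ξ : E}
    (hξ : ξ ∈ (extChartAt I x₀).target) :
    VectorField.lieBracket ℝ (chartField I x₀ V) (chartField I x₀ W) ξ =
      chartField I x₀ (VectorField.mlieBracket I V W) ξ := by
  have h2 : IsManifold I (minSmoothness ℝ 2) M := by
    simp only [minSmoothness_of_isRCLikeNormedField]
    exact IsManifold.of_le (n := ∞) ENat.LEInfty.out
  have h := VectorField.mpullback_mlieBracket (I := 𝓘(ℝ, E)) (I' := I) (n := ∞)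
    (f := (extChartAt I x₀).symm) (V := V) (W := W) (x₀ := ξ)
    ((hV.contMDiffAt Filter.univ_mem).mdifferentiableAt (by simp))
    ((hW.contMDiffAt Filter.univ_mem).mdifferentiableAt (by simp))
    (contMDiffAt_extChartAt_symm_of_mem x₀ hξ) (by
      simp only [minSmoothness_of_isRCLikeNormedField]; exact ENat.LEInfty.out)
  have h' : ∀ A B : (ξ : E) → TangentSpace 𝓘(ℝ, E) ξ, VectorField.mlieBracket 𝓘(ℝ, E) A B ξ =
      VectorField.lieBracket ℝ A B ξ := fun A B => by
    rw [← VectorField.mlieBracketWithin_univ, VectorField.mlieBracketWithin_eq_lieBracketWithin]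
    exact congrFun VectorField.lieBracketWithin_univ ξ
  exact ((h' _ _).symm.trans h.symm)

theorem hasMFDerivAt_prodChart (x₀ : M) {z : E × F} (hz : z.1 ∈ (extChartAt I x₀).target) :
    HasMFDerivAt 𝓘(ℝ, E × F) (I.prod 𝓘(ℝ, F)) (prodChart I F x₀) z
      (ContinuousLinearMap.prod
        (ContinuousLinearMap.comp (mfderiv 𝓘(ℝ, E) I (extChartAt I x₀).symm z.1)
          (ContinuousLinearMap.fst ℝ E F))
        (ContinuousLinearMap.snd ℝ E F)) := by
  have h1 : HasMFDerivAt 𝓘(ℝ, E) I (extChartAt I x₀).symm z.1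
      (mfderiv 𝓘(ℝ, E) I (extChartAt I x₀).symm z.1) :=
    ((contMDiffAt_extChartAt_symm_of_mem x₀ hz).mdifferentiableAt (by simp)).hasMFDerivAt
  exact (HasMFDerivAt.comp z h1 (ContinuousLinearMap.fst ℝ E F).hasMFDerivAt).prodMk
    (ContinuousLinearMap.snd ℝ E F).hasMFDerivAt

theorem contMDiffOn_prodChart (x₀ : M) :
    ContMDiffOn 𝓘(ℝ, E × F) (I.prod 𝓘(ℝ, F)) ∞ (prodChart I F x₀)
      ((extChartAt I x₀).target ×ˢ Set.univ) :=
  ((contMDiffOn_extChartAt_symm x₀).comp (ContinuousLinearMap.fst ℝ E F).contMDiff.contMDiffOn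
    (fun _ hz => hz.1)).prodMk (ContinuousLinearMap.snd ℝ E F).contMDiff.contMDiffOn

theorem contMDiffOn_prodChart_symm (x₀ : M) :
    ContMDiffOn (I.prod 𝓘(ℝ, F)) 𝓘(ℝ, E × F) ∞ (fun q : M × F => (extChartAt I x₀ q.1, q.2))
      ((extChartAt I x₀).source ×ˢ Set.univ) := by
  have h : ContMDiffOn I 𝓘(ℝ, E) ∞ (extChartAt I x₀) (extChartAt I x₀).source := by
    rw [extChartAt_source]; exact contMDiffOn_extChartAt
  exact (h.comp contMDiff_fst.contMDiffOn (fun _ hz => hz.1)).prodMk_space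
    contMDiff_snd.contMDiffOn

/-- The derivative of a function read in a chart. -/
theorem fderiv_comp_prodChart (x₀ : M) {h : M × F → ℝ} {z : E × F}
    (hz : z.1 ∈ (extChartAt I x₀).target)
    (hh : MDifferentiableAt (I.prod 𝓘(ℝ, F)) 𝓘(ℝ, ℝ) h (prodChart I F x₀ z))
    (V : (x : M) → TangentSpace I x) (w : F) :
    fderiv ℝ (h ∘ prodChart I F x₀) z (chartField I x₀ V z.1, w) =
      mfderiv (I.prod 𝓘(ℝ, F)) 𝓘(ℝ, ℝ) h (prodChart I F x₀ z)
        ((V (prodChart I F x₀ z).1, w) : E × F) := by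
  have h1 := HasMFDerivAt.comp z hh.hasMFDerivAt (hasMFDerivAt_prodChart (F := F) x₀ hz)
  have h1' : HasFDerivAt (h ∘ prodChart I F x₀) (_ : E × F →L[ℝ] ℝ) z :=
    hasMFDerivAt_iff_hasFDerivAt.1 h1
  rw [h1'.fderiv]
  have h2 : mfderiv 𝓘(ℝ, E) I (extChartAt I x₀).symm z.1 (chartField I x₀ V z.1 : E) =
    V (prodChart I F x₀ z).1 := mfderiv_chart_symm_chartField x₀ V hz
  rw [← h2]
  rfl

end Chart

/-! ### Lie derivatives -/

section LieDeriv

set_option linter.unusedSectionVars false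

variable {E : Type*} [NormedAddCommGroup E] [NormedSpace ℝ E]
  {H : Type*} [TopologicalSpace H] {I : ModelWithCorners ℝ E H}
  {M : Type*} [TopologicalSpace M] [ChartedSpace H M]

theorem mdifferentiableAt_of_contMDiffOn {h : M → ℝ} {U : Set M} (hU : IsOpen U)
    (hh : ContMDiffOn I 𝓘(ℝ, ℝ) ∞ h U) {q : M} (hq : q ∈ U) :
    MDifferentiableAt I 𝓘(ℝ, ℝ) h q :=
  (hh.contMDiffAt (hU.mem_nhds hq)).mdifferentiableAt (by simp)

theorem differential_congr {h h' : M → ℝ} {U : Set M} (hU : IsOpen U)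
    (heq : ∀ q ∈ U, h q = h' q) {q : M} (hq : q ∈ U) :
    differential I h q = differential I h' q :=
  Filter.EventuallyEq.mfderiv_eq (by filter_upwards [hU.mem_nhds hq] with z hz using heq z hz)

theorem lieDeriv_congr {h h' : M → ℝ} {U : Set M} (hU : IsOpen U) (heq : ∀ q ∈ U, h q = h' q)
    (V : (x : M) → TangentSpace I x) {q : M} (hq : q ∈ U) :
    lieDeriv I V h q = lieDeriv I V h' q := by
  rw [lieDeriv, lieDeriv, differential_congr hU heq hq]

theorem differential_const (c : ℝ) (q : M) : differential I (fun _ : M => c) q = 0 :=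
  mfderiv_const

theorem lieDeriv_eq_zero_of_eq_zero {h : M → ℝ} {U : Set M} (hU : IsOpen U)
    (heq : ∀ q ∈ U, h q = 0) (V : (x : M) → TangentSpace I x) {q : M} (hq : q ∈ U) :
    lieDeriv I V h q = 0 := by
  rw [lieDeriv_congr hU heq V hq, lieDeriv, differential_const]
  rfl

theorem differential_mul {f h : M → ℝ} {q : M} (hf : MDifferentiableAt I 𝓘(ℝ, ℝ) f q)
    (hh : MDifferentiableAt I 𝓘(ℝ, ℝ) h q) (v : TangentSpace I q) :
    differential I (fun z => f z * h z) q v =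
      f q * differential I h q v + h q * differential I f q v := by
  have := hf.hasMFDerivAt.mul hh.hasMFDerivAt
  have h2 : mfderiv I 𝓘(ℝ, ℝ) (fun z => f z * h z) q = _ := this.mfderiv
  rw [differential, h2]
  rfl

theorem differential_add {f h : M → ℝ} {q : M} (hf : MDifferentiableAt I 𝓘(ℝ, ℝ) f q)
    (hh : MDifferentiableAt I 𝓘(ℝ, ℝ) h q) (v : TangentSpace I q) :
    differential I (fun z => f z + h z) q v =
      differential I f q v + differential I h q v := by
  have h1 := hf.hasMFDerivAt.add hh.hasMFDerivAt
  have h2 : mfderiv I 𝓘(ℝ, ℝ) (fun z => f z + h z) q = _ := h1.mfderiv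
  rw [differential, h2]
  rfl

theorem mdifferentiableAt_finset_sum {ι : Type*} (s : Finset ι) {f : ι → M → ℝ} {q : M}
    (hf : ∀ i ∈ s, MDifferentiableAt I 𝓘(ℝ, ℝ) (f i) q) :
    MDifferentiableAt I 𝓘(ℝ, ℝ) (fun z => ∑ i ∈ s, f i z) q := by
  classical
  induction s using Finset.induction_on with
  | empty => simpa using mdifferentiableAt_const
  | insert a s ha ih =>
    simp only [Finset.sum_insert ha]
    exact ((hf a (Finset.mem_insert_self a s)).hasMFDerivAt.add
      (ih fun i hi => hf i (Finset.mem_insert_of_mem hi)).hasMFDerivAt).mdifferentiableAt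

theorem differential_sum {ι : Type*} (s : Finset ι) {f : ι → M → ℝ} {q : M}
    (hf : ∀ i ∈ s, MDifferentiableAt I 𝓘(ℝ, ℝ) (f i) q) (v : TangentSpace I q) :
    differential I (fun z => ∑ i ∈ s, f i z) q v = ∑ i ∈ s, differential I (f i) q v := by
  classical
  induction s using Finset.induction_on with
  | empty => simp only [Finset.sum_empty]; rw [differential_const]; rfl
  | insert a s ha ih =>
    have hs := mdifferentiableAt_finset_sum s fun i hi => hf i (Finset.mem_insert_of_mem hi)
    simp only [Finset.sum_insert ha]
    rw [← ih fun i hi => hf i (Finset.mem_insert_of_mem hi),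
      ← differential_add (hf a (Finset.mem_insert_self a s)) hs]

theorem contMDiffOn_mul {f h : M → ℝ} {U : Set M} (hf : ContMDiffOn I 𝓘(ℝ, ℝ) ∞ f U)
    (hh : ContMDiffOn I 𝓘(ℝ, ℝ) ∞ h U) : ContMDiffOn I 𝓘(ℝ, ℝ) ∞ (fun z => f z * h z) U :=
  (contDiff_mul (𝕜 := ℝ) (𝔸 := ℝ) (n := ∞)).contMDiff.comp_contMDiffOn (hf.prodMk_space hh)

theorem contMDiffOn_add {f h : M → ℝ} {U : Set M} (hf : ContMDiffOn I 𝓘(ℝ, ℝ) ∞ f U)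
    (hh : ContMDiffOn I 𝓘(ℝ, ℝ) ∞ h U) : ContMDiffOn I 𝓘(ℝ, ℝ) ∞ (fun z => f z + h z) U :=
  (contDiff_add (𝕜 := ℝ) (F := ℝ) (n := ∞)).contMDiff.comp_contMDiffOn (hf.prodMk_space hh)

theorem contMDiffOn_finset_sum {ι : Type*} (s : Finset ι) {f : ι → M → ℝ} {U : Set M}
    (hf : ∀ i ∈ s, ContMDiffOn I 𝓘(ℝ, ℝ) ∞ (f i) U) :
    ContMDiffOn I 𝓘(ℝ, ℝ) ∞ (fun z => ∑ i ∈ s, f i z) U := by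
  classical
  induction s using Finset.induction_on with
  | empty => simpa using contMDiffOn_const
  | insert a s ha ih =>
    simp only [Finset.sum_insert ha]
    exact contMDiffOn_add (hf a (Finset.mem_insert_self a s))
      (ih fun i hi => hf i (Finset.mem_insert_of_mem hi))

end LieDeriv

/-! ### Lifted fields -/

section Lift

set_option linter.unusedSectionVars false

variable {E : Type*} [NormedAddCommGroup E] [NormedSpace ℝ E] [FiniteDimensional ℝ E]
  {H : Type*} [TopologicalSpace H] {I : ModelWithCorners ℝ E H} [I.Boundaryless]
  {M : Type*} [TopologicalSpace M] [ChartedSpace H M] [IsManifold I ∞ M] [IsManifold I 1 M]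
  {m : ℕ} {j : Fin m → ℕ}

variable (I) in
/-- The field on `M × ℝ^|j|` with components a field on `M` and a constant vector. -/
def liftField (V : (x : M) → TangentSpace I x) (w : Chains j) (q : M × Chains j) :
    TangentSpace (I.prod 𝓘(ℝ, Chains j)) q :=
  tangentPair I q (V q.1) w

theorem lieDeriv_liftField_prodChart (x₀ : M) (V : (x : M) → TangentSpace I x) (w : Chains j)
    {h : M × Chains j → ℝ} {z : E × Chains j} (hz : z.1 ∈ (extChartAt I x₀).target)
    (hh : MDifferentiableAt (I.prod 𝓘(ℝ, Chains j)) 𝓘(ℝ, ℝ) h (prodChart I (Chains j) x₀ z)) :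
    lieDeriv (I.prod 𝓘(ℝ, Chains j)) (liftField I V w) h (prodChart I (Chains j) x₀ z) =
      fderiv ℝ (h ∘ prodChart I (Chains j) x₀) z (chartField I x₀ V z.1, w) :=
  (fderiv_comp_prodChart x₀ hz hh V w).symm

theorem isOpen_prodChart_preimage (x₀ : M) {U : Set (M × Chains j)} (hU : IsOpen U) :
    IsOpen ((extChartAt I x₀).target ×ˢ Set.univ ∩ prodChart I (Chains j) x₀ ⁻¹' U) :=
  (contMDiffOn_prodChart x₀).continuousOn.isOpen_inter_preimage
    ((isOpen_extChartAt_target x₀).prod isOpen_univ) hU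

theorem contDiffOn_comp_prodChart (x₀ : M) {U : Set (M × Chains j)} {h : M × Chains j → ℝ}
    (hh : ContMDiffOn (I.prod 𝓘(ℝ, Chains j)) 𝓘(ℝ, ℝ) ∞ h U) :
    ContDiffOn ℝ ∞ (h ∘ prodChart I (Chains j) x₀)
      ((extChartAt I x₀).target ×ˢ Set.univ ∩ prodChart I (Chains j) x₀ ⁻¹' U) :=
  contMDiffOn_iff_contDiffOn.1
    (hh.comp ((contMDiffOn_prodChart x₀).mono Set.inter_subset_left) fun _ hz => hz.2)

theorem prodChart_extChartAt (q : M × Chains j) :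
    prodChart I (Chains j) q.1 (extChartAt I q.1 q.1, q.2) = q :=
  Prod.ext (extChartAt_to_inv q.1) rfl

theorem contDiffOn_lieDeriv_liftField_chart (x₀ : M) {V : (x : M) → TangentSpace I x}
    (hV : SmoothFieldOn I V Set.univ) (w : Chains j) {U : Set (M × Chains j)} (hU : IsOpen U)
    {h : M × Chains j → ℝ} (hh : ContMDiffOn (I.prod 𝓘(ℝ, Chains j)) 𝓘(ℝ, ℝ) ∞ h U) :
    ContDiffOn ℝ ∞ (fun z : E × Chains j =>
      fderiv ℝ (h ∘ prodChart I (Chains j) x₀) z (chartField I x₀ V z.1, w))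
      ((extChartAt I x₀).target ×ˢ Set.univ ∩ prodChart I (Chains j) x₀ ⁻¹' U) := by
  refine ContDiffOn.clm_apply ((contDiffOn_comp_prodChart x₀ hh).fderiv_of_isOpen
    (isOpen_prodChart_preimage x₀ hU) (by simp)) (ContDiffOn.prodMk ?_ contDiffOn_const)
  exact (contDiffOn_chartField x₀ hV).comp contDiff_fst.contDiffOn fun z hz => hz.1.1

theorem contMDiffOn_lieDeriv_liftField {V : (x : M) → TangentSpace I x}
    (hV : SmoothFieldOn I V Set.univ) (w : Chains j) {U : Set (M × Chains j)} (hU : IsOpen U)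
    {h : M × Chains j → ℝ} (hh : ContMDiffOn (I.prod 𝓘(ℝ, Chains j)) 𝓘(ℝ, ℝ) ∞ h U) :
    ContMDiffOn (I.prod 𝓘(ℝ, Chains j)) 𝓘(ℝ, ℝ) ∞
      (lieDeriv (I.prod 𝓘(ℝ, Chains j)) (liftField I V w) h) U := by
  intro q hq
  set x₀ := q.1
  set S : Set (M × Chains j) := (extChartAt I x₀).source ×ˢ Set.univ ∩ U with hS
  have hSo : IsOpen S := ((isOpen_extChartAt_source x₀).prod isOpen_univ).inter hU
  have hqS : q ∈ S := ⟨⟨mem_extChartAt_source x₀, Set.mem_univ _⟩, hq⟩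
  have hinv : ∀ q' ∈ S, prodChart I (Chains j) x₀ (extChartAt I x₀ q'.1, q'.2) = q' :=
    fun q' hq' => Prod.ext ((extChartAt I x₀).left_inv hq'.1.1) rfl
  have h1 := (contDiffOn_lieDeriv_liftField_chart x₀ hV w hU hh).contMDiffOn.comp
    ((contMDiffOn_prodChart_symm x₀).mono (Set.inter_subset_left (t := U)))
    (fun q' hq' => ⟨⟨(extChartAt I x₀).map_source hq'.1.1, Set.mem_univ _⟩, by
      show prodChart I (Chains j) x₀ (extChartAt I x₀ q'.1, q'.2) ∈ U
      rw [hinv q' hq']; exact hq'.2⟩)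
  have h2 : ContMDiffOn (I.prod 𝓘(ℝ, Chains j)) 𝓘(ℝ, ℝ) ∞
      (lieDeriv (I.prod 𝓘(ℝ, Chains j)) (liftField I V w) h) S := by
    refine h1.congr fun q' hq' => ?_
    have h3 := lieDeriv_liftField_prodChart x₀ V w (h := h)
      (z := (extChartAt I x₀ q'.1, q'.2)) ((extChartAt I x₀).map_source hq'.1.1)
      (by rw [hinv q' hq']; exact mdifferentiableAt_of_contMDiffOn hU hh hq'.2)
    rw [hinv q' hq'] at h3
    exact h3
  exact (h2.contMDiffAt (hSo.mem_nhds hqS)).contMDiffWithinAt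

/-- The commutator of lifted fields is the lifted bracket. -/
theorem lieDeriv_liftField_comm {V W : (x : M) → TangentSpace I x}
    (hV : SmoothFieldOn I V Set.univ) (hW : SmoothFieldOn I W Set.univ) (w w' : Chains j)
    {U : Set (M × Chains j)} (hU : IsOpen U) {h : M × Chains j → ℝ}
    (hh : ContMDiffOn (I.prod 𝓘(ℝ, Chains j)) 𝓘(ℝ, ℝ) ∞ h U) {q : M × Chains j} (hq : q ∈ U) :
    lieDeriv (I.prod 𝓘(ℝ, Chains j)) (liftField I V w)
        (lieDeriv (I.prod 𝓘(ℝ, Chains j)) (liftField I W w') h) q =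
      lieDeriv (I.prod 𝓘(ℝ, Chains j)) (liftField I W w')
        (lieDeriv (I.prod 𝓘(ℝ, Chains j)) (liftField I V w) h) q +
      lieDeriv (I.prod 𝓘(ℝ, Chains j))
        (liftField I (VectorField.mlieBracket I V W) (0 : Chains j)) h q := by
  set x₀ := q.1 with hx₀
  set f := h ∘ prodChart I (Chains j) x₀ with hf
  set O := (extChartAt I x₀).target ×ˢ Set.univ ∩ prodChart I (Chains j) x₀ ⁻¹' U with hO
  have hOo : IsOpen O := isOpen_prodChart_preimage x₀ hU
  set z : E × Chains j := (extChartAt I x₀ x₀, q.2) with hz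
  have hzq : prodChart I (Chains j) x₀ z = q := prodChart_extChartAt q
  have hzO : z ∈ O := ⟨⟨mem_extChartAt_target x₀, Set.mem_univ _⟩, by
    show prodChart I (Chains j) x₀ z ∈ U
    rw [hzq]; exact hq⟩
  have hfs : ContDiffOn ℝ ∞ f O := contDiffOn_comp_prodChart x₀ hh
  have hf1 : DifferentiableAt ℝ (fderiv ℝ f) z :=
    ((hfs.fderiv_of_isOpen hOo (m := ∞) (by simp)).contDiffAt (hOo.mem_nhds hzO)).differentiableAt
      (by simp)
  -- In the chart a second Lie derivative is a Hessian term plus `df` applied to the derivative of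
  -- `W` along `V`. On exchanging the fields the Hessian terms cancel by symmetry, and the rest is
  -- `df` of the bracket; the constant components contribute nothing to it.
  have hsecond : ∀ {V W : (x : M) → TangentSpace I x}, SmoothFieldOn I V Set.univ →
      SmoothFieldOn I W Set.univ → ∀ w w' : Chains j,
      lieDeriv (I.prod 𝓘(ℝ, Chains j)) (liftField I V w)
        (lieDeriv (I.prod 𝓘(ℝ, Chains j)) (liftField I W w') h) q =
      fderiv ℝ (fderiv ℝ f) z (chartField I x₀ V z.1, w) (chartField I x₀ W z.1, w') +
      fderiv ℝ f z (fderiv ℝ (chartField I x₀ W) z.1 (chartField I x₀ V z.1), 0) := by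
    intro V W hV hW w w'
    have hd := mdifferentiableAt_of_contMDiffOn hU
      (contMDiffOn_lieDeriv_liftField hW w' hU hh) hq
    have h1 := lieDeriv_liftField_prodChart x₀ V w (z := z) hzO.1.1 (by rw [hzq]; exact hd)
    rw [hzq] at h1
    rw [h1]
    have h2 : (lieDeriv (I.prod 𝓘(ℝ, Chains j)) (liftField I W w') h) ∘
        prodChart I (Chains j) x₀ =ᶠ[𝓝 z] fun z => fderiv ℝ f z (chartField I x₀ W z.1, w') := by
      filter_upwards [hOo.mem_nhds hzO] with z' hz'
      exact lieDeriv_liftField_prodChart x₀ W w' hz'.1.1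
        (mdifferentiableAt_of_contMDiffOn hU hh hz'.2)
    rw [h2.fderiv_eq]
    have hWd : HasFDerivAt (chartField I x₀ W) (fderiv ℝ (chartField I x₀ W) z.1) z.1 :=
      (((contDiffOn_chartField x₀ hW).contDiffAt
        ((isOpen_extChartAt_target x₀).mem_nhds hzO.1.1)).differentiableAt (by simp)).hasFDerivAt
    have h3 : HasFDerivAt (fun z : E × Chains j => (chartField I x₀ W z.1, w')) _ z :=
      (HasFDerivAt.comp (g := chartField I x₀ W) z hWd hasFDerivAt_fst).prodMk
        (hasFDerivAt_const w' z)
    rw [(hf1.hasFDerivAt.clm_apply h3).fderiv]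
    simp [add_comm]
  have hbr := lieDeriv_liftField_prodChart x₀ (VectorField.mlieBracket I V W) (0 : Chains j)
    (z := z) (h := h) hzO.1.1 (by rw [hzq]; exact mdifferentiableAt_of_contMDiffOn hU hh hq)
  rw [hzq, ← lieBracket_chartField x₀ hV hW hzO.1.1, VectorField.lieBracket_eq] at hbr
  rw [hsecond hV hW, hsecond hW hV, hbr]
  have hsymm : IsSymmSndFDerivAt ℝ f z := by
    refine (hfs.contDiffAt (hOo.mem_nhds hzO)).isSymmSndFDerivAt ?_
    simp only [minSmoothness_of_isRCLikeNormedField]; exact ENat.LEInfty.out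
  rw [hsymm (chartField I x₀ V z.1, w)]
  have hsub : ((fderiv ℝ (chartField I x₀ W) z.1 (chartField I x₀ V z.1) -
      fderiv ℝ (chartField I x₀ V) z.1 (chartField I x₀ W z.1), (0 : Chains j)) : E × Chains j) =
      (fderiv ℝ (chartField I x₀ W) z.1 (chartField I x₀ V z.1), 0) -
      (fderiv ℝ (chartField I x₀ V) z.1 (chartField I x₀ W z.1), 0) := by simp
  simp only
  rw [hsub, map_sub]
  ring

end Lift

/-! ### Lie derivatives along the fields of a prolonged driftless system -/

section Prolongation

set_option linter.unusedSectionVars false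

variable {E : Type*} [NormedAddCommGroup E] [NormedSpace ℝ E] [FiniteDimensional ℝ E]
  {H : Type*} [TopologicalSpace H] {I : ModelWithCorners ℝ E H} [I.Boundaryless]
  {M : Type*} [TopologicalSpace M] [ChartedSpace H M] [IsManifold I ∞ M] [IsManifold I 1 M]
  {m : ℕ} {j : Fin m → ℕ}

theorem smoothFieldOn_zero : SmoothFieldOn I (0 : (x : M) → TangentSpace I x) Set.univ :=
  (Bundle.contMDiff_zeroSection ℝ (TangentSpace I : M → Type _)).contMDiffOn

theorem smoothFieldOn_mlieBracket {V W : (x : M) → TangentSpace I x}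
    (hV : SmoothFieldOn I V Set.univ) (hW : SmoothFieldOn I W Set.univ) :
    SmoothFieldOn I (VectorField.mlieBracket I V W) Set.univ := by
  have hinst : IsManifold I (((⊤ : ℕ∞) : WithTop ℕ∞) + 1) M := by
    have : (((⊤ : ℕ∞) : WithTop ℕ∞) + 1) = ∞ := rfl
    rw [this]; infer_instance
  have h2 : IsManifold I (minSmoothness ℝ 2) M := by
    simp only [minSmoothness_of_isRCLikeNormedField]
    exact IsManifold.of_le (n := ∞) ENat.LEInfty.out
  intro x _
  refine ContMDiffAt.contMDiffWithinAt ?_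
  exact ContMDiffAt.mlieBracket_vectorField (m := ⊤) (n := ⊤)
    (hV.contMDiffAt Filter.univ_mem) (hW.contMDiffAt Filter.univ_mem)
    (by rw [minSmoothness_of_isRCLikeNormedField]; exact le_of_eq rfl)

/-- The linear form `u_i^(p)`. -/
def inputDerivCLM (j : Fin m → ℕ) (i : Fin m) (p : ℕ) : Chains j →L[ℝ] ℝ :=
  if h : p < j i then ContinuousLinearMap.proj ⟨i, ⟨p, h⟩⟩ else 0

theorem inputDerivCLM_apply (i : Fin m) (p : ℕ) (w : Chains j) :
    inputDerivCLM j i p w = inputDeriv w i p := by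
  unfold inputDerivCLM inputDeriv
  split_ifs <;> rfl

theorem contMDiff_inputDeriv (i : Fin m) (p : ℕ) :
    ContMDiff (I.prod 𝓘(ℝ, Chains j)) 𝓘(ℝ, ℝ) ∞
      (fun q : M × Chains j => inputDeriv q.2 i p) := by
  have h := (inputDerivCLM j i p).contMDiff.comp
    (contMDiff_snd (I := I) (M := M) (J := 𝓘(ℝ, Chains j)) (N := Chains j) (n := ∞))
  refine h.congr fun q => ?_
  exact (inputDerivCLM_apply i p q.2).symm

theorem lieDeriv_inputDeriv (i : Fin m) (p : ℕ) (V : (x : M) → TangentSpace I x) (w : Chains j)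
    (q : M × Chains j) :
    lieDeriv (I.prod 𝓘(ℝ, Chains j)) (liftField I V w) (fun q => inputDeriv q.2 i p) q =
      inputDeriv w i p := by
  have h := HasMFDerivAt.comp q (inputDerivCLM j i p).hasMFDerivAt
    (hasMFDerivAt_snd (I := I) (I' := 𝓘(ℝ, Chains j)) q)
  have h' : HasMFDerivAt (I.prod 𝓘(ℝ, Chains j)) 𝓘(ℝ, ℝ)
      (fun q : M × Chains j => inputDeriv q.2 i p) q _ :=
    h.congr_of_eventuallyEq (Filter.Eventually.of_forall fun q' =>
      (inputDerivCLM_apply i p q'.2).symm)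
  rw [lieDeriv, differential, h'.mfderiv]
  exact inputDerivCLM_apply i p w

/-- Lie derivatives along a pair are linear in the pair. -/
theorem differential_tangentPair_sum {h : M × Chains j → ℝ} {q : M × Chains j}
    {ι : Type*} (s : Finset ι) (c : ι → ℝ) (v : ι → TangentSpace I q.1) (w : Chains j) :
    differential (I.prod 𝓘(ℝ, Chains j)) h q (tangentPair I q (∑ i ∈ s, c i • v i) w) =
      ∑ i ∈ s, c i * differential (I.prod 𝓘(ℝ, Chains j)) h q (tangentPair I q (v i) 0) +
      ∑ a, w a * differential (I.prod 𝓘(ℝ, Chains j)) h q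
        (tangentPair I q 0 (Pi.single a 1)) := by
  classical
  have hdec : tangentPair I q (∑ i ∈ s, c i • v i) w =
      ∑ i ∈ s, c i • tangentPair I q (v i) (0 : Chains j) +
        ∑ a, w a • tangentPair I q (0 : TangentSpace I q.1) (Pi.single a 1) := by
    have h1 : ∀ i, c i • tangentPair I q (v i) (0 : Chains j) =
        ((c i • v i, 0) : E × Chains j) := fun i => by
      simp only [tangentPair]
      exact Prod.ext rfl (smul_zero _)
    have h2 : ∀ a, w a • tangentPair I q (0 : TangentSpace I q.1) (Pi.single a 1) =
        ((0, w a • Pi.single a 1) : E × Chains j) := fun a => by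
      simp only [tangentPair]
      exact Prod.ext (smul_zero (w a) : w a • (0 : E) = 0) rfl
    have h3 : (∑ i ∈ s, c i • tangentPair I q (v i) (0 : Chains j)) =
        ((∑ i ∈ s, c i • v i, 0) : E × Chains j) := by
      rw [Finset.sum_congr rfl fun i _ => h1 i]
      refine Prod.ext ?_ ?_
      · exact Prod.fst_sum (s := s) (f := fun i => ((c i • v i, 0) : E × Chains j))
      · refine (Prod.snd_sum (s := s) (f := fun i => ((c i • v i, 0) : E × Chains j))).trans ?_
        simp
    have h4 : (∑ a, w a • tangentPair I q (0 : TangentSpace I q.1) (Pi.single a 1)) =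
        ((0, w) : E × Chains j) := by
      rw [Finset.sum_congr rfl fun i _ => h2 i]
      refine Prod.ext ?_ ?_
      · refine (Prod.fst_sum (f := fun a => ((0, w a • Pi.single a 1) : E × Chains j))).trans ?_
        simp
      · refine (Prod.snd_sum (f := fun a => ((0, w a • Pi.single a 1) : E × Chains j))).trans ?_
        simp only
        ext b
        simp [Finset.sum_apply, Pi.single_apply]
    rw [h3, h4]
    exact Prod.ext (add_zero _).symm (zero_add _).symm
  rw [hdec, map_add, map_sum, map_sum]
  simp only [map_smul, smul_eq_mul]

/-- The constant part of the bracket of a constant vertical field with the prolonged drift. -/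
def shiftChains (w : Chains j) : Chains j := fun c => inputDeriv w c.1 ((c.2 : ℕ) + 1)

variable (g : Fin m → (x : M) → TangentSpace I x)

theorem lieDeriv_drift (h : M × Chains j → ℝ) (q : M × Chains j) :
    lieDeriv (I.prod 𝓘(ℝ, Chains j)) ((driftless I g).prolong j).drift h q =
      ∑ i, inputDeriv q.2 i 0 *
        lieDeriv (I.prod 𝓘(ℝ, Chains j)) (liftField I (g i) (0 : Chains j)) h q +
      ∑ a : (i : Fin m) × Fin (j i), inputDeriv q.2 a.1 ((a.2 : ℕ) + 1) *
        lieDeriv (I.prod 𝓘(ℝ, Chains j)) (liftField I 0 (Pi.single a 1)) h q := by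
  have h1 : ((driftless I g).prolong j).drift q =
      tangentPair I q (∑ i, inputDeriv q.2 i 0 • g i q.1) (shiftChains q.2) := by
    simp only [ControlAffineSystem.prolong, driftless, zero_add]
    rfl
  rw [lieDeriv, h1, differential_tangentPair_sum]
  rfl

theorem contMDiffOn_lieDeriv_drift (hg : ∀ i, SmoothFieldOn I (g i) Set.univ)
    {U : Set (M × Chains j)} (hU : IsOpen U) {h : M × Chains j → ℝ}
    (hh : ContMDiffOn (I.prod 𝓘(ℝ, Chains j)) 𝓘(ℝ, ℝ) ∞ h U) :
    ContMDiffOn (I.prod 𝓘(ℝ, Chains j)) 𝓘(ℝ, ℝ) ∞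
      (lieDeriv (I.prod 𝓘(ℝ, Chains j)) ((driftless I g).prolong j).drift h) U := by
  refine ContMDiffOn.congr (contMDiffOn_add
    (contMDiffOn_finset_sum Finset.univ fun i _ => contMDiffOn_mul
      (contMDiff_inputDeriv (I := I) i 0).contMDiffOn
      (contMDiffOn_lieDeriv_liftField (hg i) (0 : Chains j) hU hh))
    (contMDiffOn_finset_sum Finset.univ fun a _ => contMDiffOn_mul
      (contMDiff_inputDeriv (I := I) a.1 ((a.2 : ℕ) + 1)).contMDiffOn
      (contMDiffOn_lieDeriv_liftField smoothFieldOn_zero (Pi.single a 1) hU hh)))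
    fun q _ => lieDeriv_drift g h q

theorem contMDiffOn_iterate_lieDeriv_drift (hg : ∀ i, SmoothFieldOn I (g i) Set.univ)
    {U : Set (M × Chains j)} (hU : IsOpen U) {h : M × Chains j → ℝ}
    (hh : ContMDiffOn (I.prod 𝓘(ℝ, Chains j)) 𝓘(ℝ, ℝ) ∞ h U) (k : ℕ) :
    ContMDiffOn (I.prod 𝓘(ℝ, Chains j)) 𝓘(ℝ, ℝ) ∞
      ((lieDeriv (I.prod 𝓘(ℝ, Chains j)) ((driftless I g).prolong j).drift)^[k] h) U := by
  induction k with
  | zero => exact hh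
  | succ k ih =>
    rw [Function.iterate_succ_apply']
    exact contMDiffOn_lieDeriv_drift g hg hU ih

/-- The commutator of a lifted field with the prolonged drift. -/
theorem lieDeriv_liftField_drift (hg : ∀ i, SmoothFieldOn I (g i) Set.univ)
    {V : (x : M) → TangentSpace I x} (hV : SmoothFieldOn I V Set.univ) (w : Chains j)
    {U : Set (M × Chains j)} (hU : IsOpen U) {h : M × Chains j → ℝ}
    (hh : ContMDiffOn (I.prod 𝓘(ℝ, Chains j)) 𝓘(ℝ, ℝ) ∞ h U) {q : M × Chains j} (hq : q ∈ U) :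
    lieDeriv (I.prod 𝓘(ℝ, Chains j)) (liftField I V w)
        (lieDeriv (I.prod 𝓘(ℝ, Chains j)) ((driftless I g).prolong j).drift h) q =
      lieDeriv (I.prod 𝓘(ℝ, Chains j)) ((driftless I g).prolong j).drift
        (lieDeriv (I.prod 𝓘(ℝ, Chains j)) (liftField I V w) h) q +
      lieDeriv (I.prod 𝓘(ℝ, Chains j))
        (liftField I (fun x => ∑ i, inputDeriv w i 0 • g i x) (shiftChains w)) h q +
      ∑ i, inputDeriv q.2 i 0 * lieDeriv (I.prod 𝓘(ℝ, Chains j))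
        (liftField I (VectorField.mlieBracket I V (g i)) (0 : Chains j)) h q := by
  have hmd : ∀ {f : M × Chains j → ℝ}, ContMDiffOn (I.prod 𝓘(ℝ, Chains j)) 𝓘(ℝ, ℝ) ∞ f U →
      MDifferentiableAt (I.prod 𝓘(ℝ, Chains j)) 𝓘(ℝ, ℝ) f q := fun hf =>
    mdifferentiableAt_of_contMDiffOn hU hf hq
  have hgs := fun i => contMDiffOn_lieDeriv_liftField (hg i) (0 : Chains j) hU hh
  have hes := fun a : (i : Fin m) × Fin (j i) =>
    contMDiffOn_lieDeriv_liftField (smoothFieldOn_zero (I := I) (M := M)) (Pi.single a 1) hU hh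
  have hus := fun i p => (contMDiff_inputDeriv (I := I) (M := M) (j := j) i p).contMDiffOn (s := U)
  have hprod : ∀ i p {f : M × Chains j → ℝ},
      ContMDiffOn (I.prod 𝓘(ℝ, Chains j)) 𝓘(ℝ, ℝ) ∞ f U →
      differential (I.prod 𝓘(ℝ, Chains j)) (fun q => inputDeriv q.2 i p * f q) q
        (liftField I V w q) =
      inputDeriv q.2 i p * lieDeriv (I.prod 𝓘(ℝ, Chains j)) (liftField I V w) f q +
        f q * inputDeriv w i p := fun i p f hf => by
    rw [differential_mul (hmd (hus i p)) (hmd hf), ← lieDeriv_inputDeriv i p V w q]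
    rfl
  rw [lieDeriv_congr hU (fun q _ => lieDeriv_drift g h q) _ hq, lieDeriv,
    differential_add
      (mdifferentiableAt_finset_sum _ fun i _ => hmd (contMDiffOn_mul (hus i 0) (hgs i)))
      (mdifferentiableAt_finset_sum _ fun a _ => hmd (contMDiffOn_mul (hus a.1 _) (hes a))),
    differential_sum _ fun i _ => hmd (contMDiffOn_mul (hus i 0) (hgs i)),
    differential_sum _ fun a _ => hmd (contMDiffOn_mul (hus a.1 _) (hes a))]
  simp only [hprod _ _ (hgs _), hprod _ _ (hes _)]
  rw [lieDeriv_drift]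
  have hz : ∀ a : (i : Fin m) × Fin (j i),
      lieDeriv (I.prod 𝓘(ℝ, Chains j)) (liftField I V w)
        (lieDeriv (I.prod 𝓘(ℝ, Chains j)) (liftField I 0 (Pi.single a 1)) h) q =
      lieDeriv (I.prod 𝓘(ℝ, Chains j)) (liftField I 0 (Pi.single a 1))
        (lieDeriv (I.prod 𝓘(ℝ, Chains j)) (liftField I V w) h) q := by
    intro a
    rw [lieDeriv_liftField_comm hV smoothFieldOn_zero w (Pi.single a 1) hU hh hq,
      VectorField.mlieBracket_zero_right, lieDeriv]
    have : liftField I (0 : (x : M) → TangentSpace I x) (0 : Chains j) q = 0 := rfl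
    rw [lieDeriv, this, map_zero, add_zero]
  have hg' := fun i => lieDeriv_liftField_comm hV (hg i) w (0 : Chains j) hU hh hq
  simp only [hz, hg']
  -- Besides the brackets with the `g i`, the commutator contains the derivatives of the drift's
  -- coefficients `u_i^(p)` along the lifted field, namely the components of `w`. They reassemble
  -- into a single lifted field.
  have hlast : lieDeriv (I.prod 𝓘(ℝ, Chains j))
        (liftField I (fun x => ∑ i, inputDeriv w i 0 • g i x) (shiftChains w)) h q =
      ∑ i, inputDeriv w i 0 *
        lieDeriv (I.prod 𝓘(ℝ, Chains j)) (liftField I (g i) (0 : Chains j)) h q +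
      ∑ a, shiftChains w a *
        lieDeriv (I.prod 𝓘(ℝ, Chains j)) (liftField I 0 (Pi.single a 1)) h q := by
    simp only [lieDeriv]
    exact differential_tangentPair_sum _ _ _ _
  rw [hlast]
  simp only [mul_add, Finset.sum_add_distrib, shiftChains]
  simp only [mul_comm (lieDeriv _ _ h q)]
  ring

end Prolongation

/-! ### Iterated brackets of the input fields with the drift -/

section Tower

set_option linter.unusedSectionVars false

variable {E : Type*} [NormedAddCommGroup E] [NormedSpace ℝ E] [FiniteDimensional ℝ E]
  {H : Type*} [TopologicalSpace H] {I : ModelWithCorners ℝ E H} [I.Boundaryless]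
  {M : Type*} [TopologicalSpace M] [ChartedSpace H M] [IsManifold I ∞ M] [IsManifold I 1 M]
  {m : ℕ} {j : Fin m → ℕ}

variable (g : Fin m → (x : M) → TangentSpace I x)

/-- The repeated brackets of the `k`-th input field of a prolongation with its drift: the coordinate
fields of `u_k^(j k - 1 - s)` for `s < j k`, then the lift of `g k`. -/
def tower (j : Fin m → ℕ) (k : Fin m) (s : ℕ) :
    (q : M × Chains j) → TangentSpace (I.prod 𝓘(ℝ, Chains j)) q :=
  liftField I (if j k ≤ s then g k else 0)
    (fun c => if c.1 = k ∧ (c.2 : ℕ) + s + 1 = j c.1 then 1 else 0)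

theorem prolong_input (k : Fin m) : ((driftless I g).prolong j).input k = tower g j k 0 := by
  funext q
  simp only [ControlAffineSystem.prolong, driftless, tower, liftField, nonpos_iff_eq_zero, add_zero]
  congr 1
  split_ifs <;> rfl

theorem tower_top (k : Fin m) : tower g j k (j k) = liftField I (g k) (0 : Chains j) := by
  unfold tower
  rw [if_pos le_rfl]
  congr 1
  funext c
  rw [if_neg]
  · rfl
  · rintro ⟨h1, h2⟩
    have := congrArg j h1
    omega

theorem tower_coord (c : (i : Fin m) × Fin (j i)) :
    tower g j c.1 (j c.1 - 1 - c.2) = liftField I 0 (Pi.single c 1) := by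
  have hc := c.2.2
  unfold tower
  rw [if_neg (by omega)]
  congr 1
  funext d
  by_cases hd : d = c
  · subst hd
    rw [if_pos ⟨rfl, by omega⟩, Pi.single_eq_same]
  · rw [Pi.single_eq_of_ne hd, if_neg]
    rintro ⟨h1, h2⟩
    apply hd
    obtain ⟨d1, d2⟩ := d
    obtain ⟨c1, c2⟩ := c
    simp only at h1
    subst h1
    simp only at h2 hc
    congr 1
    exact Fin.ext (by omega)

theorem contMDiffOn_lieDeriv_tower (hg : ∀ i, SmoothFieldOn I (g i) Set.univ) (k : Fin m) (s : ℕ)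
    {U : Set (M × Chains j)} (hU : IsOpen U) {h : M × Chains j → ℝ}
    (hh : ContMDiffOn (I.prod 𝓘(ℝ, Chains j)) 𝓘(ℝ, ℝ) ∞ h U) :
    ContMDiffOn (I.prod 𝓘(ℝ, Chains j)) 𝓘(ℝ, ℝ) ∞
      (lieDeriv (I.prod 𝓘(ℝ, Chains j)) (tower g j k s) h) U := by
  refine contMDiffOn_lieDeriv_liftField ?_ _ hU hh
  split_ifs
  · exact hg k
  · exact smoothFieldOn_zero

/-- While `s < j k` the field is vertical and constant, so the brackets with the `g i` vanish and
only the shift of indices remains: the coordinate field of `u_k^(p + 1)` goes to that of `u_k^(p)`,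
and the one of `u_k^(0)` goes to `g k`, which the drift multiplies by this coordinate. -/
theorem lieDeriv_tower_drift (hg : ∀ i, SmoothFieldOn I (g i) Set.univ) {k : Fin m} {s : ℕ}
    (hs : s < j k) {U : Set (M × Chains j)} (hU : IsOpen U) {h : M × Chains j → ℝ}
    (hh : ContMDiffOn (I.prod 𝓘(ℝ, Chains j)) 𝓘(ℝ, ℝ) ∞ h U) {q : M × Chains j} (hq : q ∈ U) :
    lieDeriv (I.prod 𝓘(ℝ, Chains j)) (tower g j k s)
        (lieDeriv (I.prod 𝓘(ℝ, Chains j)) ((driftless I g).prolong j).drift h) q =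
      lieDeriv (I.prod 𝓘(ℝ, Chains j)) ((driftless I g).prolong j).drift
        (lieDeriv (I.prod 𝓘(ℝ, Chains j)) (tower g j k s) h) q +
      lieDeriv (I.prod 𝓘(ℝ, Chains j)) (tower g j k (s + 1)) h q := by
  have h0 : tower g j k s = liftField I 0
      (fun c => if c.1 = k ∧ (c.2 : ℕ) + s + 1 = j c.1 then 1 else 0) := by
    unfold tower
    rw [if_neg (by omega)]
  rw [h0, lieDeriv_liftField_drift g hg smoothFieldOn_zero _ hU hh hq]
  have hsum : ∑ i, inputDeriv q.2 i 0 * lieDeriv (I.prod 𝓘(ℝ, Chains j))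
      (liftField I (VectorField.mlieBracket I 0 (g i)) (0 : Chains j)) h q = 0 := by
    refine Finset.sum_eq_zero fun i _ => ?_
    rw [VectorField.mlieBracket_zero_left, lieDeriv]
    have : liftField I (0 : (x : M) → TangentSpace I x) (0 : Chains j) q = 0 := rfl
    rw [this, map_zero, mul_zero]
  rw [hsum, add_zero]
  congr 2
  unfold tower
  congr 1
  · funext x
    have hterm : ∀ i, inputDeriv (j := j)
        (fun c => if c.1 = k ∧ (c.2 : ℕ) + s + 1 = j c.1 then 1 else 0) i 0 • g i x =
        if i = k then (if j k ≤ s + 1 then g k else 0) x else 0 := by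
      intro i
      unfold inputDeriv
      by_cases hik : i = k
      · subst hik
        by_cases hj : j i ≤ s + 1
        · have : s + 1 = j i := by omega
          simp [this]; omega
        · have : ¬ s + 1 = j i := by omega
          simp [hj, this]
      · simp [hik]
    rw [Finset.sum_congr rfl fun i _ => hterm i]
    simp
  · funext c
    unfold shiftChains inputDeriv
    by_cases hc : (c.2 : ℕ) + 1 < j c.1
    · rw [dif_pos hc]
      simp only
      congr 2
      rw [show (c.2 : ℕ) + 1 + s + 1 = c.2 + (s + 1) + 1 by ring]
    · rw [dif_neg hc, if_neg]
      rintro ⟨-, h2⟩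
      omega

/-- If the input fields annihilate the first `N` time derivatives of `y`, then so do their
brackets with the drift, with the corresponding loss. -/
theorem lieDeriv_tower_eq_zero (hg : ∀ i, SmoothFieldOn I (g i) Set.univ) {k : Fin m} {N : ℕ}
    {U : Set (M × Chains j)} (hU : IsOpen U) {y : M × Chains j → ℝ}
    (hy : ContMDiffOn (I.prod 𝓘(ℝ, Chains j)) 𝓘(ℝ, ℝ) ∞ y U)
    (hB : ∀ t < N, ∀ q ∈ U, lieDeriv (I.prod 𝓘(ℝ, Chains j)) (tower g j k 0)
      ((lieDeriv (I.prod 𝓘(ℝ, Chains j)) ((driftless I g).prolong j).drift)^[t] y) q = 0)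
    {s t : ℕ} (hs : s ≤ j k) (hst : s + t < N) {q : M × Chains j} (hq : q ∈ U) :
    lieDeriv (I.prod 𝓘(ℝ, Chains j)) (tower g j k s)
      ((lieDeriv (I.prod 𝓘(ℝ, Chains j)) ((driftless I g).prolong j).drift)^[t] y) q = 0 := by
  induction s generalizing t q with
  | zero => exact hB t (by omega) q hq
  | succ s ih =>
    -- The next field of the tower is a commutator with the drift: each step up the tower is paid
    -- for with one time derivative, and the other two terms vanish by the induction hypothesis.
    have h1 := lieDeriv_tower_drift g hg (show s < j k by omega) hU
      (contMDiffOn_iterate_lieDeriv_drift g hg hU hy t) hq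
    rw [← Function.iterate_succ_apply' (lieDeriv (I.prod 𝓘(ℝ, Chains j))
      ((driftless I g).prolong j).drift), ih (by omega) (by omega) hq,
      lieDeriv_eq_zero_of_eq_zero hU (fun q' hq' => ih (by omega) (by omega) hq') _ hq,
      zero_add] at h1
    exact h1.symm

/-- The tangent vectors of `M` that are annihilated, as horizontal vectors, by the differential
of `h`. -/
def horizontalKernel (h : M × Chains j → ℝ) (q : M × Chains j) :
    Submodule ℝ (TangentSpace I q.1) where
  carrier := {v | differential (I.prod 𝓘(ℝ, Chains j)) h q (tangentPair I q v 0) = 0}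
  add_mem' := by
    intro v w hv hw
    have h1 : tangentPair I q (v + w) (0 : Chains j) =
      tangentPair I q v (0 : Chains j) + tangentPair I q w 0 :=
        Prod.ext rfl (add_zero (0 : Chains j)).symm
    simp only [Set.mem_ofPred_eq] at hv hw ⊢
    rw [h1, map_add, hv, hw, add_zero]
  zero_mem' := map_zero (differential (I.prod 𝓘(ℝ, Chains j)) h q)
  smul_mem' := by
    intro c v hv
    have h1 : tangentPair I q (c • v) (0 : Chains j) = c • tangentPair I q v (0 : Chains j) :=
      Prod.ext rfl (smul_zero c : c • (0 : Chains j) = 0).symm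
    simp only [Set.mem_ofPred_eq] at hv ⊢
    rw [h1, map_smul, hv, smul_zero]

theorem mem_horizontalKernel {h : M × Chains j → ℝ} {q : M × Chains j} {v : TangentSpace I q.1} :
    v ∈ horizontalKernel (I := I) h q ↔
      differential (I.prod 𝓘(ℝ, Chains j)) h q (tangentPair I q v 0) = 0 := Iff.rfl

theorem exists_eq_tangentPair {q : M × Chains j}
    (v : TangentSpace (I.prod 𝓘(ℝ, Chains j)) q) :
    ∃ (u : TangentSpace I q.1) (w : Chains j), v = tangentPair I q u w :=
  ⟨(v : E × Chains j).1, (v : E × Chains j).2, rfl⟩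

/-- A differential is determined by the horizontal vectors and the coordinate vectors. -/
theorem differential_tangentPair (h : M × Chains j → ℝ) (q : M × Chains j)
    (v : TangentSpace I q.1) (w : Chains j) :
    differential (I.prod 𝓘(ℝ, Chains j)) h q (tangentPair I q v w) =
      differential (I.prod 𝓘(ℝ, Chains j)) h q (tangentPair I q v 0) +
      ∑ a, w a * lieDeriv (I.prod 𝓘(ℝ, Chains j)) (liftField I 0 (Pi.single a 1)) h q := by
  have := differential_tangentPair_sum (I := I) (h := h) (q := q) {()} (fun _ => (1 : ℝ))
    (fun _ => v) w
  simp only [Finset.sum_singleton, one_smul, one_mul] at this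
  exact this

theorem differential_eq_zero_of_horizontalKernel_eq_top {h : M × Chains j → ℝ} {q : M × Chains j}
    (hc : ∀ a, lieDeriv (I.prod 𝓘(ℝ, Chains j)) (liftField I 0 (Pi.single a 1)) h q = 0)
    (hk : horizontalKernel (I := I) h q = ⊤) : differential (I.prod 𝓘(ℝ, Chains j)) h q = 0 := by
  refine ContinuousLinearMap.ext fun v => ?_
  obtain ⟨u, w, rfl⟩ := exists_eq_tangentPair v
  have h1 := differential_tangentPair (I := I) h q u w
  have h2 : ∀ u : TangentSpace I q.1, u ∈ horizontalKernel (I := I) h q := fun u => by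
    rw [hk]; exact Submodule.mem_top
  rw [mem_horizontalKernel.1 (h2 _), zero_add] at h1
  simp only [hc, mul_zero, Finset.sum_const_zero] at h1
  exact h1

-- Both fields annihilate `h` on a whole open set, so the two iterated Lie derivatives vanish and
-- the commutator identity leaves only the bracket.
variable {g} in
theorem mlieBracket_mem_horizontalKernel {V W : (x : M) → TangentSpace I x}
    (hV : SmoothFieldOn I V Set.univ) (hW : SmoothFieldOn I W Set.univ)
    {U : Set (M × Chains j)} (hU : IsOpen U) {h : M × Chains j → ℝ}
    (hh : ContMDiffOn (I.prod 𝓘(ℝ, Chains j)) 𝓘(ℝ, ℝ) ∞ h U)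
    (hVh : ∀ q ∈ U, V q.1 ∈ horizontalKernel (I := I) h q)
    (hWh : ∀ q ∈ U, W q.1 ∈ horizontalKernel (I := I) h q) {q : M × Chains j} (hq : q ∈ U) :
    VectorField.mlieBracket I V W q.1 ∈ horizontalKernel (I := I) h q := by
  have h1 := lieDeriv_liftField_comm hV hW (0 : Chains j) (0 : Chains j) hU hh hq
  rw [lieDeriv_eq_zero_of_eq_zero
      (h := lieDeriv (I.prod 𝓘(ℝ, Chains j)) (liftField I W (0 : Chains j)) h) hU
      (fun q hq => hWh q hq) _ hq,
    lieDeriv_eq_zero_of_eq_zero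
      (h := lieDeriv (I.prod 𝓘(ℝ, Chains j)) (liftField I V (0 : Chains j)) h) hU
      (fun q hq => hVh q hq) _ hq, zero_add] at h1
  exact h1.symm

variable (l : Fin m)

theorem H12'_le_horizontalKernel (hg : ∀ i, SmoothFieldOn I (g i) Set.univ)
    {U : Set (M × Chains j)} (hU : IsOpen U) {h : M × Chains j → ℝ}
    (hh : ContMDiffOn (I.prod 𝓘(ℝ, Chains j)) 𝓘(ℝ, ℝ) ∞ h U)
    (hgh : ∀ k, ∀ q ∈ U, g k q.1 ∈ horizontalKernel (I := I) h q) {q : M × Chains j} (hq : q ∈ U) :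
    H12' I g l q.1 ≤ horizontalKernel (I := I) h q := by
  refine sup_le (sup_le (Submodule.span_le.2 ?_) (Submodule.span_le.2 ?_)) (Submodule.span_le.2 ?_)
  · rintro _ ⟨i, -, rfl⟩
    exact hgh i q hq
  · rintro _ ⟨i, -, rfl⟩
    exact mlieBracket_mem_horizontalKernel (hg l) (hg i) hU hh (hgh l) (hgh i) hq
  · rintro _ rfl
    exact hgh l q hq

theorem H23_le_horizontalKernel (hg : ∀ i, SmoothFieldOn I (g i) Set.univ)
    {U : Set (M × Chains j)} (hU : IsOpen U) {h : M × Chains j → ℝ}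
    (hh : ContMDiffOn (I.prod 𝓘(ℝ, Chains j)) 𝓘(ℝ, ℝ) ∞ h U)
    (hgh : ∀ k, ∀ q ∈ U, g k q.1 ∈ horizontalKernel (I := I) h q) {q : M × Chains j} (hq : q ∈ U) :
    H23 I g l q.1 ≤ horizontalKernel (I := I) h q := by
  refine sup_le (H12'_le_horizontalKernel g l hg hU hh hgh hq) (Submodule.span_le.2 ?_)
  rintro _ ⟨i, -, rfl⟩
  exact mlieBracket_mem_horizontalKernel (hg l) (smoothFieldOn_mlieBracket (hg l) (hg i)) hU hh
    (hgh l) (fun q hq => mlieBracket_mem_horizontalKernel (hg l) (hg i) hU hh (hgh l) (hgh i) hq) hq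

/-- If the input fields annihilate more time derivatives of `y` than any prolongation order, then
the differential of `y` vanishes, provided that it vanishes as soon as it annihilates all `g k`. -/
theorem differential_eq_zero_of_long_chain (hg : ∀ i, SmoothFieldOn I (g i) Set.univ) {N : ℕ}
    {U : Set (M × Chains j)} (hU : IsOpen U) {y : M × Chains j → ℝ}
    (hy : ContMDiffOn (I.prod 𝓘(ℝ, Chains j)) 𝓘(ℝ, ℝ) ∞ y U)
    (hB : ∀ k, ∀ t < N, ∀ q ∈ U, lieDeriv (I.prod 𝓘(ℝ, Chains j)) (tower g j k 0)
      ((lieDeriv (I.prod 𝓘(ℝ, Chains j)) ((driftless I g).prolong j).drift)^[t] y) q = 0)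
    (hN : ∀ k, j k < N) (hspan : (∀ x, H12' I g l x = ⊤) ∨ (∀ x, H23 I g l x = ⊤))
    {q : M × Chains j} (hq : q ∈ U) : differential (I.prod 𝓘(ℝ, Chains j)) y q = 0 := by
  have hgh : ∀ k, ∀ q ∈ U, g k q.1 ∈ horizontalKernel (I := I) y q := by
    intro k q hq
    have h1 := lieDeriv_tower_eq_zero g hg hU hy (hB k) (s := j k) (t := 0) le_rfl (hN k) hq
    rw [tower_top] at h1
    exact h1
  refine differential_eq_zero_of_horizontalKernel_eq_top (fun a => ?_) ?_
  · have h1 := lieDeriv_tower_eq_zero g hg hU hy (hB a.1) (s := j a.1 - 1 - a.2) (t := 0)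
      (by omega) (by have := hN a.1; omega) hq
    rw [tower_coord] at h1
    exact h1
  · rcases hspan with h | h
    · exact top_le_iff.1 (h q.1 ▸ H12'_le_horizontalKernel g l hg hU hy hgh hq)
    · exact top_le_iff.1 (h q.1 ▸ H23_le_horizontalKernel g l hg hU hy hgh hq)

end Tower

/-! ### Consequences of a Brunovský linearization -/

section Linearization

variable {E : Type*} [NormedAddCommGroup E] [NormedSpace ℝ E]
  {H : Type*} [TopologicalSpace H] {I : ModelWithCorners ℝ E H}
  {M : Type*} [TopologicalSpace M] [ChartedSpace H M] {m : ℕ}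
  {S : ControlAffineSystem I M m} {p : M}

namespace BrunovskyLinearization

variable (L : BrunovskyLinearization S p)

/-- The coordinate functions of the linearizing diffeomorphism. -/
def coord (c : (i : Fin m) × Fin (L.κ i)) (q : M) : ℝ := L.φ q c

/-- The last index of the `i`-th chain. -/
def last (i : Fin m) : (i : Fin m) × Fin (L.κ i) :=
  ⟨i, ⟨L.κ i - 1, Nat.sub_lt (L.κ_pos i) one_pos⟩⟩

theorem contMDiffOn_coord (c : (i : Fin m) × Fin (L.κ i)) :
    ContMDiffOn I 𝓘(ℝ, ℝ) ∞ (L.coord c) L.φ.source :=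
  (ContinuousLinearMap.proj (R := ℝ) (φ := fun _ : (i : Fin m) × Fin (L.κ i) => ℝ)
    c).contMDiff.comp_contMDiffOn L.smooth

theorem differential_coord (c : (i : Fin m) × Fin (L.κ i)) {q : M} (hq : q ∈ L.φ.source)
    (v : TangentSpace I q) :
    differential I (L.coord c) q v = (mfderiv I 𝓘(ℝ, Chains L.κ) L.φ q v : Chains L.κ) c := by
  have h1 : MDifferentiableAt I 𝓘(ℝ, Chains L.κ) L.φ q :=
    (L.smooth.contMDiffAt (L.φ.open_source.mem_nhds hq)).mdifferentiableAt (by simp)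
  have h2 := HasMFDerivAt.comp q
    (ContinuousLinearMap.proj (R := ℝ) (φ := fun _ : (i : Fin m) × Fin (L.κ i) => ℝ)
      c).hasMFDerivAt h1.hasMFDerivAt
  have h3 : mfderiv I 𝓘(ℝ, ℝ) (L.coord c) q = _ := h2.mfderiv
  rw [differential, h3]
  rfl

theorem differential_coord_conj (c : (i : Fin m) × Fin (L.κ i)) {q : M} (hq : q ∈ L.φ.source)
    (v : Fin m → ℝ) :
    differential I (L.coord c) q (S.drift q) +
      ∑ i, (L.a q i + (L.b q).mulVec v i) * differential I (L.coord c) q (S.input i q) =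
      brunovsky L.κ (L.φ q) v c := by
  rw [← L.conj q hq v, ← L.differential_coord c hq, map_add, map_sum]
  simp only [map_smul, smul_eq_mul]

theorem differential_coord_input_vecMul (c : (i : Fin m) × Fin (L.κ i)) {q : M}
    (hq : q ∈ L.φ.source) (v : Fin m → ℝ) :
    ∑ i, (L.b q).mulVec v i * differential I (L.coord c) q (S.input i q) =
      brunovsky L.κ (L.φ q) v c - brunovsky L.κ (L.φ q) 0 c := by
  have h1 := L.differential_coord_conj c hq v
  have h2 := L.differential_coord_conj c hq 0
  rw [← h1, ← h2]
  simp only [add_mul, Finset.sum_add_distrib, Matrix.mulVec_zero, Pi.zero_apply, zero_mul,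
    Finset.sum_const_zero]
  ring

theorem exists_mulVec_eq {q : M} (hq : q ∈ L.φ.source) (u : Fin m → ℝ) :
    ∃ v, (L.b q).mulVec v = u :=
  ⟨(L.b q)⁻¹.mulVec u, by
    rw [Matrix.mulVec_mulVec, Matrix.mul_nonsing_inv _
      ((Matrix.isUnit_iff_isUnit_det _).1 (L.regular q hq)), Matrix.one_mulVec]⟩

/-- Before the end of a chain the right-hand side of the Brunovský system does not involve `v`;
since the feedback matrix is invertible, every single input field arises from a suitable `v`. -/
theorem differential_coord_input_eq_zero (c : (i : Fin m) × Fin (L.κ i))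
    (hc : (c.2 : ℕ) + 1 < L.κ c.1) {q : M} (hq : q ∈ L.φ.source) (k : Fin m) :
    differential I (L.coord c) q (S.input k q) = 0 := by
  obtain ⟨v, hv⟩ := L.exists_mulVec_eq hq (Pi.single k 1)
  have h := L.differential_coord_input_vecMul c hq v
  simp only [brunovsky, dif_pos hc, sub_self, hv] at h
  simpa [Pi.single_apply] using h

theorem differential_coord_drift (c : (i : Fin m) × Fin (L.κ i))
    (hc : (c.2 : ℕ) + 1 < L.κ c.1) {q : M} (hq : q ∈ L.φ.source) :
    differential I (L.coord c) q (S.drift q) = L.coord ⟨c.1, ⟨(c.2 : ℕ) + 1, hc⟩⟩ q := by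
  have h := L.differential_coord_conj c hq 0
  simp only [L.differential_coord_input_eq_zero c hc hq, mul_zero, Finset.sum_const_zero,
    add_zero, brunovsky, dif_pos hc] at h
  exact h

/-- The matrix of the input fields applied to the ends of the chains is invertible. -/
theorem vecMul_differential_last_injective {q : M} (hq : q ∈ L.φ.source) (c : Fin m → ℝ)
    (hc : ∀ k, ∑ i, c i * differential I (L.coord (L.last i)) q (S.input k q) = 0) : c = 0 := by
  funext i₀
  have h := fun i => L.differential_coord_input_vecMul (L.last i) hq (Pi.single i₀ 1)
  have hnot : ∀ i, ¬ (((L.last i).2 : ℕ) + 1 < L.κ (L.last i).1) := fun i => by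
    have := L.κ_pos i
    simp only [last]
    omega
  simp only [brunovsky, dif_neg (hnot _), Pi.zero_apply, sub_zero] at h
  have h2 : ∑ i, c i * (Pi.single i₀ (1 : ℝ) : Fin m → ℝ) i = 0 := by
    calc ∑ i, c i * (Pi.single i₀ (1 : ℝ) : Fin m → ℝ) i
        = ∑ i, c i * ∑ k, (L.b q).mulVec (Pi.single i₀ 1) k *
            differential I (L.coord (L.last i)) q (S.input k q) :=
          Finset.sum_congr rfl fun i _ => by rw [h i]; rfl
      _ = ∑ k, (L.b q).mulVec (Pi.single i₀ 1) k *
            ∑ i, c i * differential I (L.coord (L.last i)) q (S.input k q) := by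
          simp only [Finset.mul_sum]
          rw [Finset.sum_comm]
          exact Finset.sum_congr rfl fun _ _ => Finset.sum_congr rfl fun _ _ => by ring
      _ = 0 := by simp [hc]
  simpa [Pi.single_apply] using h2

theorem mdifferentiable_φ : L.φ.MDifferentiable I 𝓘(ℝ, Chains L.κ) :=
  ⟨L.smooth.mdifferentiableOn (by simp), L.smooth_symm.mdifferentiableOn (by simp)⟩

theorem linearIndependent_differential_coord {q : M} (hq : q ∈ L.φ.source) :
    LinearIndependent ℝ fun c => differential I (L.coord c) q := by
  rw [Fintype.linearIndependent_iff]
  intro c hc a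
  obtain ⟨v, hv⟩ := L.mdifferentiable_φ.mfderiv_surjective hq (Pi.single a (1 : ℝ) : Chains L.κ)
  have h1 := congrArg (fun A : TangentSpace I q →L[ℝ] ℝ => A v) hc
  simp only [sum_apply, smul_apply, L.differential_coord _ hq, smul_eq_mul] at h1
  have h2 : ∀ b, (mfderiv I 𝓘(ℝ, Chains L.κ) L.φ q v : Chains L.κ) b =
      (Pi.single a (1 : ℝ) : Chains L.κ) b := fun b => congrFun hv b
  simp only [h2] at h1
  simpa [Pi.single_apply] using h1

theorem sum_κ : ∑ i, L.κ i = Module.finrank ℝ E := by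
  have h := LinearEquiv.finrank_eq (L.mdifferentiable_φ.mfderiv L.mem_source).toLinearEquiv
  have h1 : Module.finrank ℝ (Chains L.κ) = ∑ i, L.κ i := by
    simp [Chains]
  rw [← h1]
  exact h.symm

/-- The time derivatives of the flat outputs are the coordinates. -/
theorem iterate_lieDeriv_output (i : Fin m) {t : ℕ} (ht : t < L.κ i) {q : M}
    (hq : q ∈ L.φ.source) :
    (lieDeriv I S.drift)^[t] (L.output i) q = L.coord ⟨i, ⟨t, ht⟩⟩ q := by
  induction t generalizing q with
  | zero => rfl
  | succ t ih =>
    rw [Function.iterate_succ_apply', lieDeriv_congr L.φ.open_source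
      (fun q hq => ih (by omega) hq) _ hq]
    exact L.differential_coord_drift ⟨i, ⟨t, by omega⟩⟩ ht hq

theorem lieDeriv_input_iterate_output (i : Fin m) {t : ℕ} (ht : t + 1 < L.κ i) {q : M}
    (hq : q ∈ L.φ.source) (k : Fin m) :
    lieDeriv I (S.input k) ((lieDeriv I S.drift)^[t] (L.output i)) q = 0 := by
  rw [lieDeriv_congr L.φ.open_source (fun q hq => L.iterate_lieDeriv_output i
    (Nat.lt_of_succ_lt ht) hq) _ hq]
  exact L.differential_coord_input_eq_zero ⟨i, ⟨t, _⟩⟩ ht hq k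

end BrunovskyLinearization

end Linearization

/-! ### Construction of a Brunovský linearization -/

section Construction

theorem eq_zero_of_forall_apply_eq_zero {E ι : Type*} [NormedAddCommGroup E] [NormedSpace ℝ E]
    [FiniteDimensional ℝ E] [Fintype ι] {η : ι → E →L[ℝ] ℝ} (hη : LinearIndependent ℝ η)
    (hcard : Fintype.card ι = Module.finrank ℝ E) {v : E} (hv : ∀ i, η i v = 0) : v = 0 := by
  have hfr : Module.finrank ℝ (E →L[ℝ] ℝ) = Module.finrank ℝ E := by
    rw [← LinearEquiv.finrank_eq (LinearMap.toContinuousLinearMap (𝕜 := ℝ) (E := E) (F' := ℝ))]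
    exact Subspace.dual_finrank_eq
  have hspan := hη.span_eq_top_of_card_eq_finrank' (hcard.trans hfr.symm)
  have hall : ∀ f : E →L[ℝ] ℝ, f v = 0 := by
    intro f
    have hf : f ∈ Submodule.span ℝ (Set.range η) := hspan ▸ Submodule.mem_top
    induction hf using Submodule.span_induction with
    | mem x hx => obtain ⟨i, rfl⟩ := hx; exact hv i
    | zero => rfl
    | add x y _ _ hx hy => simp [hx, hy]
    | smul c x _ hx => simp [hx]
  refine (Module.forall_dual_apply_eq_zero_iff ℝ v).1 fun f => ?_
  exact hall (LinearMap.toContinuousLinearMap f)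

variable {E : Type*} [NormedAddCommGroup E] [NormedSpace ℝ E]
  {H : Type*} [TopologicalSpace H] {I : ModelWithCorners ℝ E H}
  {M : Type*} [TopologicalSpace M] [ChartedSpace H M] {m : ℕ}

theorem contMDiffOn_finset_prod_real {ι : Type*} (s : Finset ι) {f : ι → M → ℝ} {U : Set M}
    (hf : ∀ i ∈ s, ContMDiffOn I 𝓘(ℝ, ℝ) ∞ (f i) U) :
    ContMDiffOn I 𝓘(ℝ, ℝ) ∞ (fun z => ∏ i ∈ s, f i z) U := by
  classical
  induction s using Finset.induction_on with
  | empty => simpa using contMDiffOn_const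
  | insert a s ha ih =>
    simp only [Finset.prod_insert ha]
    exact contMDiffOn_mul (hf a (Finset.mem_insert_self a s))
      (ih fun i hi => hf i (Finset.mem_insert_of_mem hi))

theorem contMDiffOn_det {A : M → Matrix (Fin m) (Fin m) ℝ} {U : Set M}
    (hA : ∀ i k, ContMDiffOn I 𝓘(ℝ, ℝ) ∞ (fun q => A q i k) U) :
    ContMDiffOn I 𝓘(ℝ, ℝ) ∞ (fun q => (A q).det) U := by
  simp only [Matrix.det_apply']
  exact contMDiffOn_finset_sum _ fun σ _ => contMDiffOn_mul contMDiffOn_const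
    (contMDiffOn_finset_prod_real _ fun i _ => hA _ _)

/-- By Cramer's rule the entries of the inverse are quotients of determinants, hence of polynomials
in the entries. -/
theorem contMDiffOn_matrix_inv {A : M → Matrix (Fin m) (Fin m) ℝ} {U : Set M}
    (hA : ∀ i k, ContMDiffOn I 𝓘(ℝ, ℝ) ∞ (fun q => A q i k) U)
    (hdet : ∀ q ∈ U, (A q).det ≠ 0) (i k : Fin m) :
    ContMDiffOn I 𝓘(ℝ, ℝ) ∞ (fun q => (A q)⁻¹ i k) U := by
  have h1 : ∀ q, (A q)⁻¹ i k = (A q).det⁻¹ * ((A q).updateRow k (Pi.single i 1)).det := by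
    intro q
    rw [Matrix.inv_def, Ring.inverse_eq_inv', Matrix.smul_apply, Matrix.adjugate_apply, smul_eq_mul]
  simp only [h1]
  refine contMDiffOn_mul (fun q hq => ?_) (contMDiffOn_det fun a b => ?_)
  · exact (contDiffAt_inv ℝ (hdet q hq)).contMDiffAt.comp_contMDiffWithinAt q
      (contMDiffOn_det hA q hq)
  · simp only [Matrix.updateRow_apply]
    split_ifs
    · exact contMDiffOn_const
    · exact hA a b

variable [FiniteDimensional ℝ E] [I.Boundaryless]

variable (I) in
/-- The chart at a point, as a partial homeomorphism with values in the model vector space. -/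
def extChartHomeomorph (x : M) : OpenPartialHomeomorph M E where
  toPartialEquiv := extChartAt I x
  open_source := isOpen_extChartAt_source x
  open_target := isOpen_extChartAt_target x
  continuousOn_toFun := continuousOn_extChartAt x
  continuousOn_invFun := continuousOn_extChartAt_symm x

variable [IsManifold I ∞ M]

/-- Inverse function theorem on a manifold. -/
theorem exists_openPartialHomeomorph_of_contMDiffOn {F : Type*} [NormedAddCommGroup F]
    [NormedSpace ℝ F] [FiniteDimensional ℝ F] {f : M → F} {U : Set M} (hU : IsOpen U)
    (hf : ContMDiffOn I 𝓘(ℝ, F) ∞ f U) {p : M} (hp : p ∈ U)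
    (hinj : ∀ v : TangentSpace I p, mfderiv I 𝓘(ℝ, F) f p v = 0 → v = 0)
    (hdim : Module.finrank ℝ E = Module.finrank ℝ F) :
    ∃ φ : OpenPartialHomeomorph M F, p ∈ φ.source ∧ φ.source ⊆ U ∧ (∀ q ∈ φ.source, φ q = f q) ∧
      ContMDiffOn 𝓘(ℝ, F) I ∞ φ.symm φ.target := by
  set e := extChartHomeomorph I p with he
  set O : Set E := e.target ∩ e.symm ⁻¹' U with hO
  have hesymm : ContMDiffOn 𝓘(ℝ, E) I ∞ e.symm e.target := contMDiffOn_extChartAt_symm p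
  have hOo : IsOpen O := e.continuousOn_symm.isOpen_inter_preimage e.open_target hU
  have hfs : ContDiffOn ℝ ∞ (f ∘ e.symm) O :=
    contMDiffOn_iff_contDiffOn.1 (hf.comp (hesymm.mono Set.inter_subset_left) fun _ hz => hz.2)
  have hpe : p ∈ e.source := mem_extChartAt_source p
  have hep : e.symm (e p) = p := e.left_inv hpe
  have hepO : e p ∈ O := ⟨e.map_source hpe, by show e.symm (e p) ∈ U; rw [hep]; exact hp⟩
  set f' : E →L[ℝ] F := fderiv ℝ (f ∘ e.symm) (e p) with hf'
  have hf'd : HasFDerivAt (f ∘ e.symm) f' (e p) :=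
    ((hfs.contDiffAt (hOo.mem_nhds hepO)).differentiableAt (by simp)).hasFDerivAt
  have hinj' : Function.Injective f' := by
    refine (injective_iff_map_eq_zero f').2 fun v hv => ?_
    have h1 : HasMFDerivAt 𝓘(ℝ, E) I e.symm (e p) (mfderiv 𝓘(ℝ, E) I e.symm (e p)) :=
      ((hesymm.contMDiffAt (e.open_target.mem_nhds hepO.1)).mdifferentiableAt
        (by simp)).hasMFDerivAt
    have h2 : HasMFDerivAt I 𝓘(ℝ, F) f (e.symm (e p)) (mfderiv I 𝓘(ℝ, F) f (e.symm (e p))) := by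
      refine MDifferentiableAt.hasMFDerivAt ?_
      rw [hep]
      exact (hf.contMDiffAt (hU.mem_nhds hp)).mdifferentiableAt (by simp)
    have h3 := (HasMFDerivAt.comp (e p) h2 h1)
    have h4 : HasFDerivAt (f ∘ e.symm) (_ : E →L[ℝ] F) (e p) := hasMFDerivAt_iff_hasFDerivAt.1 h3
    rw [h4.unique hf'd |>.symm] at hv
    have hinj2 : ∀ v : TangentSpace I (e.symm (e p)),
        mfderiv I 𝓘(ℝ, F) f (e.symm (e p)) v = 0 → v = 0 := by rw [hep]; exact hinj
    have h5 := hinj2 _ hv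
    have hA : (mfderiv 𝓘(ℝ, E) I e.symm (e p)).IsInvertible :=
      isInvertible_mfderiv_extChartAt_symm (I := I) p hepO.1
    obtain ⟨A, hA⟩ := hA
    have h6 : A v = 0 := by
      rw [← h5, ← hA]
      rfl
    exact (map_eq_zero_iff A A.injective).1 h6
  set L : E ≃L[ℝ] F :=
    (LinearEquiv.ofInjectiveOfFinrankEq (f' : E →ₗ[ℝ] F) hinj' hdim).toContinuousLinearEquiv
  have hL : HasFDerivAt (f ∘ e.symm) (L : E →L[ℝ] F) (e p) := hf'd
  obtain ⟨e₁, h1, h2, h3, h4⟩ := exists_openPartialHomeomorph_of_contDiffOn hOo hfs hepO L hL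
  refine ⟨e.trans e₁, ?_, ?_, ?_, ?_⟩
  · rw [e.trans_source]; exact ⟨hpe, h1⟩
  · rw [e.trans_source]
    rintro q ⟨hq1, hq2⟩
    have := (h2 hq2).2
    rwa [Set.mem_preimage, e.left_inv hq1] at this
  · intro q hq
    rw [e.trans_source] at hq
    show e₁ (e q) = f q
    rw [h3, Function.comp_apply, e.left_inv hq.1]
  · have : ContMDiffOn 𝓘(ℝ, F) I ∞ (e.symm ∘ e₁.symm) (e.trans e₁).target := by
      refine hesymm.comp (h4.contMDiffOn.mono ?_) ?_
      · rw [e.trans_target]; exact Set.inter_subset_left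
      · intro z hz
        rw [e.trans_target] at hz
        exact hz.2
    exact this

end Construction

section Construction

variable {E : Type*} [NormedAddCommGroup E] [NormedSpace ℝ E]
  {H : Type*} [TopologicalSpace H] {I : ModelWithCorners ℝ E H}
  {M : Type*} [TopologicalSpace M] [ChartedSpace H M] {m : ℕ}
  {S : ControlAffineSystem I M m}

/-- The matrix of the input fields applied to the `κ i - 1`-st time derivatives of `y i`. -/
def decoupling (S : ControlAffineSystem I M m) (κ : Fin m → ℕ) (y : Fin m → M → ℝ) (q : M) :
    Matrix (Fin m) (Fin m) ℝ :=
  fun i k => lieDeriv I (S.input k) ((lieDeriv I S.drift)^[κ i - 1] (y i)) q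

variable {κ : Fin m → ℕ} {y : Fin m → M → ℝ} {U : Set M} {p : M}

theorem sum_smul_differential_input
    (hB : ∀ i k t, t + 1 < κ i → ∀ q ∈ U,
      lieDeriv I (S.input k) ((lieDeriv I S.drift)^[t] (y i)) q = 0) {q : M} (hq : q ∈ U)
    (c : (i : Fin m) × Fin (κ i)) (v : Fin m → ℝ) :
    differential I ((lieDeriv I S.drift)^[c.2] (y c.1)) q (∑ k, v k • S.input k q) =
      if (c.2 : ℕ) + 1 < κ c.1 then 0 else (decoupling S κ y q).mulVec v c.1 := by
  rw [map_sum]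
  split_ifs with h
  · refine Finset.sum_eq_zero fun k _ => ?_
    rw [map_smul]
    have h1 : differential I ((lieDeriv I S.drift)^[c.2] (y c.1)) q (S.input k q) = 0 :=
      hB c.1 k c.2 h q hq
    rw [h1, smul_zero]
  · have h2 : (c.2 : ℕ) = κ c.1 - 1 := by have := c.2.2; omega
    rw [h2]
    simp only [map_smul, Matrix.mulVec, dotProduct, decoupling, smul_eq_mul]
    exact Finset.sum_congr rfl fun k _ => mul_comm _ _

/-- Evaluate a linear relation on the input fields: only the last member of each chain sees them, so
the coefficients of the last members form a row vector annihilated by the decoupling matrix. These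
vanish, and the rest of the relation involves only lower derivatives. -/
theorem linearIndependent_of_det_decoupling_ne_zero
    (hκ : ∀ i, 0 < κ i)
    (hB : ∀ i k t, t + 1 < κ i → ∀ q ∈ U,
      lieDeriv I (S.input k) ((lieDeriv I S.drift)^[t] (y i)) q = 0) (hp : p ∈ U)
    (hdet : (decoupling S κ y p).det ≠ 0)
    (hlow : LinearIndependent ℝ fun c : {c : (i : Fin m) × Fin (κ i) // (c.2 : ℕ) + 1 < κ c.1} =>
      differential I ((lieDeriv I S.drift)^[c.1.2] (y c.1.1)) p) :
    LinearIndependent ℝ fun c : (i : Fin m) × Fin (κ i) =>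
      differential I ((lieDeriv I S.drift)^[c.2] (y c.1)) p := by
  rw [Fintype.linearIndependent_iff]
  intro β hβ
  set w : Fin m → ℝ := fun i => β ⟨i, ⟨κ i - 1, Nat.sub_lt (hκ i) one_pos⟩⟩ with hw
  have hw0 : w = 0 := by
    refine Matrix.eq_zero_of_vecMul_eq_zero hdet (funext fun k => ?_)
    have h1 := congrArg (fun A : TangentSpace I p →L[ℝ] ℝ =>
      A (∑ a, (Pi.single k (1 : ℝ) : Fin m → ℝ) a • S.input a p)) hβ
    simp only [sum_apply, smul_apply, smul_eq_mul] at h1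
    rw [Finset.sum_congr rfl fun c _ => by rw [sum_smul_differential_input hB hp c]] at h1
    rw [Fintype.sum_sigma] at h1
    refine Eq.trans ?_ h1
    simp only [Matrix.vecMul, dotProduct]
    refine Finset.sum_congr rfl fun i _ => ?_
    rw [Finset.sum_eq_single ⟨κ i - 1, Nat.sub_lt (hκ i) one_pos⟩]
    · have : ¬ (κ i - 1 + 1 < κ i) := by omega
      simp [this, hw]
    · intro b _ hb
      have : (b : ℕ) + 1 < κ i := by
        have h2 := b.2
        have h3 : (b : ℕ) ≠ κ i - 1 := fun h => hb (Fin.ext h)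
        omega
      simp [this]
    · simp
  have hlast : ∀ c : (i : Fin m) × Fin (κ i), ¬ ((c.2 : ℕ) + 1 < κ c.1) → β c = 0 := by
    intro c hc
    have := congrFun hw0 c.1
    rw [hw] at this
    simp only [Pi.zero_apply] at this
    rw [← this]
    congr 1
    obtain ⟨i, t⟩ := c
    congr 1
    exact Fin.ext (by have := t.2; simp only at hc ⊢; omega)
  rw [← Fintype.sum_subtype_add_sum_subtype
    (fun c : (i : Fin m) × Fin (κ i) => (c.2 : ℕ) + 1 < κ c.1),
    Fintype.sum_eq_zero (fun c : {c : (i : Fin m) × Fin (κ i) // ¬ ((c.2 : ℕ) + 1 < κ c.1)} =>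
      β c • differential I ((lieDeriv I S.drift)^[c.1.2] (y c.1.1)) p)
      (fun c => by rw [hlast c.1 c.2, zero_smul]), add_zero] at hβ
  intro c
  by_cases hc : (c.2 : ℕ) + 1 < κ c.1
  · exact Fintype.linearIndependent_iff.1 hlow (fun c => β c.1) hβ ⟨c, hc⟩
  · exact hlast c hc

variable [FiniteDimensional ℝ E] [I.Boundaryless] [IsManifold I ∞ M]

/-- Functions with the right chains of time derivatives are the outputs of a linearization. -/
theorem exists_brunovskyLinearization (hκ : ∀ i, 0 < κ i) (hU : IsOpen U) (hp : p ∈ U)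
    (hy : ∀ i t, ContMDiffOn I 𝓘(ℝ, ℝ) ∞ ((lieDeriv I S.drift)^[t] (y i)) U)
    (hyB : ∀ i k t, ContMDiffOn I 𝓘(ℝ, ℝ) ∞
      (lieDeriv I (S.input k) ((lieDeriv I S.drift)^[t] (y i))) U)
    (hB : ∀ i k t, t + 1 < κ i → ∀ q ∈ U,
      lieDeriv I (S.input k) ((lieDeriv I S.drift)^[t] (y i)) q = 0)
    (hdim : ∑ i, κ i = Module.finrank ℝ E)
    (hdet : (decoupling S κ y p).det ≠ 0)
    (hlow : LinearIndependent ℝ fun c : {c : (i : Fin m) × Fin (κ i) // (c.2 : ℕ) + 1 < κ c.1} =>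
      differential I ((lieDeriv I S.drift)^[c.1.2] (y c.1.1)) p) :
    ∃ L : BrunovskyLinearization S p, ∀ i, ∀ q ∈ L.φ.source, y i q = L.output i q := by
  have hli := linearIndependent_of_det_decoupling_ne_zero hκ hB hp hdet hlow
  set f : M → Chains κ := fun q c => (lieDeriv I S.drift)^[c.2] (y c.1) q with hf
  have hfs : ContMDiffOn I 𝓘(ℝ, Chains κ) ∞ f U :=
    contMDiffOn_pi_space.2 fun c => hy c.1 c.2
  have hfd : ∀ q ∈ U, ∀ v : TangentSpace I q, ∀ c,
      (mfderiv I 𝓘(ℝ, Chains κ) f q v : Chains κ) c =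
        differential I ((lieDeriv I S.drift)^[c.2] (y c.1)) q v := by
    intro q hq v c
    have h1 : MDifferentiableAt I 𝓘(ℝ, Chains κ) f q :=
      (hfs.contMDiffAt (hU.mem_nhds hq)).mdifferentiableAt (by simp)
    have h2 := HasMFDerivAt.comp q
      (ContinuousLinearMap.proj (R := ℝ) (φ := fun _ : (i : Fin m) × Fin (κ i) => ℝ)
        c).hasMFDerivAt h1.hasMFDerivAt
    have h3 : mfderiv I 𝓘(ℝ, ℝ) ((lieDeriv I S.drift)^[c.2] (y c.1)) q = _ := h2.mfderiv
    rw [differential, h3]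
    rfl
  have hA : ∀ i k, ContMDiffOn I 𝓘(ℝ, ℝ) ∞ (fun q => decoupling S κ y q i k) U :=
    fun i k => hyB i k _
  obtain ⟨φ, hφp, hφU, hφf, hφs⟩ := exists_openPartialHomeomorph_of_contMDiffOn hU hfs hp
    (fun v hv => by
      refine eq_zero_of_forall_apply_eq_zero (E := E)
        (η := fun c : (i : Fin m) × Fin (κ i) =>
          (differential I ((lieDeriv I S.drift)^[c.2] (y c.1)) p : E →L[ℝ] ℝ)) hli ?_ fun c => ?_
      · simp [hdim]
      · refine (hfd p hp v c).symm.trans ?_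
        rw [hv]
        rfl)
    (by simp [Chains, hdim])
  set W : Set M := φ.source ∩ (fun q => (decoupling S κ y q).det) ⁻¹' {0}ᶜ with hW
  have hdets : ContMDiffOn I 𝓘(ℝ, ℝ) ∞ (fun q => (decoupling S κ y q).det) U := contMDiffOn_det hA
  have hWo : IsOpen W := (hdets.continuousOn.mono hφU).isOpen_inter_preimage φ.open_source
    isOpen_compl_singleton
  have hWs : (φ.restrOpen W hWo).source = W := by
    rw [φ.restrOpen_source]
    exact Set.inter_eq_right.2 Set.inter_subset_left
  have hWU : W ⊆ U := fun q hq => hφU hq.1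
  have hfeq : ∀ q ∈ W, φ =ᶠ[𝓝 q] f := fun q hq =>
    Filter.eventually_of_mem (φ.open_source.mem_nhds hq.1) hφf
  have hb : ∀ i k, ContMDiffOn I 𝓘(ℝ, ℝ) ∞ (fun q => (decoupling S κ y q)⁻¹ i k) W :=
    contMDiffOn_matrix_inv (fun i k => (hA i k).mono hWU) fun q hq => hq.2
  let L : BrunovskyLinearization S p :=
    { κ := κ
      κ_pos := hκ
      φ := φ.restrOpen W hWo
      mem_source := by rw [hWs]; exact ⟨hφp, hdet⟩
      smooth := by
        rw [hWs]
        exact (hfs.mono hWU).congr fun q hq => hφf q hq.1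
      smooth_symm := by
        refine hφs.mono ?_
        rw [φ.restrOpen_toPartialEquiv, PartialEquiv.restr_target]
        exact Set.inter_subset_left
      -- The feedback solves `L_F^(κ i) y_i + (A u)_i = v_i` for `u`, where `A` is the decoupling
      -- matrix.
      a := fun q => -((decoupling S κ y q)⁻¹.mulVec
        fun i => (lieDeriv I S.drift)^[κ i] (y i) q)
      b := fun q => (decoupling S κ y q)⁻¹
      smooth_a := by
        intro i
        rw [hWs]
        simp only [Pi.neg_apply, Matrix.mulVec, dotProduct, ← neg_one_mul (Finset.sum _ _)]
        exact contMDiffOn_mul contMDiffOn_const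
          (contMDiffOn_finset_sum _ fun k _ => contMDiffOn_mul (hb i k) ((hy k _).mono hWU))
      smooth_b := by rw [hWs]; exact hb
      regular := by
        rw [hWs]
        intro q hq
        exact Matrix.isUnit_nonsing_inv_iff.2
          ((Matrix.isUnit_iff_isUnit_det _).2 (isUnit_iff_ne_zero.2 hq.2))
      conj := by
        rw [hWs]
        intro q hq v
        have hunit : IsUnit (decoupling S κ y q).det := isUnit_iff_ne_zero.2 hq.2
        show mfderiv I 𝓘(ℝ, Chains κ) φ q _ = brunovsky κ (φ q) v
        rw [(hfeq q hq).mfderiv_eq, hφf q hq.1]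
        refine funext fun c => (hfd q (hWU hq) _ c).trans ?_
        set u : Fin m → ℝ := -((decoupling S κ y q)⁻¹.mulVec
            fun i => (lieDeriv I S.drift)^[κ i] (y i) q) + (decoupling S κ y q)⁻¹.mulVec v with hu
        have hAu : (decoupling S κ y q).mulVec u =
            v - fun i => (lieDeriv I S.drift)^[κ i] (y i) q := by
          rw [hu, Matrix.mulVec_add, Matrix.mulVec_neg, Matrix.mulVec_mulVec, Matrix.mulVec_mulVec,
            Matrix.mul_nonsing_inv _ hunit, Matrix.one_mulVec, Matrix.one_mulVec]
          abel
        have h1 := sum_smul_differential_input hB (hWU hq) c u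
        rw [map_add]
        refine (congrArg _ h1).trans ?_
        have h2 : differential I ((lieDeriv I S.drift)^[c.2] (y c.1)) q (S.drift q) =
            (lieDeriv I S.drift)^[(c.2 : ℕ) + 1] (y c.1) q := by
          rw [Function.iterate_succ_apply']
          rfl
        rw [h2]
        unfold brunovsky
        split_ifs with h
        · rw [add_zero]
        · have h3 : (c.2 : ℕ) + 1 = κ c.1 := by have := c.2.2; omega
          rw [hAu, h3, Pi.sub_apply, add_sub_cancel] }
  refine ⟨L, fun i q hq => ?_⟩
  have hq' : q ∈ W := hWs ▸ hq
  have : L.φ q = f q := hφf q hq'.1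
  rw [BrunovskyLinearization.output, this]
  rfl

end Construction

/-! ### The Frobenius theorem on a manifold -/

section Frobenius

theorem map_mem_span_range {E E' ι : Type*} [AddCommGroup E] [Module ℝ E] [AddCommGroup E']
    [Module ℝ E'] (A : E →ₗ[ℝ] E') {v : E} {V : ι → E} {W : ι → E'}
    (hv : v ∈ Submodule.span ℝ (Set.range V)) (hA : ∀ i, A (V i) = W i) :
    A v ∈ Submodule.span ℝ (Set.range W) := by
  have h := Submodule.mem_map_of_mem (f := A) hv
  rwa [Submodule.map_span, ← Set.range_comp, show A ∘ V = W from funext hA] at h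

set_option linter.unusedSectionVars false

variable {E : Type} [NormedAddCommGroup E] [NormedSpace ℝ E] [FiniteDimensional ℝ E]
  {H : Type*} [TopologicalSpace H] {I : ModelWithCorners ℝ E H} [I.Boundaryless]
  {M : Type*} [TopologicalSpace M] [ChartedSpace H M] [IsManifold I ∞ M] [IsManifold I 1 M]
  {m : ℕ} {j : Fin m → ℕ}

/-- The Frobenius theorem on a manifold: first integrals of an involutive family of fields. -/
theorem exists_firstIntegrals_manifold {ι : Type} [Fintype ι] (V : ι → (x : M) → TangentSpace I x)
    (hV : ∀ i, SmoothFieldOn I (V i) Set.univ) (x₀ : M)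
    (hli : LinearIndependent ℝ fun i => V i x₀)
    (hbr : ∀ x i k, VectorField.mlieBracket I (V i) (V k) x ∈
      Submodule.span ℝ (Set.range fun i => V i x)) :
    ∃ (f : Fin (Module.finrank ℝ E - Fintype.card ι) → M → ℝ) (U : Set M), IsOpen U ∧ x₀ ∈ U ∧
      (∀ k, ContMDiffOn I 𝓘(ℝ, ℝ) ∞ (f k) U) ∧
      (∀ x ∈ U, ∀ i k, differential I (f k) x (V i x) = 0) ∧
      LinearIndependent ℝ fun k => differential I (f k) x₀ := by
  classical
  have hx₀ : x₀ ∈ (extChartAt I x₀).source := mem_extChartAt_source x₀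
  have hex : extChartAt I x₀ x₀ ∈ (extChartAt I x₀).target := mem_extChartAt_target x₀
  have hA : ∀ x ∈ (extChartAt I x₀).source, ∃ A : E ≃L[ℝ] E, ∀ V : (x : M) → TangentSpace I x,
      A (chartField I x₀ V (extChartAt I x₀ x)) = V x := by
    intro x hx
    obtain ⟨A, hA⟩ := isInvertible_mfderiv_extChartAt_symm (I := I) x₀
      ((extChartAt I x₀).map_source hx)
    refine ⟨A, fun V => ?_⟩
    have h1 := mfderiv_chart_symm_chartField x₀ V ((extChartAt I x₀).map_source hx)
    rw [← hA] at h1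
    refine h1.trans ?_
    rw [(extChartAt I x₀).left_inv hx]
  obtain ⟨f, U', hU', hxU', hf, hfV, hfl⟩ := exists_firstIntegrals
    (fun i => chartField I x₀ (V i)) (isOpen_extChartAt_target x₀) hex
    (fun i => contDiffOn_chartField x₀ (hV i)) (by
      obtain ⟨A, hA⟩ := hA x₀ hx₀
      refine LinearIndependent.of_comp (A : E →ₗ[ℝ] E) ?_
      have : ((A : E →ₗ[ℝ] E) ∘ fun i => chartField I x₀ (V i) (extChartAt I x₀ x₀)) =
        fun i => V i x₀ := funext fun i => hA (V i)
      rw [this]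
      exact hli) (by
      intro ξ hξ i k
      rw [lieBracket_chartField x₀ (hV i) (hV k) hξ]
      have hx := (extChartAt I x₀).map_target hξ
      obtain ⟨A, hA⟩ := hA _ hx
      rw [(extChartAt I x₀).right_inv hξ] at hA
      have h1 := hbr ((extChartAt I x₀).symm ξ) i k
      have h3 : ∀ W : (x : M) → TangentSpace I x, A.symm (W ((extChartAt I x₀).symm ξ)) =
        chartField I x₀ W ξ := fun W => by rw [← hA W]; exact A.symm_apply_apply _
      have h4 := map_mem_span_range (E := E) (A.symm : E →ₗ[ℝ] E) h1 fun i => h3 (V i)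
      have h5 : (A.symm : E →ₗ[ℝ] E) (VectorField.mlieBracket I (V i) (V k)
        ((extChartAt I x₀).symm ξ)) = _ := h3 (VectorField.mlieBracket I (V i) (V k))
      rw [h5] at h4
      exact h4)
  have hchart : ContMDiffOn I 𝓘(ℝ, E) ∞ (extChartAt I x₀) (extChartAt I x₀).source := by
    rw [extChartAt_source]; exact contMDiffOn_extChartAt
  have hUo : IsOpen ((extChartAt I x₀).source ∩ extChartAt I x₀ ⁻¹' U') :=
    (continuousOn_extChartAt x₀).isOpen_inter_preimage (isOpen_extChartAt_source x₀) hU'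
  have hsm : ∀ k, ContMDiffOn I 𝓘(ℝ, ℝ) ∞ (f k ∘ extChartAt I x₀)
      ((extChartAt I x₀).source ∩ extChartAt I x₀ ⁻¹' U') := fun k =>
    (hf k).contMDiffOn.comp (hchart.mono Set.inter_subset_left) fun x hx => hx.2
  have hd : ∀ x ∈ (extChartAt I x₀).source ∩ extChartAt I x₀ ⁻¹' U', ∀ k, ∀ v : E,
      fderiv ℝ (f k) (extChartAt I x₀ x) v = differential I (f k ∘ extChartAt I x₀) x
        (mfderiv 𝓘(ℝ, E) I (extChartAt I x₀).symm (extChartAt I x₀ x) v : E) := by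
    intro x hx k v
    have hx1 := (extChartAt I x₀).map_source hx.1
    have h0 : (extChartAt I x₀).symm (extChartAt I x₀ x) = x := (extChartAt I x₀).left_inv hx.1
    have h1 : MDifferentiableAt I 𝓘(ℝ, ℝ) (f k ∘ extChartAt I x₀)
      ((extChartAt I x₀).symm (extChartAt I x₀ x)) := by
        rw [h0]; exact mdifferentiableAt_of_contMDiffOn hUo (hsm k) hx
    have h2 := HasMFDerivAt.comp (extChartAt I x₀ x) h1.hasMFDerivAt
      ((contMDiffAt_extChartAt_symm_of_mem x₀ hx1).mdifferentiableAt (by simp)).hasMFDerivAt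
    have h3 : HasFDerivAt ((f k ∘ extChartAt I x₀) ∘ (extChartAt I x₀).symm)
      (_ : E →L[ℝ] ℝ) (extChartAt I x₀ x) := hasMFDerivAt_iff_hasFDerivAt.1 h2
    have h4 : (f k ∘ extChartAt I x₀) ∘ (extChartAt I x₀).symm =ᶠ[𝓝 (extChartAt I x₀ x)] f k := by
      filter_upwards [(isOpen_extChartAt_target x₀).mem_nhds hx1] with ξ hξ
      simp only [Function.comp_apply, (extChartAt I x₀).right_inv hξ]
    rw [← h4.fderiv_eq, h3.fderiv, h0]
    rfl
  refine ⟨fun k => f k ∘ extChartAt I x₀, _, hUo, ⟨hx₀, hxU'⟩, hsm, fun x hx i k => ?_, ?_⟩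
  · have h1 := hfV _ hx.2 i k
    rw [hd x hx k, mfderiv_chart_symm_chartField x₀ (V i)
      ((extChartAt I x₀).map_source hx.1)] at h1
    rw [(extChartAt I x₀).left_inv hx.1] at h1
    exact h1
  · rw [Fintype.linearIndependent_iff]
    intro c hc
    refine Fintype.linearIndependent_iff.1 hfl c (ContinuousLinearMap.ext fun v => ?_)
    rw [sum_apply]
    simp only [smul_apply, hd x₀ ⟨hx₀, hxU'⟩]
    set w : TangentSpace I x₀ :=
      (mfderiv 𝓘(ℝ, E) I (extChartAt I x₀).symm (extChartAt I x₀ x₀) v : E)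
    have h1 := congrArg (fun A : TangentSpace I x₀ →L[ℝ] ℝ => A w) hc
    simp only [sum_apply, smul_apply] at h1
    exact h1

/-- The differential of a function pulled back from the first factor. -/
theorem differential_comp_fst {f : M → ℝ} {q : M × Chains j}
    (hf : MDifferentiableAt I 𝓘(ℝ, ℝ) f q.1) (v : TangentSpace I q.1) (w : Chains j) :
    differential (I.prod 𝓘(ℝ, Chains j)) (fun q : M × Chains j => f q.1) q (tangentPair I q v w) =
      differential I f q.1 v := by
  have h := HasMFDerivAt.comp q hf.hasMFDerivAt
    (hasMFDerivAt_fst (I := I) (I' := 𝓘(ℝ, Chains j)) q)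
  have h' : mfderiv (I.prod 𝓘(ℝ, Chains j)) 𝓘(ℝ, ℝ) (fun q : M × Chains j => f q.1) q = _ :=
    h.mfderiv
  rw [differential, h']
  rfl

theorem contMDiffOn_comp_fst {f : M → ℝ} {U : Set M} (hf : ContMDiffOn I 𝓘(ℝ, ℝ) ∞ f U) :
    ContMDiffOn (I.prod 𝓘(ℝ, Chains j)) 𝓘(ℝ, ℝ) ∞ (fun q : M × Chains j => f q.1)
      (Prod.fst ⁻¹' U) :=
  hf.comp contMDiff_fst.contMDiffOn fun _ hq => hq

end Frobenius

/-! ### Bound on the Brunovský indices and minimality of the order -/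

section Minimality

set_option linter.unusedSectionVars false

variable {E : Type*} [NormedAddCommGroup E] [NormedSpace ℝ E] [FiniteDimensional ℝ E]
  {H : Type*} [TopologicalSpace H] {I : ModelWithCorners ℝ E H} [I.Boundaryless]
  {M : Type*} [TopologicalSpace M] [ChartedSpace H M] [IsManifold I ∞ M] [IsManifold I 1 M]
  {m : ℕ} {j : Fin m → ℕ} {g : Fin m → (x : M) → TangentSpace I x} {p : M × Chains j}

namespace BrunovskyLinearization

variable (L : BrunovskyLinearization ((driftless I g).prolong j) p)

theorem contMDiffOn_output (i : Fin m) :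
    ContMDiffOn (I.prod 𝓘(ℝ, Chains j)) 𝓘(ℝ, ℝ) ∞ (L.output i) L.φ.source :=
  L.contMDiffOn_coord ⟨i, ⟨0, L.κ_pos i⟩⟩

theorem linearIndependent_differential_output {q : M × Chains j} (hq : q ∈ L.φ.source) :
    LinearIndependent ℝ fun i => differential (I.prod 𝓘(ℝ, Chains j)) (L.output i) q :=
  (L.linearIndependent_differential_coord hq).comp
    (fun i => (⟨i, ⟨0, L.κ_pos i⟩⟩ : (i : Fin m) × Fin (L.κ i)))
    fun _ _ h => congrArg Sigma.fst h

theorem sum_κ_prolong : ∑ i, L.κ i = Module.finrank ℝ E + ∑ i, j i := by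
  rw [L.sum_κ, Module.finrank_prod]
  simp [Chains]

theorem lieDeriv_tower_output (i k : Fin m) {t : ℕ} (ht : t + 1 < L.κ i) {q : M × Chains j}
    (hq : q ∈ L.φ.source) :
    lieDeriv (I.prod 𝓘(ℝ, Chains j)) (tower g j k 0)
      ((lieDeriv (I.prod 𝓘(ℝ, Chains j)) ((driftless I g).prolong j).drift)^[t] (L.output i)) q =
      0 := by
  rw [← prolong_input]
  exact L.lieDeriv_input_iterate_output i ht hq k

/-- The Brunovský indices are at most one more than the orders of prolongation. -/
theorem exists_κ_le (l : Fin m) (hg : ∀ i, SmoothFieldOn I (g i) Set.univ)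
    (hspan : (∀ x, H12' I g l x = ⊤) ∨ (∀ x, H23 I g l x = ⊤)) (i : Fin m) :
    ∃ k, L.κ i ≤ j k + 1 := by
  by_contra! h
  -- The inputs annihilate all members of the chain but the last, hence `N = κ i - 1`; the negated
  -- bound `j k + 1 < κ i` is then `j k < N`.
  have h1 := differential_eq_zero_of_long_chain g l hg L.φ.open_source (L.contMDiffOn_output i)
    (N := L.κ i - 1) (fun k t ht q hq => L.lieDeriv_tower_output i k (by omega) hq)
    (fun k => by have := h k; omega) hspan L.mem_source
  exact (L.linearIndependent_differential_output L.mem_source).ne_zero i h1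

end BrunovskyLinearization

/-- Prolongations of small total order are not linearizable. -/
theorem finrank_add_le_of_P2FlatAt (l : Fin m) (hg : ∀ i, SmoothFieldOn I (g i) Set.univ)
    (hspan : (∀ x, H12' I g l x = ⊤) ∨ (∀ x, H23 I g l x = ⊤))
    (hp : P2FlatAt (driftless I g) j p) :
    Module.finrank ℝ E + ∑ i, j i ≤ m * (∑ i, j i + 1) := by
  obtain ⟨L⟩ := hp
  rw [← L.sum_κ_prolong]
  calc ∑ i, L.κ i ≤ ∑ _i : Fin m, (∑ i, j i + 1) := by
        refine Finset.sum_le_sum fun i _ => ?_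
        obtain ⟨k, hk⟩ := L.exists_κ_le l hg hspan i
        exact hk.trans (Nat.add_le_add_right (Finset.single_le_sum (fun _ _ => Nat.zero_le _)
          (Finset.mem_univ k)) 1)
    _ = m * (∑ i, j i + 1) := by simp

end Minimality

/-! ### The brackets of the inputs with the drift -/

section BracketInput

/-- The span of `b` lies in the common kernel of the forms and has the same dimension by `hcard`, so
it is the whole kernel. -/
theorem mem_span_range_of_forall_apply_eq_zero {V ι ι' : Type*} [NormedAddCommGroup V]
    [NormedSpace ℝ V] [FiniteDimensional ℝ V] [Fintype ι] [Fintype ι'] {θ : ι → V →L[ℝ] ℝ}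
    {b : ι' → V} (hθ : LinearIndependent ℝ θ) (hb : LinearIndependent ℝ b)
    (hcard : Fintype.card ι + Fintype.card ι' = Module.finrank ℝ V) (hθb : ∀ i k, θ i (b k) = 0)
    {v : V} (hv : ∀ i, θ i v = 0) : v ∈ Submodule.span ℝ (Set.range b) := by
  set θ' : ι → Module.Dual ℝ V := fun i => (θ i : V →ₗ[ℝ] ℝ) with hθ'
  have hθ'i : LinearIndependent ℝ θ' :=
    hθ.map' (ContinuousLinearMap.coeLM ℝ) (LinearMap.ker_eq_bot.2 fun _ _ h =>
      ContinuousLinearMap.coe_injective h)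
  have hmem : ∀ w : V, (∀ i, θ i w = 0) →
      w ∈ (Submodule.span ℝ (Set.range θ')).dualCoannihilator := by
    intro w hw
    rw [Submodule.mem_dualCoannihilator]
    intro φ hφ
    induction hφ using Submodule.span_induction with
    | mem x hx => obtain ⟨i, rfl⟩ := hx; exact hw i
    | zero => rfl
    | add x y _ _ hx hy => rw [LinearMap.add_apply, hx, hy, add_zero]
    | smul c x _ hx => rw [LinearMap.smul_apply, hx, smul_zero]
  have hle : Submodule.span ℝ (Set.range b) ≤
      (Submodule.span ℝ (Set.range θ')).dualCoannihilator := by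
    rw [Submodule.span_le]
    rintro _ ⟨k, rfl⟩
    exact hmem _ fun i => hθb i k
  have h1 := Subspace.finrank_add_finrank_dualCoannihilator_eq
    (Submodule.span ℝ (Set.range θ'))
  rw [finrank_span_eq_card hθ'i] at h1
  have h2 : Module.finrank ℝ (Submodule.span ℝ (Set.range b)) = Fintype.card ι' :=
    finrank_span_eq_card hb
  rw [Submodule.eq_of_le_of_finrank_eq hle (by omega)]
  exact hmem v hv

set_option linter.unusedSectionVars false

variable {E : Type*} [NormedAddCommGroup E] [NormedSpace ℝ E] [FiniteDimensional ℝ E]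
  {H : Type*} [TopologicalSpace H] {I : ModelWithCorners ℝ E H} [I.Boundaryless]
  {M : Type*} [TopologicalSpace M] [ChartedSpace H M] [IsManifold I ∞ M] [IsManifold I 1 M]
  {m : ℕ} {j : Fin m → ℕ}

variable (g : Fin m → (x : M) → TangentSpace I x)

/-- The bracket of the `k`-th input field of a prolongation with its drift. -/
def bracketInput (j : Fin m → ℕ) (k : Fin m) (q : M × Chains j) :
    TangentSpace (I.prod 𝓘(ℝ, Chains j)) q :=
  if 0 < j k then tower g j k 1 q
  else tangentPair I q (∑ i, inputDeriv q.2 i 0 • VectorField.mlieBracket I (g k) (g i) q.1) 0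

theorem tower_zero_of_eq_zero {k : Fin m} (hk : j k = 0) :
    tower g j k 0 = liftField I (g k) (0 : Chains j) := by
  rw [← tower_top, hk]

/-- For `0 < j k` this is the first step of the tower. For `j k = 0` the input field is the lift of
`g k`, already at the top of the tower, and its bracket with the drift is the horizontal combination
of the `[g k, g i]` with coefficients `u_i^(0)`. -/
theorem lieDeriv_tower_zero_drift (hg : ∀ i, SmoothFieldOn I (g i) Set.univ) (k : Fin m)
    {U : Set (M × Chains j)} (hU : IsOpen U) {h : M × Chains j → ℝ}
    (hh : ContMDiffOn (I.prod 𝓘(ℝ, Chains j)) 𝓘(ℝ, ℝ) ∞ h U) {q : M × Chains j} (hq : q ∈ U) :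
    lieDeriv (I.prod 𝓘(ℝ, Chains j)) (tower g j k 0)
        (lieDeriv (I.prod 𝓘(ℝ, Chains j)) ((driftless I g).prolong j).drift h) q =
      lieDeriv (I.prod 𝓘(ℝ, Chains j)) ((driftless I g).prolong j).drift
        (lieDeriv (I.prod 𝓘(ℝ, Chains j)) (tower g j k 0) h) q +
      differential (I.prod 𝓘(ℝ, Chains j)) h q (bracketInput g j k q) := by
  unfold bracketInput
  split_ifs with hk
  · exact lieDeriv_tower_drift g hg hk hU hh hq
  · rw [tower_zero_of_eq_zero g (by omega), lieDeriv_liftField_drift g hg (hg k) 0 hU hh hq,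
      differential_tangentPair_sum, add_assoc]
    congr 1
    have h0 : ∀ i p, inputDeriv (0 : Chains j) i p = 0 := fun i p => by
      unfold inputDeriv; split_ifs <;> rfl
    have h1 : liftField I (fun x => ∑ i, inputDeriv (0 : Chains j) i 0 • g i x)
        (shiftChains (0 : Chains j)) q = 0 := by
      unfold liftField shiftChains
      simp only [h0, zero_smul, Finset.sum_const_zero]
      rfl
    rw [lieDeriv, h1, map_zero, zero_add]
    simp only [Pi.zero_apply, zero_mul, Finset.sum_const_zero, add_zero]
    rfl

/-- The decoupling matrix is regular where the lower time derivatives of `y` are independent, if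
the input fields and their brackets with the drift are independent. -/
theorem det_decoupling_ne_zero (hg : ∀ i, SmoothFieldOn I (g i) Set.univ) {κ : Fin m → ℕ}
    {y : Fin m → M × Chains j → ℝ} {U : Set (M × Chains j)} {p : M × Chains j}
    (hκ : ∀ i, 0 < κ i) (hU : IsOpen U) (hp : p ∈ U)
    (hy : ∀ i, ContMDiffOn (I.prod 𝓘(ℝ, Chains j)) 𝓘(ℝ, ℝ) ∞ (y i) U)
    (hB : ∀ i k t, t + 1 < κ i → ∀ q ∈ U, lieDeriv (I.prod 𝓘(ℝ, Chains j)) (tower g j k 0)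
      ((lieDeriv (I.prod 𝓘(ℝ, Chains j)) ((driftless I g).prolong j).drift)^[t] (y i)) q = 0)
    (hdim : ∑ i, κ i = Module.finrank ℝ (E × Chains j))
    (hlow : LinearIndependent ℝ fun c : {c : (i : Fin m) × Fin (κ i) // (c.2 : ℕ) + 1 < κ c.1} =>
      differential (I.prod 𝓘(ℝ, Chains j)) ((lieDeriv (I.prod 𝓘(ℝ, Chains j))
        ((driftless I g).prolong j).drift)^[c.1.2] (y c.1.1)) p)
    (hBW : LinearIndependent ℝ (Sum.elim (fun k => tower g j k 0 p)
      (fun k => bracketInput g j k p))) :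
    (decoupling ((driftless I g).prolong j) κ y p).det ≠ 0 := by
  intro hdet
  -- For a kernel vector `v`, the combination of the brackets `[B_k, F]` with coefficients `v k` is
  -- annihilated by all lower derivatives: the differential of the `t`-th derivative on `[B_k, F]`
  -- is the derivative of the next one along `B_k`, which is zero or an entry of the decoupling
  -- matrix. The combination then lies in the span of the `B_k`, contrary to `hBW`.
  obtain ⟨v, hv0, hv⟩ := Matrix.exists_mulVec_eq_zero_iff.2 hdet
  -- Exactly one index per chain is not lower. The number of forms is thus the dimension minus `m`,
  -- complementary to the `m` input fields.
  have hcard : Fintype.card {c : (i : Fin m) × Fin (κ i) // (c.2 : ℕ) + 1 < κ c.1} +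
      Fintype.card (Fin m) = Module.finrank ℝ (E × Chains j) := by
    have h1 := Fintype.card_subtype_compl
      (fun c : (i : Fin m) × Fin (κ i) => (c.2 : ℕ) + 1 < κ c.1)
    have h2 := Fintype.card_subtype_le
      (fun c : (i : Fin m) × Fin (κ i) => (c.2 : ℕ) + 1 < κ c.1)
    have h3 : Fintype.card {c : (i : Fin m) × Fin (κ i) // ¬ ((c.2 : ℕ) + 1 < κ c.1)} =
        Fintype.card (Fin m) := by
      refine Fintype.card_congr ⟨fun c => c.1.1,
        fun i => ⟨⟨i, ⟨κ i - 1, Nat.sub_lt (hκ i) one_pos⟩⟩, ?_⟩, ?_, fun _ => rfl⟩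
      · have := hκ i
        simp only
        omega
      · rintro ⟨⟨i, t⟩, ht⟩
        have := t.2
        simp only at ht
        simp only [Subtype.mk.injEq]
        congr 1
        exact Fin.ext (by simp only; omega)
    have h4 : Fintype.card ((i : Fin m) × Fin (κ i)) = ∑ i, κ i := by simp
    omega
  have hmem : ∑ k, v k • bracketInput g j k p ∈
      Submodule.span ℝ (Set.range fun k => tower g j k 0 p) := by
    refine mem_span_range_of_forall_apply_eq_zero (V := E × Chains j) hlow
      (hBW.comp Sum.inl Sum.inl_injective) hcard (fun c k => hB c.1.1 k c.1.2 c.2 p hp) ?_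
    rintro ⟨⟨i, t⟩, ht⟩
    simp only at ht ⊢
    refine (map_sum (differential (I.prod 𝓘(ℝ, Chains j)) ((lieDeriv (I.prod 𝓘(ℝ, Chains j))
      ((driftless I g).prolong j).drift)^[(t : ℕ)] (y i)) p)
      (fun k => v k • bracketInput g j k p) Finset.univ).trans ?_
    have h1 : ∀ k, differential (I.prod 𝓘(ℝ, Chains j)) ((lieDeriv (I.prod 𝓘(ℝ, Chains j))
        ((driftless I g).prolong j).drift)^[(t : ℕ)] (y i)) p (bracketInput g j k p) =
        lieDeriv (I.prod 𝓘(ℝ, Chains j)) (tower g j k 0)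
          ((lieDeriv (I.prod 𝓘(ℝ, Chains j)) ((driftless I g).prolong j).drift)^[(t : ℕ) + 1]
            (y i)) p := by
      intro k
      have h2 := lieDeriv_tower_zero_drift g hg k hU
        (contMDiffOn_iterate_lieDeriv_drift g hg hU (hy i) t) hp
      rw [lieDeriv_eq_zero_of_eq_zero (h := lieDeriv (I.prod 𝓘(ℝ, Chains j)) (tower g j k 0)
        ((lieDeriv (I.prod 𝓘(ℝ, Chains j)) ((driftless I g).prolong j).drift)^[(t : ℕ)] (y i)))
        hU (fun q hq => hB i k t ht q hq) _ hp, zero_add] at h2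
      rw [Function.iterate_succ_apply']
      exact h2.symm
    simp only [map_smul, h1, smul_eq_mul]
    by_cases ht' : (t : ℕ) + 1 + 1 < κ i
    · exact Finset.sum_eq_zero fun k _ => by rw [hB i k _ ht' p hp, mul_zero]
    · have h3 : (t : ℕ) + 1 = κ i - 1 := by omega
      have h4 := congrFun hv i
      simp only [Matrix.mulVec, dotProduct, decoupling, prolong_input, Pi.zero_apply] at h4
      rw [h3, ← h4]
      exact Finset.sum_congr rfl fun k _ => mul_comm _ _
  obtain ⟨a, ha⟩ := (Submodule.mem_span_range_iff_exists_fun ℝ).1 hmem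
  have h5 := Fintype.linearIndependent_iff.1 hBW (Sum.elim (fun k => -a k) v) (by
    rw [Fintype.sum_sum_type]
    simp only [Sum.elim_inl, Sum.elim_inr, neg_smul, Finset.sum_neg_distrib]
    exact neg_add_eq_zero.2 ha)
  exact hv0 (funext fun k => h5 (Sum.inr k))

/-- Functions whose lower time derivatives are annihilated by the inputs and independent are flat
outputs. -/
theorem isFlatOutputAt_of_linearIndependent (hg : ∀ i, SmoothFieldOn I (g i) Set.univ)
    {κ : Fin m → ℕ}
    {y : Fin m → M × Chains j → ℝ} {U : Set (M × Chains j)} {p : M × Chains j}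
    (hκ : ∀ i, 0 < κ i) (hU : IsOpen U) (hp : p ∈ U)
    (hy : ∀ i, ContMDiffOn (I.prod 𝓘(ℝ, Chains j)) 𝓘(ℝ, ℝ) ∞ (y i) U)
    (hB : ∀ i k t, t + 1 < κ i → ∀ q ∈ U, lieDeriv (I.prod 𝓘(ℝ, Chains j)) (tower g j k 0)
      ((lieDeriv (I.prod 𝓘(ℝ, Chains j)) ((driftless I g).prolong j).drift)^[t] (y i)) q = 0)
    (hdim : ∑ i, κ i = Module.finrank ℝ E + ∑ i, j i)
    (hlow : LinearIndependent ℝ fun c : {c : (i : Fin m) × Fin (κ i) // (c.2 : ℕ) + 1 < κ c.1} =>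
      differential (I.prod 𝓘(ℝ, Chains j)) ((lieDeriv (I.prod 𝓘(ℝ, Chains j))
        ((driftless I g).prolong j).drift)^[c.1.2] (y c.1.1)) p)
    (hBW : LinearIndependent ℝ (Sum.elim (fun k => tower g j k 0 p)
      (fun k => bracketInput g j k p))) :
    IsFlatOutputAt (driftless I g) j p y := by
  have hdim' : ∑ i, κ i = Module.finrank ℝ (E × Chains j) := by
    rw [hdim, Module.finrank_prod]
    simp [Chains]
  have hys := fun i t => contMDiffOn_iterate_lieDeriv_drift g hg hU (hy i) t
  exact exists_brunovskyLinearization hκ hU hp hys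
    (fun i k t => by
      rw [prolong_input]
      exact contMDiffOn_lieDeriv_tower g hg k 0 hU (hys i t))
    (fun i k t ht q hq => by rw [prolong_input]; exact hB i k t ht q hq) hdim'
    (det_decoupling_ne_zero g hg hκ hU hp hy hB hdim' hlow hBW) hlow

end BracketInput

/-! ### Independence of the brackets -/

section Families

set_option linter.unusedSectionVars false

variable {E : Type*} [NormedAddCommGroup E] [NormedSpace ℝ E] [FiniteDimensional ℝ E]
  {H : Type*} [TopologicalSpace H] {I : ModelWithCorners ℝ E H} [I.Boundaryless]
  {M : Type*} [TopologicalSpace M] [ChartedSpace H M] [IsManifold I ∞ M] [IsManifold I 1 M]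
  {m : ℕ}

variable (g : Fin m → (x : M) → TangentSpace I x) (l : Fin m)

/-- The fields `g_i` and `[g_l, g_i]` for `i ≠ l`. -/
def bracketFamily : {i : Fin m // i ≠ l} ⊕ {i : Fin m // i ≠ l} → (x : M) → TangentSpace I x :=
  Sum.elim (fun i => g i) (fun i => VectorField.mlieBracket I (g l) (g i))

theorem smoothFieldOn_bracketFamily (hg : ∀ i, SmoothFieldOn I (g i) Set.univ)
    (s : {i : Fin m // i ≠ l} ⊕ {i : Fin m // i ≠ l}) :
    SmoothFieldOn I (bracketFamily g l s) Set.univ := by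
  rcases s with i | i
  · exact hg i
  · exact smoothFieldOn_mlieBracket (hg l) (hg i)

theorem span_range_eq_H02 (x : M) :
    Submodule.span ℝ (Set.range fun i : {i : Fin m // i ≠ l} => g i x) = H02 I g l x := by
  unfold H02
  congr 1
  ext w
  constructor
  · rintro ⟨i, rfl⟩
    exact ⟨i, i.2, rfl⟩
  · rintro ⟨i, hi, rfl⟩
    exact ⟨⟨i, hi⟩, rfl⟩

theorem span_range_bracketFamily (x : M) :
    Submodule.span ℝ (Set.range fun s => bracketFamily g l s x) = H12 I g l x := by
  unfold H12 H02
  rw [← Submodule.span_union]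
  congr 1
  ext w
  constructor
  · rintro ⟨i | i, rfl⟩
    · exact Or.inl ⟨i, i.2, rfl⟩
    · exact Or.inr ⟨i, i.2, rfl⟩
  · rintro (⟨i, hi, rfl⟩ | ⟨i, hi, rfl⟩)
    · exact ⟨Sum.inl ⟨i, hi⟩, rfl⟩
    · exact ⟨Sum.inr ⟨i, hi⟩, rfl⟩

theorem span_range_option_bracketFamily (x : M) :
    Submodule.span ℝ (Set.range fun o : Option _ => o.elim (g l x) fun s => bracketFamily g l s x) =
      H12' I g l x := by
  unfold H12'
  rw [← span_range_bracketFamily, ← Submodule.span_union]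
  congr 1
  ext w
  constructor
  · rintro ⟨_ | s, rfl⟩
    · exact Or.inr rfl
    · exact Or.inl ⟨s, rfl⟩
  · rintro (⟨s, rfl⟩ | rfl)
    · exact ⟨some s, rfl⟩
    · exact ⟨none, rfl⟩

theorem card_ne : Fintype.card {i : Fin m // i ≠ l} = m - 1 := by
  simp

/-- The rank equals the number `2 * (m - 1)` of spanning fields. -/
theorem linearIndependent_bracketFamily {x : M}
    (h : Module.finrank ℝ (H12 I g l x) = 2 * m - 2) :
    LinearIndependent ℝ fun s => bracketFamily g l s x := by
  rw [linearIndependent_iff_card_eq_finrank_span, Set.finrank, span_range_bracketFamily, h,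
    Fintype.card_sum, card_ne]
  omega

theorem linearIndependent_option_bracketFamily {x : M}
    (h : Module.finrank ℝ (H12' I g l x) = 2 * m - 1) :
    LinearIndependent ℝ fun o : Option _ => o.elim (g l x) fun s => bracketFamily g l s x := by
  rw [linearIndependent_iff_card_eq_finrank_span, Set.finrank, span_range_option_bracketFamily, h,
    Fintype.card_option, Fintype.card_sum, card_ne]
  have := l.pos
  omega

variable {g l} in
theorem linearIndependent_of_option {x : M}
    (h : LinearIndependent ℝ fun o : Option _ => o.elim (g l x) fun s => bracketFamily g l s x) :
    LinearIndependent ℝ fun s => bracketFamily g l s x :=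
  h.comp some (Option.some_injective _)

variable {g l} in
theorem linearIndependent_ne {x : M} (h : LinearIndependent ℝ fun s => bracketFamily g l s x) :
    LinearIndependent ℝ fun i : {i : Fin m // i ≠ l} => g i x :=
  h.comp Sum.inl Sum.inl_injective

theorem mlieBracket_mem_H02 (hg : ∀ i, SmoothFieldOn I (g i) Set.univ)
    (hinv : Involutive I (H02 I g l)) (x : M) (i k : {i : Fin m // i ≠ l}) :
    VectorField.mlieBracket I (g i) (g k) x ∈
      Submodule.span ℝ (Set.range fun i : {i : Fin m // i ≠ l} => g i x) := by
  rw [span_range_eq_H02]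
  exact hinv Set.univ isOpen_univ _ _ (hg i) (hg k)
    (fun x _ => Submodule.subset_span ⟨i, i.2, rfl⟩)
    (fun x _ => Submodule.subset_span ⟨k, k.2, rfl⟩) x trivial

theorem mlieBracket_mem_H12 (hg : ∀ i, SmoothFieldOn I (g i) Set.univ)
    (hinv : Involutive I (H12 I g l)) (x : M)
    (s t : {i : Fin m // i ≠ l} ⊕ {i : Fin m // i ≠ l}) :
    VectorField.mlieBracket I (bracketFamily g l s) (bracketFamily g l t) x ∈
      Submodule.span ℝ (Set.range fun s => bracketFamily g l s x) := by
  have hmem : ∀ s x, bracketFamily g l s x ∈ H12 I g l x := fun s x => by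
    rw [← span_range_bracketFamily]
    exact Submodule.subset_span ⟨s, rfl⟩
  rw [span_range_bracketFamily]
  exact hinv Set.univ isOpen_univ _ _ (smoothFieldOn_bracketFamily g l hg s)
    (smoothFieldOn_bracketFamily g l hg t) (fun x _ => hmem s x) (fun x _ => hmem t x) x trivial

variable {r : ℕ}

variable {l} in
theorem single_eq_zero {k : Fin m} (hk : k ≠ l) : (Pi.single l r : Fin m → ℕ) k = 0 :=
  Pi.single_eq_of_ne hk _

variable {l} in
theorem inputDeriv_eq_zero_of_ne {k : Fin m} (hk : k ≠ l)
    (ν : Chains (Pi.single l r : Fin m → ℕ)) (p : ℕ) : inputDeriv ν k p = 0 := by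
  unfold inputDeriv
  rw [dif_neg]
  rw [single_eq_zero hk]
  exact Nat.not_lt_zero p

-- Only `u_l` is a state of this prolongation; the other inputs `u_i^(0)` take the default value
-- zero of `inputDeriv`, so a single bracket survives.
variable {g l} in
theorem bracketInput_of_ne {k : Fin m} (hk : k ≠ l)
    (q : M × Chains (Pi.single l r : Fin m → ℕ)) :
    bracketInput g (Pi.single l r) k q =
      tangentPair I q (inputDeriv q.2 l 0 • VectorField.mlieBracket I (g k) (g l) q.1) 0 := by
  unfold bracketInput
  rw [if_neg (by rw [single_eq_zero hk]; exact lt_irrefl 0), Finset.sum_eq_single l]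
  · intro i _ hi
    rw [inputDeriv_eq_zero_of_ne hi, zero_smul]
  · simp

variable {g l} in
theorem bracketInput_self (hr : 0 < r) (q : M × Chains (Pi.single l r : Fin m → ℕ)) :
    bracketInput g (Pi.single l r) l q = tower g (Pi.single l r) l 1 q := by
  unfold bracketInput
  rw [if_pos (by simpa using hr)]

variable {g l} in
theorem tower_of_ne {k : Fin m} (hk : k ≠ l) (q : M × Chains (Pi.single l r : Fin m → ℕ)) :
    tower g (Pi.single l r) k 0 q = tangentPair I q (g k q.1) 0 := by
  rw [tower_zero_of_eq_zero g (single_eq_zero hk)]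
  rfl

variable {g l} in
/-- The components of a linear relation between the input fields and their brackets with the
drift. -/
theorem components_of_relation (hr : 0 < r) {p : M × Chains (Pi.single l r : Fin m → ℕ)}
    {a b : Fin m → ℝ}
    (h : ∑ k, a k • tower g (Pi.single l r) k 0 p +
      ∑ k, b k • bracketInput g (Pi.single l r) k p = 0) :
    a l = 0 ∧ (1 < r → b l = 0) ∧
    (∑ k : {i : Fin m // i ≠ l}, a k • g k p.1) +
      (∑ k : {i : Fin m // i ≠ l}, b k •
        (inputDeriv p.2 l 0 • VectorField.mlieBracket I (g k) (g l) p.1)) +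
      (b l • if r ≤ 1 then g l p.1 else 0) = 0 := by
  have hl : (Pi.single l r : Fin m → ℕ) l = r := by simp
  rw [Fintype.sum_eq_add_sum_subtype_ne _ l, Fintype.sum_eq_add_sum_subtype_ne _ l,
    bracketInput_self hr] at h
  have e1 := fun k : {i : Fin m // i ≠ l} => tower_of_ne (g := g) k.2 p
  have e2 := fun k : {i : Fin m // i ≠ l} => bracketInput_of_ne (g := g) k.2 p
  simp only [e1, e2] at h
  let T : ℕ → E × Chains (Pi.single l r : Fin m → ℕ) := fun s => tower g (Pi.single l r) l s p
  let G : Fin m → E := fun k => g k p.1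
  let W : Fin m → E := fun k => inputDeriv p.2 l 0 • VectorField.mlieBracket I (g k) (g l) p.1
  have h1 : (a l • T 0 + ∑ k : {i : Fin m // i ≠ l}, a k • (G k, 0)) +
      (b l • T 1 + ∑ k : {i : Fin m // i ≠ l}, b k • (W k, 0)) = 0 := h
  have hf := congrArg Prod.fst h1
  have hs := congrArg Prod.snd h1
  have ht1 : ∀ s, (T s).1 = if r ≤ s then G l else 0 := by
    intro s
    show (if (Pi.single l r : Fin m → ℕ) l ≤ s then g l else 0) p.1 = _
    rw [hl]
    split_ifs <;> rfl
  have ht2 : ∀ s c, (T s).2 c =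
      if c.1 = l ∧ (c.2 : ℕ) + s + 1 = (Pi.single l r : Fin m → ℕ) c.1 then 1 else 0 :=
    fun s c => rfl
  simp only [Prod.fst_add, Prod.fst_sum, Prod.smul_fst, ht1, Prod.fst_zero] at hf
  simp only [Prod.snd_add, Prod.snd_sum, Prod.smul_snd, smul_zero, Finset.sum_const_zero, add_zero,
    Prod.snd_zero] at hs
  have hs' : ∀ c, a l * (T 0).2 c + b l * (T 1).2 c = 0 := fun c => congrFun hs c
  simp only [ht2] at hs'
  -- The coordinate `u_l^(r - 1)` occurs only in the input field `l`. The coordinate `u_l^(r - 2)`,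
  -- present for `1 < r`, occurs only in the bracket of that field with the drift. For `r = 1` this
  -- bracket is `g l` and enters the horizontal component instead.
  refine ⟨?_, fun hr1 => ?_, ?_⟩
  · have := hs' ⟨l, ⟨r - 1, by omega⟩⟩
    rw [if_pos ⟨rfl, by simp only [hl]; omega⟩, if_neg (by simp only [hl]; omega)] at this
    simpa using this
  · have := hs' ⟨l, ⟨r - 2, by omega⟩⟩
    rw [if_neg (by simp only [hl]; omega), if_pos ⟨rfl, by simp only [hl]; omega⟩] at this
    simpa using this
  · rw [if_neg (by omega : ¬ r ≤ 0)] at hf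
    rw [smul_zero, zero_add] at hf
    refine Eq.trans ?_ hf
    rw [add_assoc]
    congr 1
    exact add_comm _ _

-- With one prolongation `[B_l, F]` is the lift of `g l`, so a relation becomes one between `g l`,
-- the `g i` and the `[g l, g i]`. The last ones carry the factor `-u_l`, with a sign from the order
-- of the bracket, and `u_l ≠ 0`.
variable {g l} in
theorem linearIndependent_tower_bracketInput_one
    {p : M × Chains (Pi.single l 1 : Fin m → ℕ)} (hu : inputDeriv p.2 l 0 ≠ 0)
    (h : LinearIndependent ℝ fun o : Option _ =>
      o.elim (g l p.1) fun s => bracketFamily g l s p.1) :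
    LinearIndependent ℝ (Sum.elim (fun k => tower g (Pi.single l 1) k 0 p)
      (fun k => bracketInput g (Pi.single l 1) k p)) := by
  rw [Fintype.linearIndependent_iff]
  intro c hc
  rw [Fintype.sum_sum_type] at hc
  obtain ⟨h1, -, h3⟩ := components_of_relation one_pos hc
  have h4 := Fintype.linearIndependent_iff.1 h (fun o => o.elim (c (Sum.inr l))
    (Sum.elim (fun k => c (Sum.inl k)) fun k => -(c (Sum.inr k) * inputDeriv p.2 l 0))) (by
      rw [Fintype.sum_option, Fintype.sum_sum_type, add_comm, ← h3]
      rw [if_pos le_rfl]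
      congr 1
      congr 1
      refine Finset.sum_congr rfl fun k _ => ?_
      simp only [Option.elim_some, Sum.elim_inr, bracketFamily]
      rw [VectorField.mlieBracket_swap_apply, smul_neg, neg_smul, neg_neg, mul_smul])
  have h5 : ∀ k, k ≠ l → c (Sum.inl k) = 0 := fun k hk => h4 (some (Sum.inl ⟨k, hk⟩))
  have h6 : ∀ k, k ≠ l → c (Sum.inr k) = 0 := fun k hk => by
    have : -(c (Sum.inr k) * inputDeriv p.2 l 0) = 0 := h4 (some (Sum.inr ⟨k, hk⟩))
    simpa [hu] using this
  rintro (k | k) <;> by_cases hk : k = l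
  · rw [hk]; exact h1
  · exact h5 k hk
  · rw [hk]; exact h4 none
  · exact h6 k hk

-- With two prolongations `[B_l, F]` is the coordinate field of `u_l`, so `g l` does not occur among
-- the horizontal parts, and independence of the `g i` and `[g l, g i]` suffices.
variable {g l} in
theorem linearIndependent_tower_bracketInput_two
    {p : M × Chains (Pi.single l 2 : Fin m → ℕ)} (hu : inputDeriv p.2 l 0 ≠ 0)
    (h : LinearIndependent ℝ fun s => bracketFamily g l s p.1) :
    LinearIndependent ℝ (Sum.elim (fun k => tower g (Pi.single l 2) k 0 p)
      (fun k => bracketInput g (Pi.single l 2) k p)) := by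
  rw [Fintype.linearIndependent_iff]
  intro c hc
  rw [Fintype.sum_sum_type] at hc
  obtain ⟨h1, h2, h3⟩ := components_of_relation two_pos hc
  rw [if_neg (by norm_num), smul_zero, add_zero] at h3
  have h4 := Fintype.linearIndependent_iff.1 h
    (Sum.elim (fun k => c (Sum.inl k)) fun k => -(c (Sum.inr k) * inputDeriv p.2 l 0)) (by
      rw [Fintype.sum_sum_type, ← h3]
      congr 1
      refine Finset.sum_congr rfl fun k _ => ?_
      simp only [Sum.elim_inr, bracketFamily]
      rw [VectorField.mlieBracket_swap_apply, smul_neg, neg_smul, neg_neg, mul_smul])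
  have h5 : ∀ k, k ≠ l → c (Sum.inl k) = 0 := fun k hk => h4 (Sum.inl ⟨k, hk⟩)
  have h6 : ∀ k, k ≠ l → c (Sum.inr k) = 0 := fun k hk => by
    have : -(c (Sum.inr k) * inputDeriv p.2 l 0) = 0 := h4 (Sum.inr ⟨k, hk⟩)
    simpa [hu] using this
  rintro (k | k) <;> by_cases hk : k = l
  · rw [hk]; exact h1
  · exact h5 k hk
  · rw [hk]; exact h2 one_lt_two
  · exact h6 k hk

end Families

section Near

variable {E : Type*} [NormedAddCommGroup E] [NormedSpace ℝ E]
  {H : Type*} [TopologicalSpace H] {I : ModelWithCorners ℝ E H}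
  {M : Type*} [TopologicalSpace M] [ChartedSpace H M]

theorem exists_isOpen_forall_contMDiffOn {ι : Type*} [Finite ι] {y : ι → M → ℝ} {p : M}
    (h : ∀ i, SmoothNear I (y i) p) :
    ∃ U : Set M, IsOpen U ∧ p ∈ U ∧ ∀ i, ContMDiffOn I 𝓘(ℝ, ℝ) ∞ (y i) U := by
  choose U hU hp hy using h
  exact ⟨⋂ i, U i, isOpen_iInter_of_finite hU, Set.mem_iInter.2 hp,
    fun i => (hy i).mono (Set.iInter_subset U i)⟩

end Near

/-! ### Flat outputs with `2m - 1` states -/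

section Odd

set_option linter.unusedSectionVars false

variable {E : Type} [NormedAddCommGroup E] [NormedSpace ℝ E] [FiniteDimensional ℝ E]
  {H : Type*} [TopologicalSpace H] {I : ModelWithCorners ℝ E H} [I.Boundaryless]
  {M : Type*} [TopologicalSpace M] [ChartedSpace H M] [IsManifold I ∞ M] [IsManifold I 1 M]
  {m : ℕ} {g : Fin m → (x : M) → TangentSpace I x} {l : Fin m}

theorem H12'_eq_top {x : M} (hn : Module.finrank ℝ E = 2 * m - 1)
    (h : Module.finrank ℝ (H12' I g l x) = 2 * m - 1) : H12' I g l x = ⊤ :=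
  Submodule.eq_top_of_finrank_eq (K := ℝ) (V := E) (h.trans hn.symm)

theorem sum_single (l : Fin m) (r : ℕ) : ∑ i, (Pi.single l r : Fin m → ℕ) i = r := by
  simp

theorem single_le (l k : Fin m) (r : ℕ) : (Pi.single l r : Fin m → ℕ) k ≤ r := by
  by_cases hk : k = l
  · subst hk; simp
  · simp [hk]

/-- All indices are at most 2 and they sum to `2m`, so every one equals 2. The outputs are then
annihilated by the inputs, which are the lifted `g i` for `i ≠ l` and the only vertical coordinate
field. -/
theorem outputEquationsOdd_of_isFlatOutputAt (hg : ∀ i, SmoothFieldOn I (g i) Set.univ)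
    (hn : Module.finrank ℝ E = 2 * m - 1)
    (hrank : ∀ x, Module.finrank ℝ (H12' I g l x) = 2 * m - 1)
    {p : M × Chains (Pi.single l 1 : Fin m → ℕ)}
    {y : Fin m → M × Chains (Pi.single l 1 : Fin m → ℕ) → ℝ}
    (hy : IsFlatOutputAt (driftless I g) (Pi.single l 1) p y) : OutputEquationsOdd g l y p := by
  obtain ⟨L, hL⟩ := hy
  have hm := l.pos
  have hκ : ∀ i, L.κ i = 2 := by
    have h1 : ∀ i ∈ Finset.univ, L.κ i ≤ 2 := fun i _ => by
      obtain ⟨k, hk⟩ := L.exists_κ_le l hg (Or.inl fun x => H12'_eq_top hn (hrank x)) i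
      exact hk.trans (Nat.add_le_add_right (single_le l k 1) 1)
    have h2 : ∑ i, L.κ i = ∑ _i : Fin m, 2 := by
      rw [L.sum_κ_prolong, sum_single, hn]
      simp only [Finset.sum_const, Finset.card_univ, Fintype.card_fin, smul_eq_mul]
      omega
    exact fun i => (Finset.sum_eq_sum_iff_of_le h1).1 h2 i (Finset.mem_univ i)
  have hB : ∀ i k, ∀ q ∈ L.φ.source, lieDeriv (I.prod 𝓘(ℝ, Chains (Pi.single l 1)))
      (tower g (Pi.single l 1) k 0) (L.output i) q = 0 := fun i k q hq =>
    L.lieDeriv_tower_output i k (t := 0) (by rw [hκ]; norm_num) hq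
  have hd : ∀ i, ∀ q ∈ L.φ.source, differential (I.prod 𝓘(ℝ, Chains (Pi.single l 1))) (y i) q =
      differential (I.prod 𝓘(ℝ, Chains (Pi.single l 1))) (L.output i) q := fun i q hq =>
    differential_congr L.φ.open_source (hL i) hq
  refine ⟨fun i => ⟨L.φ.source, L.φ.open_source, L.mem_source,
    (L.contMDiffOn_output i).congr fun q hq => hL i q hq⟩, fun i => ?_, ?_⟩
  · refine Filter.eventually_of_mem (L.φ.open_source.mem_nhds L.mem_source)
      fun q hq (w : TangentSpace I q.1) hw ν => ?_
    rw [hd i q hq, differential_tangentPair]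
    have h1 : H02 I g l q.1 ≤ horizontalKernel (I := I) (L.output i) q := by
      refine Submodule.span_le.2 ?_
      rintro _ ⟨k, hk, rfl⟩
      have h2 := hB i k q hq
      rw [lieDeriv, tower_of_ne hk] at h2
      exact h2
    rw [mem_horizontalKernel.1 (h1 hw), zero_add]
    refine Finset.sum_eq_zero fun a _ => ?_
    have h3 := hB i a.1 q hq
    have h4 := a.2.2
    have h5 := single_le l a.1 1
    rw [show (0 : ℕ) = (Pi.single l 1 : Fin m → ℕ) a.1 - 1 - a.2 by omega, tower_coord] at h3
    rw [h3, mul_zero]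
  · have h1 := L.linearIndependent_differential_output L.mem_source
    simpa only [hd _ p L.mem_source] using h1

/-- All chains get length 2, so the lower derivatives are the `y i` themselves, and their
independence is assumed. -/
theorem isFlatOutputAt_of_outputEquationsOdd (hg : ∀ i, SmoothFieldOn I (g i) Set.univ)
    (hn : Module.finrank ℝ E = 2 * m - 1)
    (hrank : ∀ x, Module.finrank ℝ (H12' I g l x) = 2 * m - 1)
    {p : M × Chains (Pi.single l 1 : Fin m → ℕ)} (hu : inputDeriv p.2 l 0 ≠ 0)
    {y : Fin m → M × Chains (Pi.single l 1 : Fin m → ℕ) → ℝ}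
    (hy : OutputEquationsOdd g l y p) : IsFlatOutputAt (driftless I g) (Pi.single l 1) p y := by
  obtain ⟨hys, hann, hli⟩ := hy
  obtain ⟨U, hU, hpU, hyU⟩ := exists_isOpen_forall_contMDiffOn hys
  obtain ⟨U', hU'ann, hU', hpU'⟩ := eventually_nhds_iff.1 (Filter.eventually_all.2 hann)
  have hm := l.pos
  have hin : ∀ k q, ∃ w ∈ H02 I g l q.1, ∃ ν, tower g (Pi.single l 1) k 0 q =
      tangentPair I q w ν := by
    intro k q
    by_cases hk : k = l
    · subst hk
      refine ⟨0, Submodule.zero_mem _, fun c =>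
        if c.1 = k ∧ (c.2 : ℕ) + 0 + 1 = (Pi.single k 1 : Fin m → ℕ) c.1 then 1 else 0, ?_⟩
      unfold tower
      rw [if_neg (by simp)]
      rfl
    · exact ⟨g k q.1, Submodule.subset_span ⟨k, hk, rfl⟩, 0, tower_of_ne hk q⟩
  refine isFlatOutputAt_of_linearIndependent g hg (κ := fun _ => 2) (fun _ => two_pos)
    (hU.inter hU') ⟨hpU, hpU'⟩ (fun i => (hyU i).mono Set.inter_subset_left) ?_ ?_ ?_
    (linearIndependent_tower_bracketInput_one hu
      (linearIndependent_option_bracketFamily g l (hrank p.1)))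
  · intro i k t ht q hq
    obtain rfl : t = 0 := by omega
    obtain ⟨w, hw, ν, h⟩ := hin k q
    rw [lieDeriv, h]
    exact hU'ann q hq.2 i w hw ν
  · rw [sum_single, hn]
    simp only [Finset.sum_const, Finset.card_univ, Fintype.card_fin, smul_eq_mul]
    omega
  · have h0 : ∀ c : {c : (_i : Fin m) × Fin 2 // (c.2 : ℕ) + 1 < 2}, (c.1.2 : ℕ) = 0 :=
      fun c => by have := c.2; omega
    have h1 := hli.comp (fun c : {c : (_i : Fin m) × Fin 2 // (c.2 : ℕ) + 1 < 2} => c.1.1) (by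
      rintro ⟨⟨i, t⟩, ht⟩ ⟨⟨i', t'⟩, ht'⟩ h
      simp only at ht ht' h
      subst h
      obtain rfl : t = t' := Fin.ext (by omega)
      rfl)
    convert h1 using 2 with c
    rw [h0 c]
    rfl

/-- Existence of flat outputs. -/
theorem exists_outputEquationsOdd (hg : ∀ i, SmoothFieldOn I (g i) Set.univ)
    (hn : Module.finrank ℝ E = 2 * m - 1) (hinv : Involutive I (H02 I g l))
    (hrank : ∀ x, Module.finrank ℝ (H12' I g l x) = 2 * m - 1)
    (p : M × Chains (Pi.single l 1 : Fin m → ℕ)) :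
    ∃ y : Fin m → M × Chains (Pi.single l 1 : Fin m → ℕ) → ℝ, OutputEquationsOdd g l y p := by
  have hm := l.pos
  obtain ⟨f, U, hU, hpU, hf, hfg, hli⟩ := exists_firstIntegrals_manifold
    (fun i : {i : Fin m // i ≠ l} => g i) (fun i => hg i) p.1
    (linearIndependent_ne (linearIndependent_of_option
      (linearIndependent_option_bracketFamily g l (hrank p.1))))
    (mlieBracket_mem_H02 g l hg hinv)
  -- The corank of `H02` is `(2m - 1) - (m - 1) = m`: there are exactly as many first integrals as
  -- outputs.
  have hcard : m = Module.finrank ℝ E - Fintype.card {i : Fin m // i ≠ l} := by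
    rw [hn, card_ne]
    omega
  have hmd : ∀ k, ∀ q : M × Chains (Pi.single l 1 : Fin m → ℕ), q.1 ∈ U →
      MDifferentiableAt I 𝓘(ℝ, ℝ) (f k) q.1 := fun k q hq =>
    mdifferentiableAt_of_contMDiffOn hU (hf k) hq
  refine ⟨fun i q => f (finCongr hcard i) q.1, fun i => ⟨_, hU.preimage continuous_fst, hpU,
    contMDiffOn_comp_fst (hf _)⟩, fun i => ?_, ?_⟩
  · refine Filter.eventually_of_mem ((hU.preimage continuous_fst).mem_nhds hpU)
      fun q hq (w : TangentSpace I q.1) hw ν => ?_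
    rw [differential_comp_fst (hmd _ q hq)]
    have h1 : H02 I g l q.1 ≤ LinearMap.ker
        (differential I (f (finCongr hcard i)) q.1 : TangentSpace I q.1 →ₗ[ℝ] ℝ) := by
      refine Submodule.span_le.2 ?_
      rintro _ ⟨k, hk, rfl⟩
      exact hfg q.1 hq ⟨k, hk⟩ _
    exact h1 hw
  · have hli' := hli.comp (finCongr hcard) (finCongr hcard).injective
    rw [Fintype.linearIndependent_iff] at hli' ⊢
    intro c hc
    refine hli' c (ContinuousLinearMap.ext fun v => ?_)
    have h1 := congrArg (fun A : TangentSpace (I.prod 𝓘(ℝ, Chains (Pi.single l 1))) p →L[ℝ] ℝ =>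
      A (tangentPair I p v 0)) hc
    simp only [sum_apply, smul_apply, differential_comp_fst (hmd _ p hpU)] at h1
    rw [sum_apply]
    exact h1

end Odd

/-! ### Differential independence of flat outputs -/

section Forget

set_option linter.unusedSectionVars false

variable {E : Type*} [NormedAddCommGroup E] [NormedSpace ℝ E] [FiniteDimensional ℝ E]
  {H : Type*} [TopologicalSpace H] {I : ModelWithCorners ℝ E H} [I.Boundaryless]
  {M : Type*} [TopologicalSpace M] [ChartedSpace H M] [IsManifold I ∞ M] [IsManifold I 1 M]
  {m : ℕ} {j : Fin m → ℕ} (r : ℕ)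

/-- The linear projection that forgets the input derivatives `u_i^(p)` with `p ≥ j i`. -/
def forgetChains (j : Fin m → ℕ) : Chains (fun i => j i + r) →L[ℝ] Chains j :=
  ContinuousLinearMap.pi fun c => inputDerivCLM (fun i => j i + r) c.1 c.2

theorem forgetChains_apply (w : Chains (fun i => j i + r)) (c : (i : Fin m) × Fin (j i)) :
    forgetChains r j w c = inputDeriv w c.1 c.2 :=
  inputDerivCLM_apply c.1 c.2 w

theorem forget_eq (q : M × Chains (fun i => j i + r)) :
    forget (j := j) r q = (q.1, forgetChains r j q.2) :=
  Prod.ext rfl (funext fun c => (forgetChains_apply r q.2 c).symm)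

theorem contMDiff_forget : ContMDiff (I.prod 𝓘(ℝ, Chains (fun i => j i + r)))
    (I.prod 𝓘(ℝ, Chains j)) ∞ (forget (M := M) (j := j) r) := by
  have h : ContMDiff (I.prod 𝓘(ℝ, Chains (fun i => j i + r))) (I.prod 𝓘(ℝ, Chains j)) ∞
      (fun q : M × Chains (fun i => j i + r) => (q.1, forgetChains r j q.2)) :=
    contMDiff_fst.prodMk ((forgetChains r j).contMDiff.comp contMDiff_snd)
  exact h.congr fun q => forget_eq r q

/-- The differential of a function pulled back from a lower prolongation. -/
theorem differential_comp_forget {h : M × Chains j → ℝ} {q : M × Chains (fun i => j i + r)}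
    (hh : MDifferentiableAt (I.prod 𝓘(ℝ, Chains j)) 𝓘(ℝ, ℝ) h (forget r q))
    (v : TangentSpace I q.1) (w : Chains (fun i => j i + r)) :
    differential (I.prod 𝓘(ℝ, Chains (fun i => j i + r))) (h ∘ forget r) q (tangentPair I q v w) =
      differential (I.prod 𝓘(ℝ, Chains j)) h (forget r q)
        (tangentPair I (forget r q) v (forgetChains r j w)) := by
  have h1 := (hasMFDerivAt_fst (I := I) (I' := 𝓘(ℝ, Chains (fun i => j i + r))) q).prodMk
    (HasMFDerivAt.comp q (forgetChains r j).hasMFDerivAt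
      (hasMFDerivAt_snd (I := I) (I' := 𝓘(ℝ, Chains (fun i => j i + r))) q))
  have h2 : HasMFDerivAt (I.prod 𝓘(ℝ, Chains (fun i => j i + r))) (I.prod 𝓘(ℝ, Chains j))
      (forget (M := M) (j := j) r) q _ :=
    h1.congr_of_eventuallyEq (Filter.Eventually.of_forall fun q' => forget_eq r q')
  have h3 := HasMFDerivAt.comp q hh.hasMFDerivAt h2
  have h4 : mfderiv (I.prod 𝓘(ℝ, Chains (fun i => j i + r))) 𝓘(ℝ, ℝ) (h ∘ forget r) q = _ :=
    h3.mfderiv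
  rw [differential, h4]
  rfl

variable (g : Fin m → (x : M) → TangentSpace I x)

/-- The drift of a higher prolongation projects to the drift of a lower one up to the inputs. -/
theorem tangentPair_forget_drift (q : M × Chains (fun i => j i + r)) :
    tangentPair I (forget (j := j) r q) (∑ i, inputDeriv q.2 i 0 • g i q.1)
        (forgetChains r j (shiftChains q.2)) =
      ((driftless I g).prolong j).drift (forget r q) +
        ∑ k, inputDeriv q.2 k (j k) • ((driftless I g).prolong j).input k (forget r q) := by
  let B : Fin m → E × Chains j := fun k => ((if j k = 0 then g k q.1 else 0 : E),
    fun c => if c.1 = k ∧ (c.2 : ℕ) + 1 = j c.1 then 1 else 0)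
  let G : Fin m → E := fun k => g k q.1
  show ((∑ i, inputDeriv q.2 i 0 • G i, forgetChains r j (shiftChains q.2)) : E × Chains j) =
    ((0 + ∑ i, inputDeriv (forget (j := j) r q).2 i 0 • G i,
      fun c => inputDeriv (forget (j := j) r q).2 c.1 ((c.2 : ℕ) + 1)) : E × Chains j) +
      ∑ k, inputDeriv q.2 k (j k) • B k
  -- The lower prolongation reads `u_i^(p)` as zero for `p ≥ j i`. What its drift thus omits,
  -- `u_i^(0) g_i` if `j i = 0` or the end of the chain otherwise, is supplied by its input field
  -- with value `u_i^(j i)`.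
  have hfor : ∀ i p, inputDeriv (forget (j := j) r q).2 i p =
      if p < j i then inputDeriv q.2 i p else 0 := by
    intro i p
    conv_lhs => unfold inputDeriv
    split_ifs <;> rfl
  refine Prod.ext ?_ (funext fun c => ?_)
  · simp only [Prod.fst_add, Prod.fst_sum, Prod.smul_fst, zero_add]
    rw [← Finset.sum_add_distrib]
    refine Finset.sum_congr rfl fun i _ => ?_
    rw [hfor]
    show _ = _ + inputDeriv q.2 i (j i) • (if j i = 0 then G i else 0 : E)
    by_cases hi : j i = 0
    · simp [hi]
    · simp [hi, Nat.pos_of_ne_zero hi]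
  · simp only [Prod.snd_add, Prod.snd_sum, Prod.smul_snd, Pi.add_apply, Finset.sum_apply,
      Pi.smul_apply, smul_eq_mul]
    rw [forgetChains_apply, hfor]
    show inputDeriv (shiftChains q.2) c.1 c.2 = _ + ∑ k, inputDeriv q.2 k (j k) *
      (if c.1 = k ∧ (c.2 : ℕ) + 1 = j c.1 then 1 else 0)
    have hc := c.2.2
    have h1 : inputDeriv (shiftChains q.2) c.1 c.2 = inputDeriv q.2 c.1 ((c.2 : ℕ) + 1) := by
      conv_lhs => unfold inputDeriv
      rw [dif_pos (show (c.2 : ℕ) < j c.1 + r by omega)]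
      rfl
    rw [h1, Finset.sum_eq_single c.1]
    · by_cases h : (c.2 : ℕ) + 1 < j c.1
      · rw [if_pos h, if_neg (by omega), mul_zero, add_zero]
      · have h2 : (c.2 : ℕ) + 1 = j c.1 := by omega
        rw [if_neg h, if_pos ⟨rfl, h2⟩, zero_add, mul_one, h2]
    · intro k _ hk
      rw [if_neg (fun h => hk h.1.symm), mul_zero]
    · simp

/-- The higher drift projects to the lower drift plus a combination of the lower input fields; a
function annihilated by these fields sees only the lower drift. -/
theorem lieDeriv_drift_comp_forget {U : Set (M × Chains j)} (hU : IsOpen U)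
    {h : M × Chains j → ℝ} (hh : ContMDiffOn (I.prod 𝓘(ℝ, Chains j)) 𝓘(ℝ, ℝ) ∞ h U)
    (hB : ∀ k, ∀ q ∈ U, lieDeriv (I.prod 𝓘(ℝ, Chains j))
      (((driftless I g).prolong j).input k) h q = 0)
    {q : M × Chains (fun i => j i + r)} (hq : forget r q ∈ U) :
    lieDeriv (I.prod 𝓘(ℝ, Chains (fun i => j i + r)))
        ((driftless I g).prolong (fun i => j i + r)).drift (h ∘ forget r) q =
      lieDeriv (I.prod 𝓘(ℝ, Chains j)) ((driftless I g).prolong j).drift h (forget r q) := by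
  have h1 : ((driftless I g).prolong (fun i => j i + r)).drift q =
      tangentPair I q (∑ i, inputDeriv q.2 i 0 • g i q.1) (shiftChains q.2) := by
    simp only [ControlAffineSystem.prolong, driftless, zero_add]
    rfl
  rw [lieDeriv, h1, differential_comp_forget r (mdifferentiableAt_of_contMDiffOn hU hh hq)]
  refine (congrArg (differential (I.prod 𝓘(ℝ, Chains j)) h (forget r q))
    (tangentPair_forget_drift r g q)).trans ?_
  rw [map_add, map_sum, Finset.sum_eq_zero, add_zero]
  · rfl
  · intro k _
    rw [map_smul]
    have h2 : differential (I.prod 𝓘(ℝ, Chains j)) h (forget r q)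
      (((driftless I g).prolong j).input k (forget r q)) = 0 := hB k _ hq
    rw [h2, smul_zero]

theorem isOpen_forget_preimage {U : Set (M × Chains j)} (hU : IsOpen U) :
    IsOpen (forget (M := M) (j := j) r ⁻¹' U) := by
  have h : Continuous (forget (M := M) (j := j) r) := by
    rw [show forget (M := M) (j := j) r = fun q => (q.1, forgetChains r j q.2) from
      funext (forget_eq r)]
    exact continuous_fst.prodMk ((forgetChains r j).continuous.comp continuous_snd)
  exact hU.preimage h

theorem contMDiffOn_comp_forget {U : Set (M × Chains j)} {h : M × Chains j → ℝ}
    (hh : ContMDiffOn (I.prod 𝓘(ℝ, Chains j)) 𝓘(ℝ, ℝ) ∞ h U) :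
    ContMDiffOn (I.prod 𝓘(ℝ, Chains (fun i => j i + r))) 𝓘(ℝ, ℝ) ∞ (h ∘ forget r)
      (forget (M := M) (j := j) r ⁻¹' U) :=
  hh.comp (contMDiff_forget r).contMDiffOn fun _ hq => hq

/-- The first time derivatives of a function annihilated by the inputs descend to the lower
prolongation. -/
theorem timeDeriv_eq_of_input_eq_zero (hg : ∀ i, SmoothFieldOn I (g i) Set.univ)
    {U : Set (M × Chains j)} (hU : IsOpen U)
    {h : M × Chains j → ℝ} (hh : ContMDiffOn (I.prod 𝓘(ℝ, Chains j)) 𝓘(ℝ, ℝ) ∞ h U) {t : ℕ}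
    (hB : ∀ k, ∀ s < t, ∀ q ∈ U, lieDeriv (I.prod 𝓘(ℝ, Chains j))
      (((driftless I g).prolong j).input k)
      ((lieDeriv (I.prod 𝓘(ℝ, Chains j)) ((driftless I g).prolong j).drift)^[s] h) q = 0)
    {q : M × Chains (fun i => j i + r)} (hq : forget r q ∈ U) :
    timeDeriv (driftless I g) h r t q =
      (lieDeriv (I.prod 𝓘(ℝ, Chains j)) ((driftless I g).prolong j).drift)^[t] h
        (forget r q) := by
  induction t generalizing q with
  | zero => rfl
  | succ t ih =>
    rw [timeDeriv, Function.iterate_succ_apply']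
    refine (lieDeriv_congr (h' := (lieDeriv (I.prod 𝓘(ℝ, Chains j))
      ((driftless I g).prolong j).drift)^[t] h ∘ forget r) (isOpen_forget_preimage r hU)
      (fun q' hq' => ih (fun k s hs => hB k s (by omega)) hq') _ hq).trans ?_
    rw [lieDeriv_drift_comp_forget r g hU (contMDiffOn_iterate_lieDeriv_drift g hg hU hh t)
      (fun k => hB k t (by omega)) hq, Function.iterate_succ_apply']

/-- Derivatives along the tower of input `k` of a function that descends: the coordinate fields of
the forgotten input derivatives annihilate it, the next field projects to the input field. -/
theorem lieDeriv_tower_comp_forget (k : Fin m) {τ : ℕ} (hτ : τ ≤ r) (h : M × Chains j → ℝ)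
    {q : M × Chains (fun i => j i + r)}
    (hh : MDifferentiableAt (I.prod 𝓘(ℝ, Chains j)) 𝓘(ℝ, ℝ) h (forget r q)) :
    lieDeriv (I.prod 𝓘(ℝ, Chains (fun i => j i + r))) (tower g (fun i => j i + r) k τ)
      (h ∘ forget r) q =
      if τ = r then lieDeriv (I.prod 𝓘(ℝ, Chains j)) (((driftless I g).prolong j).input k) h
        (forget r q) else 0 := by
  unfold tower liftField
  rw [lieDeriv, differential_comp_forget r hh]
  have hcoord : ∀ c : (i : Fin m) × Fin (j i), forgetChains r j
      (fun c => if c.1 = k ∧ (c.2 : ℕ) + τ + 1 = j c.1 + r then 1 else 0) c =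
      if c.1 = k ∧ (c.2 : ℕ) + τ + 1 = j c.1 + r then 1 else 0 := by
    intro c
    have := c.2.2
    rw [forgetChains_apply]
    unfold inputDeriv
    rw [dif_pos (show (c.2 : ℕ) < j c.1 + r by omega)]
  beta_reduce
  split_ifs with h1 h2 h2
  · subst h2
    rw [lieDeriv, prolong_input]
    unfold tower
    congr 1
    refine Prod.ext ?_ (funext fun c => (hcoord c).trans ?_)
    · show g k q.1 = (if j k ≤ 0 then g k else 0) q.1
      rw [if_pos (by omega)]
    · congr 1
      simp only [eq_iff_iff]
      omega
  · omega
  · subst h2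
    rw [lieDeriv, prolong_input]
    unfold tower
    congr 1
    refine Prod.ext ?_ (funext fun c => (hcoord c).trans ?_)
    · show (0 : E) = (if j k ≤ 0 then g k else 0) q.1
      rw [if_neg (by omega)]
      rfl
    · congr 1
      simp only [eq_iff_iff]
      omega
  · have h3 : tangentPair I (forget (j := j) r q) ((0 : (x : M) → TangentSpace I x) q.1)
        (forgetChains r j
          (fun c => if c.1 = k ∧ (c.2 : ℕ) + τ + 1 = j c.1 + r then 1 else 0)) = 0 := by
      refine Prod.ext rfl (funext fun c => (hcoord c).trans ?_)
      have := c.2.2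
      rw [if_neg (by omega)]
      rfl
    rw [h3, map_zero]

end Forget

/-! ### Independence of all time derivatives of a Brunovský output -/

section DifferentialIndependence

set_option linter.unusedSectionVars false

variable {E : Type*} [NormedAddCommGroup E] [NormedSpace ℝ E] [FiniteDimensional ℝ E]
  {H : Type*} [TopologicalSpace H] {I : ModelWithCorners ℝ E H} [I.Boundaryless]
  {M : Type*} [TopologicalSpace M] [ChartedSpace H M] [IsManifold I ∞ M] [IsManifold I 1 M]
  {m : ℕ} {j : Fin m → ℕ} (r : ℕ)

/-- A family of input derivatives extended by zero. -/
def extendChains (w : Chains j) : Chains (fun i => j i + r) := fun c => inputDeriv w c.1 c.2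

theorem forgetChains_extendChains (w : Chains j) : forgetChains r j (extendChains r w) = w := by
  funext c
  have hc := c.2.2
  rw [forgetChains_apply, inputDeriv, dif_pos (show (c.2 : ℕ) < j c.1 + r by omega), extendChains,
    inputDeriv, dif_pos hc]

variable {g : Fin m → (x : M) → TangentSpace I x} {p : M × Chains j}

theorem timeDeriv_congr {U : Set (M × Chains j)} (hU : IsOpen U) {h h' : M × Chains j → ℝ}
    (heq : ∀ q ∈ U, h q = h' q) (t : ℕ) {q : M × Chains (fun i => j i + r)}
    (hq : forget r q ∈ U) :
    timeDeriv (driftless I g) h r t q = timeDeriv (driftless I g) h' r t q := by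
  induction t generalizing q with
  | zero => exact heq _ hq
  | succ t ih =>
    rw [timeDeriv, timeDeriv, Function.iterate_succ_apply', Function.iterate_succ_apply']
    exact lieDeriv_congr (isOpen_forget_preimage r hU) (fun q' hq' => ih hq') _ hq

namespace BrunovskyLinearization

variable (L : BrunovskyLinearization ((driftless I g).prolong j) p)

theorem timeDeriv_output (hg : ∀ i, SmoothFieldOn I (g i) Set.univ) (i : Fin m) {t : ℕ}
    (ht : t < L.κ i) {q : M × Chains (fun i => j i + r)} (hq : forget r q ∈ L.φ.source) :
    timeDeriv (driftless I g) (L.output i) r t q = L.coord ⟨i, ⟨t, ht⟩⟩ (forget r q) := by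
  rw [timeDeriv_eq_of_input_eq_zero r g hg L.φ.open_source (L.contMDiffOn_output i)
    (fun k s hs q hq => L.lieDeriv_input_iterate_output i (by omega) hq k) hq]
  exact L.iterate_lieDeriv_output i ht hq

theorem contMDiffOn_timeDeriv_output (hg : ∀ i, SmoothFieldOn I (g i) Set.univ) (i : Fin m)
    (t : ℕ) : ContMDiffOn (I.prod 𝓘(ℝ, Chains (fun i => j i + r))) 𝓘(ℝ, ℝ) ∞
      (timeDeriv (driftless I g) (L.output i) r t) (forget r ⁻¹' L.φ.source) :=
  contMDiffOn_iterate_lieDeriv_drift g hg (isOpen_forget_preimage r L.φ.open_source)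
    (contMDiffOn_comp_forget r (L.contMDiffOn_output i)) t

/-- The derivatives of the time derivatives of the outputs along the new inputs. -/
theorem lieDeriv_tower_timeDeriv_output (hg : ∀ i, SmoothFieldOn I (g i) Set.univ) (i k : Fin m)
    {t τ : ℕ} (hτ : τ ≤ r) (ht : t + τ + 1 ≤ L.κ i + r)
    {q : M × Chains (fun i => j i + r)} (hq : forget r q ∈ L.φ.source) :
    lieDeriv (I.prod 𝓘(ℝ, Chains (fun i => j i + r))) (tower g (fun i => j i + r) k τ)
        (timeDeriv (driftless I g) (L.output i) r t) q =
      if t + τ + 1 = L.κ i + r then differential (I.prod 𝓘(ℝ, Chains j)) (L.coord (L.last i))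
        (forget r q) (((driftless I g).prolong j).input k (forget r q)) else 0 := by
  have hopen := isOpen_forget_preimage r L.φ.open_source
  have hcoord : ∀ (t : ℕ) (ht : t < L.κ i) (τ : ℕ), τ ≤ r →
      ∀ q : M × Chains (fun i => j i + r), forget r q ∈ L.φ.source →
      lieDeriv (I.prod 𝓘(ℝ, Chains (fun i => j i + r))) (tower g (fun i => j i + r) k τ)
        (timeDeriv (driftless I g) (L.output i) r t) q =
      if τ = r then lieDeriv (I.prod 𝓘(ℝ, Chains j)) (((driftless I g).prolong j).input k)
        (L.coord ⟨i, ⟨t, ht⟩⟩) (forget r q) else 0 := by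
    intro t ht τ hτ q hq
    rw [← lieDeriv_tower_comp_forget r g k hτ _ (mdifferentiableAt_of_contMDiffOn L.φ.open_source
      (L.contMDiffOn_coord _) hq)]
    exact lieDeriv_congr hopen (fun q' hq' => L.timeDeriv_output r hg i ht hq') _ hq
  induction t generalizing τ q with
  | zero =>
    have := L.κ_pos i
    rw [hcoord 0 this τ hτ q hq]
    split_ifs with h1 h2 h2
    · rw [lieDeriv]
      congr 3
      simp only [last]
      congr 1
      exact Fin.ext (by simp only; omega)
    · exact L.differential_coord_input_eq_zero ⟨i, ⟨0, _⟩⟩ (by simp only; omega) hq k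
    · omega
    · rfl
  | succ t ih =>
    -- If `τ = r`, the bound on the order gives `t + 1 < κ i`, so the derivative is still a chain
    -- coordinate pulled back. If `τ < r`, the commutator with the drift exchanges one time
    -- derivative for one step up the tower, and the remaining term vanishes because its order is
    -- strictly below the threshold.
    rcases hτ.eq_or_lt with rfl | hτ'
    · rw [hcoord (t + 1) (by omega) τ le_rfl q hq, if_pos rfl]
      split_ifs with h
      · rw [lieDeriv]
        congr 3
        simp only [last]
        congr 1
        exact Fin.ext (by simp only; omega)
      · exact L.differential_coord_input_eq_zero ⟨i, ⟨t + 1, _⟩⟩ (by simp only; omega) hq k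
    · have h1 := lieDeriv_tower_drift g hg (j := fun i => j i + r)
        (show τ < (fun i => j i + r) k by simp only; omega) hopen
        (L.contMDiffOn_timeDeriv_output r hg i t) hq
      rw [lieDeriv_eq_zero_of_eq_zero (h := lieDeriv (I.prod 𝓘(ℝ, Chains (fun i => j i + r)))
        (tower g (fun i => j i + r) k τ) (timeDeriv (driftless I g) (L.output i) r t)) hopen
        (fun q' hq' => by rw [ih hτ (by omega) hq', if_neg (by omega)]) _ hq, zero_add,
        ih hτ' (by omega) hq] at h1
      rw [timeDeriv, Function.iterate_succ_apply']
      refine h1.trans ?_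
      congr 1
      simp only [eq_iff_iff]
      omega

/-- Flat outputs are differentially independent. -/
theorem differentiallyIndependentAt_output (hg : ∀ i, SmoothFieldOn I (g i) Set.univ) :
    DifferentiallyIndependentAt (driftless I g) L.output p := by
  intro r q hqp
  have hq : forget r q ∈ L.φ.source := hqp ▸ L.mem_source
  rw [Fintype.linearIndependent_iff]
  intro c hc
  -- Coefficients extended by zero beyond order `r`, so that the cutoffs `r` and `κ i` can be
  -- compared freely.
  set c' : Fin m → ℕ → ℝ := fun i t => if h : t < r + 1 then c (i, ⟨t, h⟩) else 0 with hc'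
  have hc'c : ∀ i (t : Fin (r + 1)), c' i t = c (i, t) := fun i t => by
    simp only [hc', dif_pos t.2]
  have hc'0 : ∀ i t, r < t → c' i t = 0 := fun i t ht => by
    simp only [hc', dif_neg (show ¬ t < r + 1 by omega)]
  have hsum : ∀ v : TangentSpace (I.prod 𝓘(ℝ, Chains (fun i => j i + r))) q,
      ∑ i, ∑ t ∈ Finset.range (r + 1), c' i t *
        differential (I.prod 𝓘(ℝ, Chains (fun i => j i + r)))
          (timeDeriv (driftless I g) (L.output i) r t) q v = 0 := by
    intro v
    have h1 := congrArg (fun A : TangentSpace (I.prod 𝓘(ℝ, Chains (fun i => j i + r))) q →L[ℝ] ℝ =>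
      A v) hc
    simp only [sum_apply, smul_apply, smul_eq_mul] at h1
    rw [Fintype.sum_prod_type] at h1
    refine Eq.trans (Finset.sum_congr rfl fun i _ => ?_) h1
    rw [Finset.sum_range]
    exact Finset.sum_congr rfl fun t _ => by rw [hc'c]
  -- Elimination from the highest derivatives downwards. Evaluated on step `e` of the tower of input
  -- `k`, the relation retains only the orders `κ i + (r - (e + 1))`: higher ones already have zero
  -- coefficients, lower ones are annihilated. Letting `k` vary leaves a row vector annihilated by
  -- the invertible matrix of the inputs on the chain ends.
  have hhigh : ∀ e ≤ r, ∀ i t, L.κ i + (r - e) ≤ t → c' i t = 0 := by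
    intro e
    induction e with
    | zero =>
      intro _ i t ht
      have := L.κ_pos i
      exact hc'0 i t (by omega)
    | succ e ih =>
      intro he
      have key : (fun i => c' i (L.κ i + (r - (e + 1)))) = 0 := by
        refine L.vecMul_differential_last_injective hq _ fun k => ?_
        refine Eq.trans (Finset.sum_congr rfl fun i _ => ?_)
          (hsum (tower g (fun i => j i + r) k e q))
        symm
        have hval : ∀ t, c' i t * differential (I.prod 𝓘(ℝ, Chains (fun i => j i + r)))
            (timeDeriv (driftless I g) (L.output i) r t) q (tower g (fun i => j i + r) k e q) =
            if t = L.κ i + (r - (e + 1)) then c' i (L.κ i + (r - (e + 1))) *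
              differential (I.prod 𝓘(ℝ, Chains j)) (L.coord (L.last i)) (forget r q)
                (((driftless I g).prolong j).input k (forget r q)) else 0 := by
          intro t
          by_cases ht : L.κ i + (r - e) ≤ t
          · rw [ih (by omega) i t ht, zero_mul, if_neg (by omega)]
          · have h2 := L.lieDeriv_tower_timeDeriv_output r hg i k (t := t) (τ := e) (by omega)
              (by omega) hq
            rw [lieDeriv] at h2
            rw [h2]
            by_cases h3 : t = L.κ i + (r - (e + 1))
            · rw [if_pos (by omega), if_pos h3, h3]
            · rw [if_neg (by omega), if_neg h3, mul_zero]
        rw [Finset.sum_congr rfl fun t _ => hval t, Finset.sum_ite_eq']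
        split_ifs with h4
        · rfl
        · rw [hc'0 i _ (by simpa using h4), zero_mul]
      intro i t ht
      rcases ht.eq_or_lt with h1 | h1
      · rw [← h1]
        exact congrFun key i
      · exact ih (by omega) i t (by omega)
  have hlow : ∀ i t, L.κ i ≤ t → c' i t = 0 := fun i t ht => hhigh r le_rfl i t (by omega)
  -- Only orders `t < κ i` remain. There the time derivatives are pullbacks of the chain
  -- coordinates, whose differentials are independent; each tangent vector below is lifted by
  -- extending its input components by zero.
  have hβ := Fintype.linearIndependent_iff.1 (L.linearIndependent_differential_coord hq)
    (fun a => c' a.1 a.2) (by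
      refine ContinuousLinearMap.ext fun u => ?_
      obtain ⟨v, w, rfl⟩ := exists_eq_tangentPair u
      rw [sum_apply, Fintype.sum_sigma]
      refine Eq.trans (Finset.sum_congr rfl fun i _ => ?_)
        (hsum (tangentPair I q v (extendChains r w)))
      have h1 : ∀ t : Fin (L.κ i), (c' i t • differential (I.prod 𝓘(ℝ, Chains j))
          (L.coord ⟨i, t⟩) (forget r q)) (tangentPair I (forget r q) v w) =
          c' i t * differential (I.prod 𝓘(ℝ, Chains (fun i => j i + r)))
            (timeDeriv (driftless I g) (L.output i) r t) q
            (tangentPair I q v (extendChains r w)) := by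
        intro t
        rw [smul_apply, smul_eq_mul]
        congr 1
        rw [differential_congr (h' := L.coord ⟨i, t⟩ ∘ forget r)
          (isOpen_forget_preimage r L.φ.open_source)
          (fun q' hq' => L.timeDeriv_output r hg i t.2 hq') hq]
        have h5 := differential_comp_forget r (mdifferentiableAt_of_contMDiffOn L.φ.open_source
          (L.contMDiffOn_coord ⟨i, t⟩) hq) v (extendChains r w)
        rw [forgetChains_extendChains] at h5
        exact h5.symm
      rw [Finset.sum_congr rfl fun t _ => h1 t, ← Finset.sum_range (fun t : ℕ => c' i t *
        differential (I.prod 𝓘(ℝ, Chains (fun i => j i + r)))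
            (timeDeriv (driftless I g) (L.output i) r t) q
            (tangentPair I q v (extendChains r w)))]
      rcases le_total (L.κ i) (r + 1) with h2 | h2
      · refine Finset.sum_subset (Finset.range_mono h2) fun t _ ht => ?_
        rw [hlow i t (by simpa using ht), zero_mul]
      · refine (Finset.sum_subset (Finset.range_mono h2) fun t _ ht => ?_).symm
        rw [hc'0 i t (by simpa [Nat.succ_le_iff] using ht), zero_mul])
  rintro ⟨i, t⟩
  rw [← hc'c]
  by_cases ht : (t : ℕ) < L.κ i
  · exact hβ ⟨i, ⟨t, ht⟩⟩
  · exact hlow i t (by omega)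

end BrunovskyLinearization

end DifferentialIndependence

/-! ### Flat outputs with `2m` states -/

section Even

theorem card_add_card_le_of_forall_apply_eq_zero {V ι ι' : Type*} [NormedAddCommGroup V]
    [NormedSpace ℝ V] [FiniteDimensional ℝ V] [Fintype ι] [Fintype ι'] {θ : ι → V →L[ℝ] ℝ}
    {b : ι' → V} (hθ : LinearIndependent ℝ θ) (hb : LinearIndependent ℝ b)
    (hθb : ∀ i k, θ i (b k) = 0) :
    Fintype.card ι + Fintype.card ι' ≤ Module.finrank ℝ V := by
  set θ' : ι → Module.Dual ℝ V := fun i => (θ i : V →ₗ[ℝ] ℝ) with hθ'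
  have hθ'i : LinearIndependent ℝ θ' :=
    hθ.map' (ContinuousLinearMap.coeLM ℝ) (LinearMap.ker_eq_bot.2 fun _ _ h =>
      ContinuousLinearMap.coe_injective h)
  have hle : Submodule.span ℝ (Set.range θ') ≤
      (Submodule.span ℝ (Set.range b)).dualAnnihilator := by
    rw [Submodule.span_le]
    rintro _ ⟨i, rfl⟩
    refine (Submodule.mem_dualAnnihilator _).2 fun w hw => ?_
    have : Submodule.span ℝ (Set.range b) ≤ LinearMap.ker (θ' i) := by
      rw [Submodule.span_le]
      rintro _ ⟨k, rfl⟩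
      exact hθb i k
    exact this hw
  have h1 := Submodule.finrank_mono hle
  rw [finrank_span_eq_card hθ'i] at h1
  have h2 := Subspace.finrank_add_finrank_dualAnnihilator_eq (Submodule.span ℝ (Set.range b))
  rw [finrank_span_eq_card hb] at h2
  omega

set_option linter.unusedSectionVars false

variable {E : Type} [NormedAddCommGroup E] [NormedSpace ℝ E] [FiniteDimensional ℝ E]
  {H : Type*} [TopologicalSpace H] {I : ModelWithCorners ℝ E H} [I.Boundaryless]
  {M : Type*} [TopologicalSpace M] [ChartedSpace H M] [IsManifold I ∞ M] [IsManifold I 1 M]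
  {m : ℕ} {g : Fin m → (x : M) → TangentSpace I x} {l : Fin m}

theorem card_fin_lt_two (hm : 2 ≤ m) : Fintype.card {i : Fin m // (i : ℕ) < 2} = 2 := by
  rw [Fintype.card_congr (⟨fun i => ⟨i.1, i.2⟩, fun i => ⟨⟨i, by omega⟩, i.2⟩, fun _ => rfl,
    fun _ => rfl⟩ : {i : Fin m // (i : ℕ) < 2} ≃ Fin 2), Fintype.card_fin]

theorem H02_le_H12 (x : M) : H02 I g l x ≤ H12 I g l x := le_sup_left

theorem mlieBracket_mem_H12_of_ne {k : Fin m} (hk : k ≠ l) (x : M) :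
    VectorField.mlieBracket I (g k) (g l) x ∈ H12 I g l x := by
  rw [VectorField.mlieBracket_swap_apply]
  exact Submodule.neg_mem _ (Submodule.mem_sup_right (Submodule.subset_span ⟨k, hk, rfl⟩))

/-- The input fields are the `g k` for `k ≠ l` and, since the order at `l` is 2, the coordinate
field of `u_l^(1)`, whose component along `u_l^(0)` is zero. -/
theorem lieDeriv_tower_of_annihilates_H02 {h : M × Chains (Pi.single l 2 : Fin m → ℕ) → ℝ}
    {q : M × Chains (Pi.single l 2 : Fin m → ℕ)}
    (hh : ∀ w ∈ H02 I g l q.1, ∀ ν : Chains (Pi.single l 2 : Fin m → ℕ),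
      (∀ i, inputDeriv ν i 0 = 0) →
      differential (I.prod 𝓘(ℝ, Chains (Pi.single l 2))) h q (tangentPair I q w ν) = 0)
    (k : Fin m) :
    lieDeriv (I.prod 𝓘(ℝ, Chains (Pi.single l 2))) (tower g (Pi.single l 2) k 0) h q = 0 := by
  rw [lieDeriv]
  by_cases hk : k = l
  · subst hk
    unfold tower liftField
    rw [if_neg (by simp)]
    refine hh _ (Submodule.zero_mem _) _ fun i => ?_
    unfold inputDeriv
    split_ifs with h1
    · show (if i = k ∧ 0 + 0 + 1 = (Pi.single k 2 : Fin m → ℕ) i then (1 : ℝ) else 0) = 0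
      rw [if_neg]
      rintro ⟨rfl, h4⟩
      simp at h4
    · rfl
  · rw [tower_of_ne hk]
    refine hh _ (Submodule.subset_span ⟨k, hk, rfl⟩) _ fun i => ?_
    unfold inputDeriv
    split_ifs <;> rfl

/-- The bracket for `k ≠ l` is `u_l [g k, g l]`, horizontal with values in `H12`; the one for `k =
l` is vertical. -/
theorem differential_bracketInput_of_annihilates_H12
    {h : M × Chains (Pi.single l 2 : Fin m → ℕ) → ℝ}
    {q : M × Chains (Pi.single l 2 : Fin m → ℕ)}
    (hh : ∀ w ∈ H12 I g l q.1, ∀ ν : Chains (Pi.single l 2 : Fin m → ℕ),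
      differential (I.prod 𝓘(ℝ, Chains (Pi.single l 2))) h q (tangentPair I q w ν) = 0)
    (k : Fin m) :
    differential (I.prod 𝓘(ℝ, Chains (Pi.single l 2))) h q
      (bracketInput g (Pi.single l 2) k q) = 0 := by
  by_cases hk : k = l
  · subst hk
    rw [bracketInput_self two_pos]
    unfold tower liftField
    rw [if_neg (by simp)]
    exact hh _ (Submodule.zero_mem _) _
  · rw [bracketInput_of_ne hk]
    exact hh _ (Submodule.smul_mem _ _ (mlieBracket_mem_H12_of_ne hk q.1)) _

/-- Two functions with chains of length three and `m - 2` functions with chains of length two are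
flat outputs if their lower time derivatives are independent. -/
theorem isFlatOutputAt_of_annihilates (hg : ∀ i, SmoothFieldOn I (g i) Set.univ)
    (hn : Module.finrank ℝ E = 2 * m)
    (hrank : ∀ x, Module.finrank ℝ (H12 I g l x) = 2 * m - 2)
    {p : M × Chains (Pi.single l 2 : Fin m → ℕ)} (hu : inputDeriv p.2 l 0 ≠ 0)
    {y : Fin m → M × Chains (Pi.single l 2 : Fin m → ℕ) → ℝ} (T : Fin m → Prop) [DecidablePred T]
    (hT : Fintype.card {i // T i} = 2)
    (hys : ∀ i, SmoothNear (I.prod 𝓘(ℝ, Chains (Pi.single l 2))) (y i) p)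
    (hT1 : ∀ i, T i → InputFreeAnnihilates (H12 I g l) (y i) p)
    (hT0 : ∀ i, ¬ T i → DerivFreeAnnihilates (H02 I g l) (y i) p)
    (hlow : LinearIndependent ℝ fun c : {c : Fin m × Fin 2 // T c.1 ∨ c.2 = 0} =>
      differential (I.prod 𝓘(ℝ, Chains (Pi.single l 2)))
        ((lieDeriv (I.prod 𝓘(ℝ, Chains (Pi.single l 2)))
          ((driftless I g).prolong (Pi.single l 2)).drift)^[c.1.2] (y c.1.1)) p) :
    IsFlatOutputAt (driftless I g) (Pi.single l 2) p y := by
  obtain ⟨U, hU, hpU, hyU⟩ := exists_isOpen_forall_contMDiffOn hys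
  obtain ⟨U₁, hU₁ann, hU₁, hpU₁⟩ := eventually_nhds_iff.1
    (Filter.eventually_all.2 fun i => Filter.eventually_imp_distrib_left.2 (hT1 i))
  obtain ⟨U₀, hU₀ann, hU₀, hpU₀⟩ := eventually_nhds_iff.1
    (Filter.eventually_all.2 fun i => Filter.eventually_imp_distrib_left.2 (hT0 i))
  have hW : IsOpen (U ∩ (U₁ ∩ U₀)) := hU.inter (hU₁.inter hU₀)
  have hyW : ∀ i, ContMDiffOn (I.prod 𝓘(ℝ, Chains (Pi.single l 2))) 𝓘(ℝ, ℝ) ∞ (y i)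
      (U ∩ (U₁ ∩ U₀)) := fun i => (hyU i).mono Set.inter_subset_left
  have hB0 : ∀ i k, ∀ q ∈ U ∩ (U₁ ∩ U₀), lieDeriv (I.prod 𝓘(ℝ, Chains (Pi.single l 2)))
      (tower g (Pi.single l 2) k 0) (y i) q = 0 := by
    intro i k q hq
    by_cases hi : T i
    · exact lieDeriv_tower_of_annihilates_H02
        (fun w hw ν _ => hU₁ann q hq.2.1 i hi w (H02_le_H12 _ hw) ν) k
    · exact lieDeriv_tower_of_annihilates_H02 (fun w hw ν hν => hU₀ann q hq.2.2 i hi w hw ν hν) k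
  -- Lengths 3 on the two members of `T` and 2 elsewhere add up to `2m + 2`, the dimension of the
  -- prolonged state. The lower derivatives are all the `y i` and the first derivatives of the
  -- members of `T`.
  refine isFlatOutputAt_of_linearIndependent g hg (κ := fun i => if T i then 3 else 2)
    (fun i => by split_ifs <;> norm_num) hW ⟨hpU, hpU₁, hpU₀⟩ hyW ?_ ?_ ?_
    (linearIndependent_tower_bracketInput_two hu (linearIndependent_bracketFamily g l (hrank p.1)))
  · intro i k t ht q hq
    rcases t with _ | t
    · exact hB0 i k q hq
    · have hi : T i := by
        by_contra hi
        simp only [if_neg hi] at ht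
        omega
      simp only [if_pos hi] at ht
      obtain rfl : t = 0 := by omega
      refine (lieDeriv_tower_zero_drift g hg k hW (hyW i) hq).trans ?_
      rw [lieDeriv_eq_zero_of_eq_zero (h := lieDeriv (I.prod 𝓘(ℝ, Chains (Pi.single l 2)))
        (tower g (Pi.single l 2) k 0) (y i)) hW (hB0 i k) _ hq, zero_add]
      exact differential_bracketInput_of_annihilates_H12
        (fun w hw ν => hU₁ann q hq.2.1 i hi w hw ν) k
  · rw [sum_single, hn]
    have h1 : ∀ i, (if T i then 3 else 2) = 2 + if T i then 1 else 0 := fun i => by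
      split_ifs <;> rfl
    simp only [h1, Finset.sum_add_distrib, Finset.sum_const, Finset.card_univ, Fintype.card_fin,
      smul_eq_mul, Finset.sum_boole, ← Fintype.card_subtype, hT]
    norm_num
    ring
  · have hlt : ∀ c : {c : (i : Fin m) × Fin (if T i then 3 else 2) //
        (c.2 : ℕ) + 1 < if T c.1 then 3 else 2}, (c.1.2 : ℕ) < 2 ∧ (T c.1.1 ∨ (c.1.2 : ℕ) = 0) := by
      intro c
      have h1 := c.2
      by_cases hc : T c.1.1
      · simp only [if_pos hc] at h1
        exact ⟨by omega, Or.inl hc⟩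
      · simp only [if_neg hc] at h1
        exact ⟨by omega, Or.inr (by omega)⟩
    exact hlow.comp (fun c : {c : (i : Fin m) × Fin (if T i then 3 else 2) //
        (c.2 : ℕ) + 1 < if T c.1 then 3 else 2} =>
      (⟨(c.1.1, ⟨c.1.2, (hlt c).1⟩), (hlt c).2.imp_right fun h => Fin.ext h⟩ :
        {c : Fin m × Fin 2 // T c.1 ∨ c.2 = 0})) (by
      rintro ⟨⟨i, t⟩, ht⟩ ⟨⟨i', t'⟩, ht'⟩ h
      simp only [Subtype.mk.injEq, Prod.mk.injEq, Fin.mk.injEq] at h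
      obtain ⟨rfl, h⟩ := h
      obtain rfl : t = t' := Fin.ext h
      rfl)

/-- Differential independence is needed only for first derivatives, `r = 1`. It is stated on a
further prolongation, but the derivatives in question, of the outputs annihilated by `H12`, descend
to order `(0, …, 0, 2)` since the inputs annihilate those outputs; a relation below then pulls back
to one above. -/
theorem isFlatOutputAt_of_outputEquationsEven (hm : 2 ≤ m)
    (hg : ∀ i, SmoothFieldOn I (g i) Set.univ)
    (hn : Module.finrank ℝ E = 2 * m)
    (hrank : ∀ x, Module.finrank ℝ (H12 I g l x) = 2 * m - 2)
    {p : M × Chains (Pi.single l 2 : Fin m → ℕ)} (hu : inputDeriv p.2 l 0 ≠ 0)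
    {y : Fin m → M × Chains (Pi.single l 2 : Fin m → ℕ) → ℝ} (σ : Equiv.Perm (Fin m))
    (hy : OutputEquationsEven g l (y ∘ σ) p) :
    IsFlatOutputAt (driftless I g) (Pi.single l 2) p y := by
  obtain ⟨hys, hann1, hann0, hdi⟩ := hy
  have hσ : ∀ i, (y ∘ σ) (σ.symm i) = y i := fun i => by simp
  have hys' : ∀ i, SmoothNear (I.prod 𝓘(ℝ, Chains (Pi.single l 2))) (y i) p := fun i =>
    hσ i ▸ hys (σ.symm i)
  have hT1 : ∀ i, (σ.symm i : ℕ) < 2 → InputFreeAnnihilates (H12 I g l) (y i) p := fun i hi =>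
    hσ i ▸ hann1 (σ.symm i) hi
  refine isFlatOutputAt_of_annihilates hg hn hrank hu (fun i => (σ.symm i : ℕ) < 2) ?_ hys'
    hT1 (fun i hi => hσ i ▸ hann0 (σ.symm i) (not_lt.1 hi)) ?_
  · have h1 : Fintype.card {i : Fin m // (σ.symm i : ℕ) < 2} =
        Fintype.card {i : Fin m // (i : ℕ) < 2} :=
      Fintype.card_congr (σ.symm.subtypeEquiv fun _ => Iff.rfl)
    rw [h1]
    exact card_fin_lt_two hm
  · obtain ⟨q, hqp⟩ : ∃ q, forget (M := M) (j := (Pi.single l 2 : Fin m → ℕ)) 1 q = p :=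
      ⟨(p.1, extendChains 1 p.2), by rw [forget_eq, forgetChains_extendChains]⟩
    have h := (hdi 1 q hqp).comp
      (fun c : {c : Fin m × Fin 2 // (σ.symm c.1 : ℕ) < 2 ∨ c.2 = 0} => (σ.symm c.1.1, c.1.2)) (by
        rintro ⟨⟨i, t⟩, _⟩ ⟨⟨i', t'⟩, _⟩ h
        simpa using h)
    rw [Fintype.linearIndependent_iff] at h ⊢
    intro c hc
    refine h c (ContinuousLinearMap.ext fun u => ?_)
    obtain ⟨v, w, rfl⟩ := exists_eq_tangentPair u
    subst hqp
    have hc' := congrArg (fun A : TangentSpace (I.prod 𝓘(ℝ, Chains (Pi.single l 2)))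
      (forget (j := (Pi.single l 2 : Fin m → ℕ)) 1 q) →L[ℝ] ℝ =>
        A (tangentPair I (forget 1 q) v (forgetChains 1 _ w))) hc
    simp only [sum_apply, smul_apply] at hc'
    rw [sum_apply]
    refine Eq.trans (Finset.sum_congr rfl fun a _ => ?_) hc'
    rw [smul_apply]
    congr 1
    obtain ⟨⟨i, t⟩, hit⟩ := a
    simp only [Function.comp_apply, Equiv.apply_symm_apply] at hit ⊢
    obtain ⟨U, hU, hpU, hyU⟩ := hys' i
    by_cases ht : t = 0
    · subst ht
      exact differential_comp_forget 1 (mdifferentiableAt_of_contMDiffOn hU hyU hpU) v w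
    · obtain rfl : t = 1 := by omega
      have hi : (σ.symm i : ℕ) < 2 := hit.resolve_right ht
      obtain ⟨U₁, hU₁ann, hU₁, hpU₁⟩ := eventually_nhds_iff.1 (hT1 i hi)
      have hW := hU.inter hU₁
      have hyW := hyU.mono (Set.inter_subset_left (t := U₁))
      have hFW := contMDiffOn_iterate_lieDeriv_drift g hg hW hyW 1
      have h5 : differential (I.prod 𝓘(ℝ, Chains (fun i => (Pi.single l 2 : Fin m → ℕ) i + 1)))
          (timeDeriv (driftless I g) (y i) 1 1) q =
          differential (I.prod 𝓘(ℝ, Chains (fun i => (Pi.single l 2 : Fin m → ℕ) i + 1)))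
            ((lieDeriv (I.prod 𝓘(ℝ, Chains (Pi.single l 2)))
              ((driftless I g).prolong (Pi.single l 2)).drift)^[1] (y i) ∘ forget 1) q :=
        differential_congr (isOpen_forget_preimage 1 hW)
        (fun q' hq' => timeDeriv_eq_of_input_eq_zero 1 g hg hW hyW (t := 1)
          (fun k s hs q'' hq'' => by
            obtain rfl : s = 0 := by omega
            rw [prolong_input]
            exact lieDeriv_tower_of_annihilates_H02
              (fun w hw ν _ => hU₁ann q'' hq''.2 w (H02_le_H12 _ hw) ν) k) hq') ⟨hpU, hpU₁⟩
      refine (congrArg (fun A : TangentSpace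
        (I.prod 𝓘(ℝ, Chains (fun i => (Pi.single l 2 : Fin m → ℕ) i + 1))) q →L[ℝ] ℝ =>
        A (tangentPair I q v w)) h5).trans ?_
      exact differential_comp_forget 1
        (mdifferentiableAt_of_contMDiffOn hW hFW ⟨hpU, hpU₁⟩) v w

end Even

/-! ### From flat outputs to the equations, with `2m` states -/

section Even

set_option linter.unusedSectionVars false

variable {E : Type} [NormedAddCommGroup E] [NormedSpace ℝ E] [FiniteDimensional ℝ E]
  {H : Type*} [TopologicalSpace H] {I : ModelWithCorners ℝ E H} [I.Boundaryless]
  {M : Type*} [TopologicalSpace M] [ChartedSpace H M] [IsManifold I ∞ M] [IsManifold I 1 M]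
  {m : ℕ} {g : Fin m → (x : M) → TangentSpace I x} {l : Fin m}

theorem isOpen_inputDeriv_ne_zero {j : Fin m → ℕ} (i : Fin m) (k : ℕ) :
    IsOpen {q : M × Chains j | inputDeriv q.2 i k ≠ 0} := by
  have h : Continuous fun q : M × Chains j => inputDeriv q.2 i k := by
    simp only [← inputDerivCLM_apply]
    exact (inputDerivCLM j i k).continuous.comp continuous_snd
  exact isOpen_ne_fun h continuous_const

namespace BrunovskyLinearization

variable {p : M × Chains (Pi.single l 2 : Fin m → ℕ)}
  (L : BrunovskyLinearization ((driftless I g).prolong (Pi.single l 2)) p)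

theorem differential_output_of_two_le {i : Fin m} (hi : 2 ≤ L.κ i)
    {q : M × Chains (Pi.single l 2 : Fin m → ℕ)} (hq : q ∈ L.φ.source) {w : TangentSpace I q.1}
    (hw : w ∈ H02 I g l q.1) {ν : Chains (Pi.single l 2 : Fin m → ℕ)}
    (hν : ∀ i, inputDeriv ν i 0 = 0) :
    differential (I.prod 𝓘(ℝ, Chains (Pi.single l 2))) (L.output i) q
      (tangentPair I q w ν) = 0 := by
  have hB : ∀ k, lieDeriv (I.prod 𝓘(ℝ, Chains (Pi.single l 2))) (tower g (Pi.single l 2) k 0)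
      (L.output i) q = 0 := fun k => L.lieDeriv_tower_output i k (t := 0) (by omega) hq
  have h1 : H02 I g l q.1 ≤ horizontalKernel (I := I) (L.output i) q := by
    refine Submodule.span_le.2 ?_
    rintro _ ⟨k, hk, rfl⟩
    have h2 := hB k
    rw [lieDeriv, tower_of_ne hk] at h2
    exact h2
  rw [differential_tangentPair, mem_horizontalKernel.1 (h1 hw), zero_add]
  refine Finset.sum_eq_zero fun a _ => ?_
  have h4 := a.2.2
  have h5 := single_le l a.1 2
  by_cases ha : (a.2 : ℕ) = 0
  · have h6 := hν a.1
    rw [inputDeriv, dif_pos (by omega)] at h6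
    have h7 : ν a = 0 := by
      rw [← h6]
      congr 1
      obtain ⟨i, t⟩ := a
      congr 1
      exact Fin.ext ha
    rw [h7, zero_mul]
  · have h3 := hB a.1
    rw [show (0 : ℕ) = (Pi.single l 2 : Fin m → ℕ) a.1 - 1 - a.2 by omega, tower_coord] at h3
    rw [h3, mul_zero]

/-- The inputs annihilate the first two members of a chain of length at least three. This allows
tower steps 0 and 1, which are both coordinate fields `u_l^(1)` and `u_l^(0)`. -/
theorem lieDeriv_coord_output_of_three_le (hg : ∀ i, SmoothFieldOn I (g i) Set.univ) {i : Fin m}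
    (hi : 3 ≤ L.κ i) {q : M × Chains (Pi.single l 2 : Fin m → ℕ)} (hq : q ∈ L.φ.source)
    (a : (i : Fin m) × Fin ((Pi.single l 2 : Fin m → ℕ) i)) :
    lieDeriv (I.prod 𝓘(ℝ, Chains (Pi.single l 2))) (liftField I 0 (Pi.single a 1))
      (L.output i) q = 0 := by
  have h4 := a.2.2
  have h5 := single_le l a.1 2
  rw [← tower_coord g a]
  exact lieDeriv_tower_eq_zero g hg L.φ.open_source (L.contMDiffOn_output i) (N := 2) (t := 0)
    (fun t ht q hq => L.lieDeriv_tower_output i a.1 (by omega) hq) (by omega) (by omega) hq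

/-- The output is annihilated by the brackets of the inputs with the drift, in particular by `u_l [g
k, g l]`; division by `u_l ≠ 0` gives the second half of `H12`. -/
theorem H12_le_horizontalKernel_output (hg : ∀ i, SmoothFieldOn I (g i) Set.univ) {i : Fin m}
    (hi : 3 ≤ L.κ i) {q : M × Chains (Pi.single l 2 : Fin m → ℕ)} (hq : q ∈ L.φ.source)
    (hu : inputDeriv q.2 l 0 ≠ 0) :
    H12 I g l q.1 ≤ horizontalKernel (I := I) (L.output i) q := by
  have hB : ∀ k, ∀ t < 2, ∀ q ∈ L.φ.source, lieDeriv (I.prod 𝓘(ℝ, Chains (Pi.single l 2)))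
      (tower g (Pi.single l 2) k 0) ((lieDeriv (I.prod 𝓘(ℝ, Chains (Pi.single l 2)))
        ((driftless I g).prolong (Pi.single l 2)).drift)^[t] (L.output i)) q = 0 :=
    fun k t ht q hq => L.lieDeriv_tower_output i k (by omega) hq
  refine sup_le (Submodule.span_le.2 ?_) (Submodule.span_le.2 ?_)
  · rintro _ ⟨k, hk, rfl⟩
    have h2 := hB k 0 two_pos q hq
    rw [lieDeriv, tower_of_ne hk] at h2
    exact h2
  · rintro _ ⟨k, hk, rfl⟩
    have h1 := lieDeriv_tower_zero_drift g hg k L.φ.open_source (L.contMDiffOn_output i) hq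
    have h2 := hB k 1 one_lt_two q hq
    rw [Function.iterate_one] at h2
    rw [h2, lieDeriv_eq_zero_of_eq_zero (h := lieDeriv (I.prod 𝓘(ℝ, Chains (Pi.single l 2)))
      (tower g (Pi.single l 2) k 0) (L.output i)) L.φ.open_source
      (fun q hq => hB k 0 two_pos q hq) _ hq, zero_add, bracketInput_of_ne hk] at h1
    have h3 : inputDeriv q.2 l 0 • VectorField.mlieBracket I (g k) (g l) q.1 ∈
      horizontalKernel (I := I) (L.output i) q := h1.symm
    have h4 := (Submodule.smul_mem_iff _ hu).1 h3
    rw [VectorField.mlieBracket_swap_apply]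
    exact Submodule.neg_mem _ h4

theorem differential_output_of_three_le (hg : ∀ i, SmoothFieldOn I (g i) Set.univ) {i : Fin m}
    (hi : 3 ≤ L.κ i) {q : M × Chains (Pi.single l 2 : Fin m → ℕ)} (hq : q ∈ L.φ.source)
    (hu : inputDeriv q.2 l 0 ≠ 0) {w : TangentSpace I q.1} (hw : w ∈ H12 I g l q.1)
    (ν : Chains (Pi.single l 2 : Fin m → ℕ)) :
    differential (I.prod 𝓘(ℝ, Chains (Pi.single l 2))) (L.output i) q
      (tangentPair I q w ν) = 0 := by
  rw [differential_tangentPair,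
    mem_horizontalKernel.1 (L.H12_le_horizontalKernel_output hg hi hq hu hw), zero_add]
  exact Finset.sum_eq_zero fun a _ => by
    rw [L.lieDeriv_coord_output_of_three_le hg hi hq a, mul_zero]

/-- The differentials of these outputs have no vertical part, so they are independent covectors on
the original tangent space. They annihilate `H12`, whose corank is 2. -/
theorem card_three_le (hg : ∀ i, SmoothFieldOn I (g i) Set.univ)
    (hn : Module.finrank ℝ E = 2 * m)
    (hrank : ∀ x, Module.finrank ℝ (H12 I g l x) = 2 * m - 2) (hu : inputDeriv p.2 l 0 ≠ 0) :
    Fintype.card {i // L.κ i = 3} ≤ 2 := by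
  let θ : {i // L.κ i = 3} → E →L[ℝ] ℝ := fun i =>
    ContinuousLinearMap.comp
      (differential (I.prod 𝓘(ℝ, Chains (Pi.single l 2))) (L.output i) p :
        E × Chains (Pi.single l 2 : Fin m → ℕ) →L[ℝ] ℝ)
      (ContinuousLinearMap.inl ℝ E (Chains (Pi.single l 2 : Fin m → ℕ)))
  have hθ : ∀ i (v : TangentSpace I p.1), θ i v =
      differential (I.prod 𝓘(ℝ, Chains (Pi.single l 2))) (L.output i) p (tangentPair I p v 0) :=
    fun _ _ => rfl
  have hli : LinearIndependent ℝ θ := by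
    have h := (L.linearIndependent_differential_output L.mem_source).comp
      (fun i : {i // L.κ i = 3} => i.1) Subtype.val_injective
    rw [Fintype.linearIndependent_iff] at h ⊢
    intro c hc
    refine h c (ContinuousLinearMap.ext fun u => ?_)
    obtain ⟨v, w, rfl⟩ := exists_eq_tangentPair u
    have h1 : ∀ v : E, ∑ i, c i • θ i v = 0 := fun v => by
      have := congrArg (fun A : E →L[ℝ] ℝ => A v) hc
      simp only [sum_apply, smul_apply] at this
      exact this
    rw [sum_apply]
    refine Eq.trans (Finset.sum_congr rfl fun i _ => ?_) (h1 v)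
    rw [smul_apply]
    congr 1
    rw [Function.comp_apply, differential_tangentPair]
    rw [Finset.sum_eq_zero fun a _ => by
      rw [L.lieDeriv_coord_output_of_three_le hg i.2.ge L.mem_source a, mul_zero], add_zero]
    rfl
  have h := card_add_card_le_of_forall_apply_eq_zero (V := E) hli
    (linearIndependent_bracketFamily g l (hrank p.1)) (fun i s => by
      refine (hθ i _).trans (L.differential_output_of_three_le hg i.2.ge L.mem_source hu ?_ 0)
      rw [← span_range_bracketFamily]
      exact Submodule.subset_span ⟨s, rfl⟩)
  rw [Fintype.card_sum, card_ne, hn] at h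
  have := l.pos
  omega

end BrunovskyLinearization

/-- Each index is at most 2, or equals 3 for at most two outputs, while the sum is `2m + 2`.
Equality therefore holds throughout: two indices are 3 and all others are 2. -/
theorem exists_outputEquationsEven_of_isFlatOutputAt (hm : 2 ≤ m)
    (hg : ∀ i, SmoothFieldOn I (g i) Set.univ) (hn : Module.finrank ℝ E = 2 * m)
    (hrank : ∀ x, Module.finrank ℝ (H12 I g l x) = 2 * m - 2) (htop : ∀ x, H23 I g l x = ⊤)
    {p : M × Chains (Pi.single l 2 : Fin m → ℕ)} (hu : inputDeriv p.2 l 0 ≠ 0)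
    {y : Fin m → M × Chains (Pi.single l 2 : Fin m → ℕ) → ℝ}
    (hy : IsFlatOutputAt (driftless I g) (Pi.single l 2) p y) :
    ∃ σ : Equiv.Perm (Fin m), OutputEquationsEven g l (y ∘ σ) p := by
  obtain ⟨L, hL⟩ := hy
  have h3 := L.card_three_le hg hn hrank hu
  have hle : ∀ i ∈ Finset.univ, L.κ i ≤ 2 + if L.κ i = 3 then 1 else 0 := fun i _ => by
    obtain ⟨k, hk⟩ := L.exists_κ_le l hg (Or.inr htop) i
    have := single_le l k 2
    split_ifs <;> omega
  have hsum : ∑ i, (2 + if L.κ i = 3 then 1 else 0) =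
      2 * m + Fintype.card {i // L.κ i = 3} := by
    simp only [Finset.sum_add_distrib, Finset.sum_const, Finset.card_univ, Fintype.card_fin,
      smul_eq_mul, Finset.sum_boole, ← Fintype.card_subtype]
    norm_num
    ring
  have htot : ∑ i, L.κ i = 2 * m + 2 := by rw [L.sum_κ_prolong, sum_single, hn]
  have hle' := Finset.sum_le_sum hle
  have hκ := fun i => (Finset.sum_eq_sum_iff_of_le hle).1 (by omega) i (Finset.mem_univ i)
  have hcard : Fintype.card {i : Fin m // (i : ℕ) < 2} = Fintype.card {i // L.κ i = 3} := by
    rw [card_fin_lt_two hm]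
    omega
  -- Any bijection from the first two labels to the outputs of index 3 extends to the required
  -- permutation.
  set e := Fintype.equivOfCardEq hcard
  have hd : ∀ i, ∀ q ∈ L.φ.source, differential (I.prod 𝓘(ℝ, Chains (Pi.single l 2))) (y i) q =
      differential (I.prod 𝓘(ℝ, Chains (Pi.single l 2))) (L.output i) q := fun i q hq =>
    differential_congr L.φ.open_source (hL i) hq
  have hW : IsOpen (L.φ.source ∩ {q | inputDeriv q.2 l 0 ≠ 0}) :=
    L.φ.open_source.inter (isOpen_inputDeriv_ne_zero l 0)
  refine ⟨e.extendSubtype, fun i => ⟨L.φ.source, L.φ.open_source, L.mem_source,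
    (L.contMDiffOn_output _).congr fun q hq => hL _ q hq⟩, fun i hi => ?_, fun i _ => ?_, ?_⟩
  · refine Filter.eventually_of_mem (hW.mem_nhds ⟨L.mem_source, hu⟩)
      fun q hq (w : TangentSpace I q.1) hw ν => ?_
    rw [Function.comp_apply, hd _ q hq.1]
    exact L.differential_output_of_three_le hg (e.extendSubtype_mem i hi).ge hq.1 hq.2 hw ν
  · refine Filter.eventually_of_mem (L.φ.open_source.mem_nhds L.mem_source)
      fun q hq (w : TangentSpace I q.1) hw ν hν => ?_
    rw [Function.comp_apply, hd _ q hq]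
    exact L.differential_output_of_two_le (by rw [hκ]; omega) hq hw hν
  · intro r q hq
    have h := (L.differentiallyIndependentAt_output hg r q hq).comp
      (fun c : Fin m × Fin (r + 1) => (e.extendSubtype c.1, c.2)) (by
        rintro ⟨i, t⟩ ⟨i', t'⟩ h
        simpa using h)
    convert h using 2 with c
    exact differential_congr (isOpen_forget_preimage r L.φ.open_source)
      (fun q' hq' => timeDeriv_congr r L.φ.open_source (hL _) c.2 hq') (hq ▸ L.mem_source)

end Even

/-! ### Existence of flat outputs with `2m` states -/

section EvenExistence

/-- Steinitz exchange: an independent family is completed by members of a larger one. -/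
theorem exists_linearIndependent_sumElim {V α β : Type*} [AddCommGroup V] [Module ℝ V] [Fintype α]
    [Fintype β] {v : α → V} {w : β → V} (hv : LinearIndependent ℝ v)
    (hw : LinearIndependent ℝ w) :
    ∃ e : Fin (Fintype.card β - Fintype.card α) → β,
      LinearIndependent ℝ (Sum.elim v (w ∘ e)) := by
  classical
  -- `b` is an independent subset of the union that contains the range of `v` and spans the range of
  -- `w`. It has at least `card β` elements, so enough members of `w` remain outside the range of
  -- `v`.
  obtain ⟨b, hbt, hsb, htb, hb⟩ := exists_linearIndepOn_id_extension (K := ℝ)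
    (s := Set.range v) (t := Set.range v ∪ Set.range w) hv.linearIndepOn_id Set.subset_union_left
  have hbfin : b.Finite := ((Set.finite_range v).union (Set.finite_range w)).subset hbt
  have : Fintype b := hbfin.fintype
  have hcard : Fintype.card β ≤ b.toFinset.card := by
    have h1 : Submodule.span ℝ (Set.range w) ≤ Submodule.span ℝ b :=
      Submodule.span_le.2 fun x hx => htb (Or.inr hx)
    have : FiniteDimensional ℝ (Submodule.span ℝ b) := FiniteDimensional.span_of_finite ℝ hbfin
    have h2 := Submodule.finrank_mono h1
    rw [finrank_span_eq_card hw] at h2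
    exact h2.trans (finrank_span_le_card b)
  have hrange : (Finset.univ.image v).card = Fintype.card α :=
    Finset.card_image_of_injective _ hv.injective
  obtain ⟨t, ht, htc⟩ := Finset.exists_subset_card_eq
    (s := b.toFinset \ Finset.univ.image v) (n := Fintype.card β - Fintype.card α) (by
      have := Finset.le_card_sdiff (Finset.univ.image v) b.toFinset
      omega)
  set d := (t.equivFinOfCardEq htc).symm
  have hd : ∀ i, (d i : V) ∈ b ∧ ∀ a, v a ≠ d i := fun i => by
    have := ht (d i).2
    simpa using this
  have hdw : ∀ i, ∃ x, w x = d i := fun i => by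
    rcases hbt (hd i).1 with ⟨a, ha⟩ | h
    · exact absurd ha ((hd i).2 a)
    · exact h
  choose e he using hdw
  refine ⟨e, ?_⟩
  have h := hb.linearIndependent.comp
    (Sum.elim (fun a => (⟨v a, hsb ⟨a, rfl⟩⟩ : b)) fun i => ⟨d i, (hd i).1⟩) (by
      rintro (a | i) (a' | i') h
      · simp only [Sum.elim_inl, Subtype.mk.injEq] at h
        rw [hv.injective h]
      · simp only [Sum.elim_inl, Sum.elim_inr, Subtype.mk.injEq] at h
        exact absurd h ((hd i').2 a)
      · simp only [Sum.elim_inl, Sum.elim_inr, Subtype.mk.injEq] at h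
        exact absurd h.symm ((hd i).2 a')
      · simp only [Sum.elim_inr, Subtype.mk.injEq] at h
        rw [d.injective (Subtype.ext h)])
  have heq : Sum.elim v (w ∘ e) = (fun x : b => id (x : V)) ∘
      Sum.elim (fun a => (⟨v a, hsb ⟨a, rfl⟩⟩ : b)) fun i => ⟨d i, (hd i).1⟩ := by
    funext s
    rcases s with a | i
    · rfl
    · exact he i
  rw [heq]
  exact h

set_option linter.unusedSectionVars false

variable {E : Type} [NormedAddCommGroup E] [NormedSpace ℝ E] [FiniteDimensional ℝ E]
  {H : Type*} [TopologicalSpace H] {I : ModelWithCorners ℝ E H} [I.Boundaryless]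
  {M : Type*} [TopologicalSpace M] [ChartedSpace H M] [IsManifold I ∞ M] [IsManifold I 1 M]
  {m : ℕ} {g : Fin m → (x : M) → TangentSpace I x} {l : Fin m}

theorem differential_inputDeriv {j : Fin m → ℕ} (i : Fin m) (k : ℕ) (q : M × Chains j)
    (v : TangentSpace I q.1) (w : Chains j) :
    differential (I.prod 𝓘(ℝ, Chains j)) (fun q : M × Chains j => inputDeriv q.2 i k) q
      (tangentPair I q v w) = inputDeriv w i k :=
  lieDeriv_inputDeriv i k (fun _ => (v : E)) w q

theorem linearIndependent_differential_comp_fst {j : Fin m → ℕ} {ι : Type*} [Fintype ι]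
    {f : ι → M → ℝ} {p : M × Chains j} (hf : ∀ a, MDifferentiableAt I 𝓘(ℝ, ℝ) (f a) p.1)
    (hli : LinearIndependent ℝ fun a => differential I (f a) p.1) :
    LinearIndependent ℝ fun a => differential (I.prod 𝓘(ℝ, Chains j))
      (fun q : M × Chains j => f a q.1) p := by
  rw [Fintype.linearIndependent_iff] at hli ⊢
  intro c hc
  refine hli c (ContinuousLinearMap.ext fun v => ?_)
  have h1 := congrArg (fun A : TangentSpace (I.prod 𝓘(ℝ, Chains j)) p →L[ℝ] ℝ =>
    A (tangentPair I p v 0)) hc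
  simp only [sum_apply, smul_apply, differential_comp_fst (hf _)] at h1
  rw [sum_apply]
  exact h1

theorem linearIndependent_differential_option {ι : Type*} [Fintype ι] {r : ℕ} (hr : 0 < r)
    {f : ι → M → ℝ} {p : M × Chains (Pi.single l r : Fin m → ℕ)}
    (hf : ∀ a, MDifferentiableAt I 𝓘(ℝ, ℝ) (f a) p.1)
    (hli : LinearIndependent ℝ fun a => differential I (f a) p.1) :
    LinearIndependent ℝ fun o : Option ι => differential (I.prod 𝓘(ℝ, Chains (Pi.single l r)))
      (o.elim (fun q : M × Chains (Pi.single l r : Fin m → ℕ) => inputDeriv q.2 l 0)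
        fun a q => f a q.1) p := by
  have hli' := linearIndependent_differential_comp_fst (p := p) hf hli
  rw [Fintype.linearIndependent_iff] at hli' ⊢
  intro c hc
  rw [Fintype.sum_option] at hc
  simp only [Option.elim_none, Option.elim_some] at hc
  -- A vertical vector is annihilated by all functions of `x`; the constant one isolates the
  -- coefficient of `u_l`.
  have h0 : c none = 0 := by
    have h1 := congrArg (fun A : TangentSpace (I.prod 𝓘(ℝ, Chains (Pi.single l r))) p →L[ℝ] ℝ =>
      A (tangentPair I p 0 (fun _ => 1))) hc
    simp only [add_apply, sum_apply, smul_apply, differential_comp_fst (hf _),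
      differential_inputDeriv, map_zero, smul_zero, Finset.sum_const_zero, add_zero] at h1
    rw [inputDeriv, dif_pos (by simpa using hr)] at h1
    simpa using h1
  rw [h0, zero_smul, zero_add] at hc
  have h2 := hli' (fun a => c (some a)) hc
  rintro (_ | a)
  · exact h0
  · exact h2 a

/-- The first integrals of `H12` and their time derivatives are independent. -/
theorem linearIndependent_firstIntegrals (hg : ∀ i, SmoothFieldOn I (g i) Set.univ)
    (htop : ∀ x, H23 I g l x = ⊤) {ι : Type*} [Fintype ι] {f : ι → M → ℝ}
    {p : M × Chains (Pi.single l 2 : Fin m → ℕ)} (hu : inputDeriv p.2 l 0 ≠ 0)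
    {U : Set M} (hU : IsOpen U) (hp : p.1 ∈ U) (hf : ∀ a, ContMDiffOn I 𝓘(ℝ, ℝ) ∞ (f a) U)
    (hfH : ∀ x ∈ U, ∀ a, ∀ w ∈ H12 I g l x, differential I (f a) x w = 0)
    (hli : LinearIndependent ℝ fun a => differential I (f a) p.1) :
    LinearIndependent ℝ fun c : ι × Fin 2 => differential (I.prod 𝓘(ℝ, Chains (Pi.single l 2)))
      ((lieDeriv (I.prod 𝓘(ℝ, Chains (Pi.single l 2)))
        ((driftless I g).prolong (Pi.single l 2)).drift)^[c.2]
        (fun q : M × Chains (Pi.single l 2 : Fin m → ℕ) => f c.1 q.1)) p := by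
  have hl : (Pi.single l 2 : Fin m → ℕ) l = 2 := by simp
  have hW : IsOpen (Prod.fst ⁻¹' U : Set (M × Chains (Pi.single l 2 : Fin m → ℕ))) :=
    hU.preimage continuous_fst
  have hfs := fun a => contMDiffOn_comp_fst (j := (Pi.single l 2 : Fin m → ℕ)) (hf a)
  have hd : ∀ a, ∀ q : M × Chains (Pi.single l 2 : Fin m → ℕ), q.1 ∈ U →
      ∀ (v : TangentSpace I q.1) w, differential (I.prod 𝓘(ℝ, Chains (Pi.single l 2)))
        (fun q : M × Chains (Pi.single l 2 : Fin m → ℕ) => f a q.1) q (tangentPair I q v w) =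
        differential I (f a) q.1 v := fun a q hq v w =>
    differential_comp_fst (mdifferentiableAt_of_contMDiffOn hU (hf a) hq) v w
  -- The partial derivative of `L_F f` with respect to `u_l` is `df (g l)`.
  have hd1 : ∀ a, lieDeriv (I.prod 𝓘(ℝ, Chains (Pi.single l 2))) (tower g (Pi.single l 2) l 1)
      (lieDeriv (I.prod 𝓘(ℝ, Chains (Pi.single l 2)))
        ((driftless I g).prolong (Pi.single l 2)).drift
        (fun q : M × Chains (Pi.single l 2 : Fin m → ℕ) => f a q.1)) p =
      differential I (f a) p.1 (g l p.1) := by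
    intro a
    rw [lieDeriv_tower_drift g hg (by rw [hl]; norm_num) hW (hfs a) hp,
      lieDeriv_eq_zero_of_eq_zero (h := lieDeriv (I.prod 𝓘(ℝ, Chains (Pi.single l 2)))
        (tower g (Pi.single l 2) l 1) (fun q => f a q.1)) hW (fun q hq => ?_) _ hp, zero_add]
    · have h2 : tower g (Pi.single l 2) l (1 + 1) = liftField I (g l) 0 := by
        rw [← tower_top, hl]
      rw [h2]
      exact hd a p hp _ _
    · unfold tower
      rw [if_neg (by rw [hl]; norm_num)]
      exact (hd a q hq _ _).trans (map_zero _)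
  -- Since `df` annihilates `[g l, g i]`, differentiating `L_F f` along this field leaves only a
  -- commutator, and of the brackets in it only the one with `u_l g l` survives.
  have hd2 : ∀ a i, i ≠ l → differential (I.prod 𝓘(ℝ, Chains (Pi.single l 2)))
      (lieDeriv (I.prod 𝓘(ℝ, Chains (Pi.single l 2)))
        ((driftless I g).prolong (Pi.single l 2)).drift
        (fun q : M × Chains (Pi.single l 2 : Fin m → ℕ) => f a q.1)) p
      (tangentPair I p (VectorField.mlieBracket I (g l) (g i) p.1) 0) =
      inputDeriv p.2 l 0 * differential I (f a) p.1 (VectorField.mlieBracket I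
        (VectorField.mlieBracket I (g l) (g i)) (g l) p.1) := by
    intro a i hi
    have h0 : ∀ i p, inputDeriv (0 : Chains (Pi.single l 2 : Fin m → ℕ)) i p = 0 := fun i p => by
      unfold inputDeriv; split_ifs <;> rfl
    refine (lieDeriv_liftField_drift g hg (smoothFieldOn_mlieBracket (hg l) (hg i)) 0 hW
      (hfs a) hp).trans ?_
    rw [lieDeriv_eq_zero_of_eq_zero (h := lieDeriv (I.prod 𝓘(ℝ, Chains (Pi.single l 2)))
      (liftField I (VectorField.mlieBracket I (g l) (g i)) 0) (fun q => f a q.1)) hW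
      (fun q hq => ?_) _ hp, zero_add, Finset.sum_eq_single l]
    · have h1 : lieDeriv (I.prod 𝓘(ℝ, Chains (Pi.single l 2))) (liftField I
          (fun x => ∑ i, inputDeriv (0 : Chains (Pi.single l 2 : Fin m → ℕ)) i 0 • g i x)
          (shiftChains (0 : Chains (Pi.single l 2 : Fin m → ℕ))))
          (fun q : M × Chains (Pi.single l 2 : Fin m → ℕ) => f a q.1) p = 0 := by
        refine (hd a p hp _ _).trans ?_
        simp only [h0, zero_smul, Finset.sum_const_zero, map_zero]
      rw [h1, zero_add]
      congr 1
      exact hd a p hp _ _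
    · intro k _ hk
      rw [inputDeriv_eq_zero_of_ne hk, zero_mul]
    · simp
    · exact (hd a q hq _ _).trans (hfH q.1 hq a _
        (Submodule.mem_sup_right (Submodule.subset_span ⟨i, hi, rfl⟩)))
  have hli' := linearIndependent_differential_comp_fst (p := p)
    (fun a => mdifferentiableAt_of_contMDiffOn hU (hf a) hp) hli
  rw [Fintype.linearIndependent_iff] at hli hli' ⊢
  intro c hc
  rw [Fintype.sum_prod_type] at hc
  simp only [Fin.sum_univ_two, Fin.val_zero, Fin.val_one, Function.iterate_zero,
    Function.iterate_one, id_eq] at hc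
  have happ : ∀ u : TangentSpace (I.prod 𝓘(ℝ, Chains (Pi.single l 2))) p,
      ∑ a, (c (a, 0) * differential (I.prod 𝓘(ℝ, Chains (Pi.single l 2)))
        (fun q : M × Chains (Pi.single l 2 : Fin m → ℕ) => f a q.1) p u +
        c (a, 1) * differential (I.prod 𝓘(ℝ, Chains (Pi.single l 2)))
        (lieDeriv (I.prod 𝓘(ℝ, Chains (Pi.single l 2)))
        ((driftless I g).prolong (Pi.single l 2)).drift
        (fun q : M × Chains (Pi.single l 2 : Fin m → ℕ) => f a q.1)) p u) = 0 := by
    intro u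
    have h1 := congrArg (fun A : TangentSpace (I.prod 𝓘(ℝ, Chains (Pi.single l 2))) p →L[ℝ] ℝ =>
      A u) hc
    simp only [sum_apply, add_apply, smul_apply, smul_eq_mul] at h1
    exact h1
  -- The coefficients of the time derivatives, placed on the `df_a`, define a covector that
  -- annihilates `H12` by hypothesis. It annihilates `g l` and the double brackets because the
  -- relation is evaluated on the coordinate field of `u_l` and on `[g l, g i]`. As `H23` is
  -- everything, this covector and hence those coefficients vanish.
  have hker : H23 I g l p.1 ≤ LinearMap.ker
      ((∑ a, c (a, 1) • differential I (f a) p.1 : TangentSpace I p.1 →L[ℝ] ℝ) :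
        TangentSpace I p.1 →ₗ[ℝ] ℝ) := by
    have hmem : ∀ w : TangentSpace I p.1, ∑ a, c (a, 1) * differential I (f a) p.1 w = 0 →
        w ∈ LinearMap.ker ((∑ a, c (a, 1) • differential I (f a) p.1 :
          TangentSpace I p.1 →L[ℝ] ℝ) : TangentSpace I p.1 →ₗ[ℝ] ℝ) := by
      intro w hw
      refine LinearMap.mem_ker.2 ?_
      refine Eq.trans ?_ hw
      rw [ContinuousLinearMap.coe_coe, sum_apply]
      rfl
    refine sup_le (sup_le (fun w hw => hmem w (Finset.sum_eq_zero fun a _ => ?_))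
      (Submodule.span_le.2 ?_)) (Submodule.span_le.2 ?_)
    · rw [hfH p.1 hp a w hw, mul_zero]
    · rintro _ rfl
      refine hmem _ ?_
      refine Eq.trans (Finset.sum_congr rfl fun a _ => ?_) (happ (tower g (Pi.single l 2) l 1 p))
      have h1 : differential (I.prod 𝓘(ℝ, Chains (Pi.single l 2)))
          (fun q : M × Chains (Pi.single l 2 : Fin m → ℕ) => f a q.1) p
          (tower g (Pi.single l 2) l 1 p) = 0 := by
        unfold tower
        rw [if_neg (by rw [hl]; norm_num)]
        exact (hd a p hp _ _).trans (map_zero _)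
      have h2 := hd1 a
      rw [lieDeriv] at h2
      rw [h1, h2, mul_zero, zero_add]
    · rintro _ ⟨i, hi, rfl⟩
      refine hmem _ ?_
      have h1 := happ (tangentPair I p (VectorField.mlieBracket I (g l) (g i) p.1) 0)
      simp only [hd2 _ i hi, hd _ p hp] at h1
      have h2 : inputDeriv p.2 l 0 * ∑ a, c (a, 1) * differential I (f a) p.1
          (VectorField.mlieBracket I (g l) (VectorField.mlieBracket I (g l) (g i)) p.1) = 0 := by
        rw [Finset.mul_sum, ← neg_eq_zero, ← Finset.sum_neg_distrib]
        refine Eq.trans (Finset.sum_congr rfl fun a _ => ?_) h1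
        rw [hfH p.1 hp a _ (Submodule.mem_sup_right (Submodule.subset_span ⟨i, hi, rfl⟩)),
          VectorField.mlieBracket_swap_apply (V := VectorField.mlieBracket I (g l) (g i)), map_neg]
        ring
      exact (mul_eq_zero.1 h2).resolve_left hu
  have hβ : ∀ a, c (a, 1) = 0 := hli (fun a => c (a, 1)) (ContinuousLinearMap.ext fun v => by
    have h1 : v ∈ H23 I g l p.1 := by rw [htop]; exact Submodule.mem_top
    exact LinearMap.mem_ker.1 (hker h1))
  have hα : ∀ a, c (a, 0) = 0 := hli' (fun a => c (a, 0)) (by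
    simp only [hβ, zero_smul, add_zero] at hc
    exact hc)
  rintro ⟨a, t⟩
  fin_cases t
  · exact hα a
  · exact hβ a

end EvenExistence

section EvenExistence

set_option linter.unusedSectionVars false

variable {E : Type} [NormedAddCommGroup E] [NormedSpace ℝ E] [FiniteDimensional ℝ E]
  {H : Type*} [TopologicalSpace H] {I : ModelWithCorners ℝ E H} [I.Boundaryless]
  {M : Type*} [TopologicalSpace M] [ChartedSpace H M] [IsManifold I ∞ M] [IsManifold I 1 M]
  {m : ℕ} {g : Fin m → (x : M) → TangentSpace I x} {l : Fin m}

/-- Existence of flat outputs. -/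
theorem exists_isFlatOutputAt_two (hm : 2 ≤ m) (hg : ∀ i, SmoothFieldOn I (g i) Set.univ)
    (hn : Module.finrank ℝ E = 2 * m) (hinv : Involutive I (H02 I g l))
    (hinv' : Involutive I (H12 I g l))
    (hrank : ∀ x, Module.finrank ℝ (H12 I g l x) = 2 * m - 2) (htop : ∀ x, H23 I g l x = ⊤)
    (p : M × Chains (Pi.single l 2 : Fin m → ℕ)) (hu : inputDeriv p.2 l 0 ≠ 0) :
    ∃ y : Fin m → M × Chains (Pi.single l 2 : Fin m → ℕ) → ℝ,
      IsFlatOutputAt (driftless I g) (Pi.single l 2) p y := by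
  have hLI := linearIndependent_bracketFamily g l (hrank p.1)
  obtain ⟨f₀, U₁, hU₁, hpU₁, hf₀, hfH₀, hli₀⟩ := exists_firstIntegrals_manifold
    (bracketFamily g l) (smoothFieldOn_bracketFamily g l hg) p.1 hLI
    (mlieBracket_mem_H12 g l hg hinv')
  obtain ⟨h₀, U₂, hU₂, hpU₂, hh, hhg, hhli⟩ := exists_firstIntegrals_manifold
    (fun i : {i : Fin m // i ≠ l} => g i) (fun i => hg i) p.1
    (linearIndependent_ne hLI) (mlieBracket_mem_H02 g l hg hinv)
  have hc2 : 2 = Module.finrank ℝ E -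
      Fintype.card ({i : Fin m // i ≠ l} ⊕ {i : Fin m // i ≠ l}) := by
    rw [Fintype.card_sum, hn, card_ne]
    omega
  have hcm : Module.finrank ℝ E - Fintype.card {i : Fin m // i ≠ l} = m + 1 := by
    rw [hn, card_ne]
    omega
  set f : Fin 2 → M → ℝ := fun a => f₀ (finCongr hc2 a) with hfdef
  have hf : ∀ a, ContMDiffOn I 𝓘(ℝ, ℝ) ∞ (f a) U₁ := fun a => hf₀ _
  have hli : LinearIndependent ℝ fun a => differential I (f a) p.1 :=
    hli₀.comp _ (finCongr hc2).injective
  have hfH : ∀ x ∈ U₁, ∀ a, ∀ w ∈ H12 I g l x, differential I (f a) x w = 0 := by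
    intro x hx a w hw
    have h1 : H12 I g l x ≤ LinearMap.ker
        (differential I (f a) x : TangentSpace I x →ₗ[ℝ] ℝ) := by
      rw [← span_range_bracketFamily]
      refine Submodule.span_le.2 ?_
      rintro _ ⟨s, rfl⟩
      exact hfH₀ x hx s _
    exact h1 hw
  have hhH : ∀ x ∈ U₂, ∀ a, ∀ w ∈ H02 I g l x, differential I (h₀ a) x w = 0 := by
    intro x hx a w hw
    have h1 : H02 I g l x ≤ LinearMap.ker
        (differential I (h₀ a) x : TangentSpace I x →ₗ[ℝ] ℝ) := by
      rw [← span_range_eq_H02]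
      refine Submodule.span_le.2 ?_
      rintro _ ⟨s, rfl⟩
      exact hhg x hx s _
    exact h1 hw
  have hLIf := linearIndependent_firstIntegrals hg htop hu hU₁ hpU₁ hf hfH hli
  -- The candidates for the remaining outputs: `u_l` and the `m + 1` first integrals of `H02`, in
  -- all `m + 2` functions with independent differentials.
  set w : Option (Fin (Module.finrank ℝ E - Fintype.card {i : Fin m // i ≠ l})) →
      M × Chains (Pi.single l 2 : Fin m → ℕ) → ℝ := fun o =>
    o.elim (fun q => inputDeriv q.2 l 0) fun a q => h₀ a q.1 with hwdef
  have hLIw : LinearIndependent ℝ fun o => differential (I.prod 𝓘(ℝ, Chains (Pi.single l 2)))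
      (w o) p :=
    linearIndependent_differential_option two_pos
      (fun a => mdifferentiableAt_of_contMDiffOn hU₂ (hh a) hpU₂) hhli
  have hws : ∀ o, SmoothNear (I.prod 𝓘(ℝ, Chains (Pi.single l 2))) (w o) p := by
    rintro (_ | a)
    · exact ⟨Set.univ, isOpen_univ, trivial, (contMDiff_inputDeriv l 0).contMDiffOn⟩
    · exact ⟨_, hU₂.preimage continuous_fst, hpU₂, contMDiffOn_comp_fst (hh a)⟩
  have hwH : ∀ o, DerivFreeAnnihilates (H02 I g l) (w o) p := by
    rintro (_ | a)
    · exact Filter.Eventually.of_forall fun q (v : TangentSpace I q.1) _ ν hν =>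
        (differential_inputDeriv l 0 q v ν).trans (hν l)
    · refine Filter.eventually_of_mem ((hU₂.preimage continuous_fst).mem_nhds hpU₂)
        fun q hq (v : TangentSpace I q.1) hv ν _ => ?_
      exact (differential_comp_fst (mdifferentiableAt_of_contMDiffOn hU₂ (hh a) hq) v ν).trans
        (hhH q.1 hq a v hv)
  -- The two first integrals of `H12` and their time derivatives are four independent forms; the
  -- exchange completes them with `(m + 2) - 4 = m - 2` candidates, exactly the number of missing
  -- outputs.
  obtain ⟨e, he⟩ := exists_linearIndependent_sumElim hLIf hLIw
  have hk : Fintype.card (Option (Fin (Module.finrank ℝ E - Fintype.card {i : Fin m // i ≠ l}))) -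
      Fintype.card (Fin 2 × Fin 2) = m - 2 := by
    rw [Fintype.card_option, Fintype.card_fin, hcm, Fintype.card_prod, Fintype.card_fin]
    omega
  have hlt : ∀ i : Fin m, ¬ (i : ℕ) < 2 → (i : ℕ) - 2 < Fintype.card (Option (Fin
      (Module.finrank ℝ E - Fintype.card {i : Fin m // i ≠ l}))) -
      Fintype.card (Fin 2 × Fin 2) := fun i hi => by
    have := i.2
    omega
  set y : Fin m → M × Chains (Pi.single l 2 : Fin m → ℕ) → ℝ := fun i =>
    if hi : (i : ℕ) < 2 then fun q => f ⟨i, hi⟩ q.1 else w (e ⟨(i : ℕ) - 2, hlt i hi⟩) with hydef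
  have hy1 : ∀ (i : Fin m) (hi : (i : ℕ) < 2), y i = fun q => f ⟨i, hi⟩ q.1 := fun i hi => by
    simp only [hydef, dif_pos hi]
  have hy0 : ∀ (i : Fin m) (hi : ¬ (i : ℕ) < 2), y i = w (e ⟨(i : ℕ) - 2, hlt i hi⟩) :=
    fun i hi => by simp only [hydef, dif_neg hi]
  refine ⟨y, isFlatOutputAt_of_annihilates hg hn hrank hu (fun i => (i : ℕ) < 2)
    (card_fin_lt_two hm) (fun i => ?_) (fun i hi => ?_) (fun i hi => ?_) ?_⟩
  · by_cases hi : (i : ℕ) < 2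
    · rw [hy1 i hi]
      exact ⟨_, hU₁.preimage continuous_fst, hpU₁, contMDiffOn_comp_fst (hf _)⟩
    · rw [hy0 i hi]
      exact hws _
  · rw [hy1 i hi]
    refine Filter.eventually_of_mem ((hU₁.preimage continuous_fst).mem_nhds hpU₁)
      fun q hq (v : TangentSpace I q.1) hv ν => ?_
    exact (differential_comp_fst (mdifferentiableAt_of_contMDiffOn hU₁ (hf _) hq) v ν).trans
      (hfH q.1 hq _ v hv)
  · rw [hy0 i hi]
    exact hwH _
  · have h := he.comp (fun c : {c : Fin m × Fin 2 // (c.1 : ℕ) < 2 ∨ c.2 = 0} =>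
      if hc : (c.1.1 : ℕ) < 2 then Sum.inl (⟨c.1.1, hc⟩, c.1.2)
      else Sum.inr ⟨(c.1.1 : ℕ) - 2, hlt c.1.1 hc⟩) (by
        rintro ⟨⟨i, t⟩, hit⟩ ⟨⟨i', t'⟩, hit'⟩ h
        simp only at hit hit' h
        by_cases hi : (i : ℕ) < 2 <;> by_cases hi' : (i' : ℕ) < 2
        · rw [dif_pos hi, dif_pos hi'] at h
          simp only [Sum.inl.injEq, Prod.mk.injEq, Fin.mk.injEq] at h
          rw [Subtype.mk.injEq, Prod.mk.injEq]
          exact ⟨Fin.ext h.1, h.2⟩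
        · rw [dif_pos hi, dif_neg hi'] at h
          cases h
        · rw [dif_neg hi, dif_pos hi'] at h
          cases h
        · rw [dif_neg hi, dif_neg hi'] at h
          simp only [Sum.inr.injEq, Fin.mk.injEq] at h
          rw [Subtype.mk.injEq, Prod.mk.injEq]
          exact ⟨Fin.ext (by omega), (hit.resolve_left hi).trans (hit'.resolve_left hi').symm⟩)
    convert h using 2 with c
    · obtain ⟨⟨i, t⟩, hit⟩ := c
      simp only [Function.comp_apply]
      by_cases hi : (i : ℕ) < 2
      · rw [dif_pos hi, Sum.elim_inl, hy1 i hi]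
      · obtain rfl : t = 0 := hit.resolve_left hi
        rw [dif_neg hi, Sum.elim_inr, hy0 i hi]
        rfl
    · rfl

end EvenExistence

end PureProlongation

end

/-! ### The theorem -/

theorem mainTheorem3 {n m : ℕ} (hm : 2 ≤ m)
    {X : Type*} [TopologicalSpace X] [ChartedSpace (EuclideanSpace ℝ (Fin n)) X]
    [IsManifold (𝓡 n) ∞ X]
    (g : Fin m → (x : X) → TangentSpace (𝓡 n) x)
    (hg : ∀ i, PureProlongation.SmoothFieldOn (𝓡 n) (g i) Set.univ)
    (l : Fin m) (hl : (l : ℕ) + 1 = m) :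
    (n = 2 * m - 1 →
      PureProlongation.Involutive (𝓡 n) (PureProlongation.H02 (𝓡 n) g l) →
      (∀ x, Module.finrank ℝ (PureProlongation.H12' (𝓡 n) g l x) = 2 * m - 1) →
      (∀ p : X × PureProlongation.Chains (Pi.single l 1), PureProlongation.inputDeriv p.2 l 0 ≠ 0 →
        PureProlongation.P2FlatAt (PureProlongation.driftless (𝓡 n) g) (Pi.single l 1) p ∧
        (∀ y : Fin m → X × PureProlongation.Chains (Pi.single l 1) → ℝ,
          PureProlongation.IsFlatOutputAt (PureProlongation.driftless (𝓡 n) g)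
              (Pi.single l 1) p y ↔
            PureProlongation.OutputEquationsOdd g l y p)) ∧
      PureProlongation.NoShorterProlongation (PureProlongation.driftless (𝓡 n) g)
        (Pi.single l 1)) ∧
    (n = 2 * m →
      PureProlongation.Involutive (𝓡 n) (PureProlongation.H02 (𝓡 n) g l) →
      PureProlongation.Involutive (𝓡 n) (PureProlongation.H12 (𝓡 n) g l) →
      (∀ x, Module.finrank ℝ (PureProlongation.H12 (𝓡 n) g l x) = 2 * m - 2) →
      (∀ x, PureProlongation.H23 (𝓡 n) g l x = ⊤) →
      (∀ p : X × PureProlongation.Chains (Pi.single l 2), PureProlongation.inputDeriv p.2 l 0 ≠ 0 →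
        PureProlongation.P2FlatAt (PureProlongation.driftless (𝓡 n) g) (Pi.single l 2) p ∧
        (∀ y : Fin m → X × PureProlongation.Chains (Pi.single l 2) → ℝ,
          PureProlongation.IsFlatOutputAt (PureProlongation.driftless (𝓡 n) g)
              (Pi.single l 2) p y ↔
            ∃ σ : Equiv.Perm (Fin m), PureProlongation.OutputEquationsEven g l (y ∘ σ) p)) ∧
      PureProlongation.NoShorterProlongation (PureProlongation.driftless (𝓡 n) g)
        (Pi.single l 2)) := by
  have hfin : Module.finrank ℝ (EuclideanSpace ℝ (Fin n)) = n := finrank_euclideanSpace_fin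
  refine ⟨fun hn hinv hrank => ⟨fun p hu => ⟨?_, fun y => ⟨?_, ?_⟩⟩, ?_⟩,
    fun hn hinv hinv' hrank htop => ⟨fun p hu => ⟨?_, fun y => ⟨?_, ?_⟩⟩, ?_⟩⟩
  · obtain ⟨y, hy⟩ := PureProlongation.exists_outputEquationsOdd hg (hfin.trans hn) hinv hrank p
    obtain ⟨L, -⟩ := PureProlongation.isFlatOutputAt_of_outputEquationsOdd hg (hfin.trans hn) hrank
      hu hy
    exact ⟨L⟩
  · exact PureProlongation.outputEquationsOdd_of_isFlatOutputAt hg (hfin.trans hn) hrank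
  · exact PureProlongation.isFlatOutputAt_of_outputEquationsOdd hg (hfin.trans hn) hrank hu
  · intro j' hj' p hp
    rw [PureProlongation.sum_single] at hj'
    have h := PureProlongation.finrank_add_le_of_P2FlatAt l hg
      (Or.inl fun x => PureProlongation.H12'_eq_top (hfin.trans hn) (hrank x)) hp
    -- Without prolongation the dimension bound reads `2m - 1 ≤ m`, which fails for `m ≥ 2`.
    rw [show ∑ i, j' i = 0 by omega, hfin] at h
    omega
  · obtain ⟨y, L, -⟩ := PureProlongation.exists_isFlatOutputAt_two hm hg (hfin.trans hn) hinv hinv'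
      hrank htop p hu
    exact ⟨L⟩
  · exact PureProlongation.exists_outputEquationsEven_of_isFlatOutputAt hm hg (hfin.trans hn) hrank
      htop hu
  · rintro ⟨σ, hσ⟩
    exact PureProlongation.isFlatOutputAt_of_outputEquationsEven hm hg (hfin.trans hn) hrank hu σ hσ
  · intro j' hj' p hp
    rw [PureProlongation.sum_single] at hj'
    have h := PureProlongation.finrank_add_le_of_P2FlatAt l hg (Or.inr htop) hp
    rw [hfin] at h
    -- The dimension bound reads `2m ≤ m` or `2m + 1 ≤ 2m` in the two cases.
    have : ∑ i, j' i = 0 ∨ ∑ i, j' i = 1 := by omega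
    rcases this with h' | h' <;> rw [h'] at h <;> omega
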